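/- **Wyner–Ziv code.** Let $\mathcal X,\mathcal Y$ be finite, $(x_i,y_i)_{i\ge1}$ i.i.d. with law $P_{X,Y}$, $P_{Z|X}$ a conditional distribution from $\mathcal X$ to $\mathbb F_2$, and $(X,Y,Z)\sim P_{X,Y}P_{Z|X}$. Logarithms are to base $2$ and $H_b$ is the binary entropy function. Let $R<1$, $k=\lfloor nR\rfloor$, let $\mathbf H$ be uniform on the invertible matrices in $\mathbb F_2^{n\times n}$, and let $\mathbf q=[q_1,\dots,q_{n-k}]$ be i.i.d. with law $P_Q$, a distribution on $[0,1]$ with finite support and symmetric about $1/2$; the source, $\mathbf H$ and $\mathbf q$ are independent. For $\mathbf a\in[0,1]^n$, $\mathbf u\in\mathbb F_2^n$ put $w_{\mathbf a}(\mathbf u)=\prod_{i=1}^n a_i^{u_i}(1-a_i)^{1-u_i}$, and let $f_{\mathbf H}(\mathbf p,\mathbf a)$ be a maximizer of $\mathbf z\mapsto w_{\mathbf p}(\mathbf z)\,w_{\mathbf a}(\mathbf z\mathbf H^T)$ over $\mathbf z\in\mathbb F_2^n$, ties being broken by any rule that depends on $(\mathbf H,\mathbf p,\mathbf a)$ only.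 With $p_e(x)=P_{Z|X}(1|x)$ and $p_d(y)=P_{Z|Y}(1|y)$, the encoder computes $\mathbf z=f_{\mathbf H}([p_e(x_1),\dots,p_e(x_n)],[\tfrac12,\dots,\tfrac12,\mathbf q])$ and sends the first $k$ bits $\mathbf m$ of $\mathbf z\mathbf H^T$; the decoder outputs $\hat{\mathbf z}=f_{\mathbf H}([p_d(y_1),\dots,p_d(y_n)],[\mathbf m,\mathbf q])$. **Corollary.** Suppose that $$\mathbf E[H_b(Q)]=1-\frac{H(Z|X)}{1-R},\qquad Q\sim P_Q,$$ and that it is not the case that $H(Z|X)>0$ while all the numbers $P_{Z|X}(1|x)$ with $P_X(x)>0$ and all points of the support of $P_Q$ lie in $\{0,\tfrac12,1\}$. If $I(X;Z|Y)<R<1$, then, as $n\to\infty$, the empirical joint distribution of $\{(x_i,\hat z_i)\}_{i=1,\dots,n}$ tends to $P_XP_{Z|X}$ in probability. In particular, the code, of rate $R$, achieves the Wyner–Ziv trade-off for $P_{Z|X}$: for every $d:\mathcal X\times\mathbb F_2\to\mathbb R$, $$\frac1n\,\mathbf E\Big[\sum_{i=1}^n d(x_i,\hat z_i)\Big]\to\mathbf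 E[d(X,Z)].$$ -/

import Mathlib

open Filter Topology Matrix

noncomputable section

namespace WPC

/-! ### Laws and information measures on finite alphabets (logarithms to base 2) -/

section Information

variable {A B C : Type*} [Fintype A] [Fintype B] [Fintype C]

/-- First marginal of a joint law. -/
def margFst (p : A × B → ℝ) (a : A) : ℝ := ∑ b, p (a, b)

/-- Second marginal of a joint law. -/
def margSnd (p : A × B → ℝ) (b : B) : ℝ := ∑ a, p (a, b)

/-- Conditional entropy `H(B | A) = - ∑ p(a,b) log₂ p(b | a)` in bits, for `(A, B) ∼ p`. -/
def condEntropy (p : A × B → ℝ) : ℝ :=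
  -∑ a, ∑ b, p (a, b) * Real.logb 2 (p (a, b) / margFst p a)

/-- Conditional mutual information
`I(A; C | B) = ∑ p(a,b,c) log₂ (p(a,b,c) p(b) / (p(a,b) p(b,c)))` in bits,
for `(A, B, C) ∼ p`. Terms with `p(a,b,c) = 0` vanish. -/
def condMutualInfo (p : A × B × C → ℝ) : ℝ :=
  ∑ a, ∑ b, ∑ c, p (a, b, c) *
    Real.logb 2 ((p (a, b, c) * ∑ a', ∑ c', p (a', b, c')) /
      ((∑ c', p (a, b, c')) * ∑ a', p (a', b, c)))

end Information

/-- Binary entropy function in bits. -/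
def Hb (t : ℝ) : ℝ := Real.binEntropy t / Real.log 2

/-! ### The single-letter laws: `(X, Y) ∼ P` and `Z | X ∼ W`, with `Z` binary and `Z - X - Y` -/

section SingleLetter

variable {X Y : Type*} [Fintype X] [Fintype Y]

/-- Joint law of `(X, Y, Z)`. -/
def lawXYZ (P : X × Y → ℝ) (W : X → ZMod 2 → ℝ) : X × Y × ZMod 2 → ℝ :=
  fun t => P (t.1, t.2.1) * W t.1 t.2.2

/-- Joint law `P_X P_{Z|X}` of `(X, Z)`. -/
def lawXZ (P : X × Y → ℝ) (W : X → ZMod 2 → ℝ) : X × ZMod 2 → ℝ :=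
  fun t => margFst P t.1 * W t.1 t.2

/-- Joint law of `(Y, Z)`. -/
def lawYZ (P : X × Y → ℝ) (W : X → ZMod 2 → ℝ) : Y × ZMod 2 → ℝ :=
  fun t => ∑ x, P (x, t.1) * W x t.2

/-- Encoder bias `p_e(x) = P_{Z|X}(1|x)`. -/
def encBias (W : X → ZMod 2 → ℝ) (x : X) : ℝ := W x 1

/-- Decoder bias `p_d(y) = P_{Z|Y}(1|y)` (with value `0` at a letter `y` of probability `0`). -/
def decBias (P : X × Y → ℝ) (W : X → ZMod 2 → ℝ) (y : Y) : ℝ :=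
  lawYZ P W (y, 1) / margSnd P y

end SingleLetter

/-- A parity bias distribution: a finitely supported probability distribution on `[0, 1]`
(`PQ q` is the mass of `q`) that is symmetric about `1 / 2`. -/
structure IsParityBiasLaw (PQ : ℝ →₀ ℝ) : Prop where
  nonneg : ∀ q, 0 ≤ PQ q
  sum_eq_one : (PQ.sum fun _ w => w) = 1
  mem_Icc : ∀ q ∈ PQ.support, q ∈ Set.Icc (0 : ℝ) 1
  symm : ∀ q, PQ (1 - q) = PQ q

/-! ### Weighted parity-check codes -/

/-- The `q`-weight `w_q(u) = ∏ i, q_i ^ u_i (1 - q_i) ^ (1 - u_i)` of a binary vector. -/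
def weight {n : ℕ} (q : Fin n → ℝ) (u : Fin n → ZMod 2) : ℝ :=
  ∏ i, q i ^ (u i).val * (1 - q i) ^ (1 - (u i).val)

/-- `f` is a query function `f_H(p, q) = argmax_z w_p(z) w_q(z Hᵀ)` at block length `n`;
ties are broken in an arbitrary way that depends on `(H, p, q)` only. -/
def IsQuery {n : ℕ}
    (f : GL (Fin n) (ZMod 2) → (Fin n → ℝ) → (Fin n → ℝ) → (Fin n → ZMod 2)) : Prop :=
  ∀ (H : GL (Fin n) (ZMod 2)) (p q : Fin n → ℝ),
    (∀ i, p i ∈ Set.Icc (0 : ℝ) 1) → (∀ i, q i ∈ Set.Icc (0 : ℝ) 1) →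
    ∀ z : Fin n → ZMod 2,
      weight p z * weight q (z ᵥ* (H : Matrix (Fin n) (Fin n) (ZMod 2))ᵀ) ≤
        weight p (f H p q) *
          weight q (f H p q ᵥ* (H : Matrix (Fin n) (Fin n) (ZMod 2))ᵀ)

/-- The concatenation `[a, b]` of vectors of lengths `k` and `n - k`. -/
def concat {n k : ℕ} (a : Fin k → ℝ) (b : Fin (n - k) → ℝ) : Fin n → ℝ :=
  fun i => if h : (i : ℕ) < k then a ⟨i, h⟩ else b ⟨i - k, by omega⟩

/-- The message length `k = ⌊n R⌋`. -/
def msgLen (R : ℝ) (n : ℕ) : ℕ := ⌊(n : ℝ) * R⌋₊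

theorem msgLen_le {R : ℝ} (hR : R < 1) (n : ℕ) : msgLen R n ≤ n := by
  unfold msgLen
  calc ⌊(n : ℝ) * R⌋₊ ≤ ⌊(n : ℝ)⌋₊ :=
        Nat.floor_le_floor (by nlinarith [(Nat.cast_nonneg n : (0 : ℝ) ≤ n)])
    _ = n := Nat.floor_natCast n

section Code

variable {X Y : Type*} [Fintype X] [Fintype Y] {n k : ℕ}
  (f : GL (Fin n) (ZMod 2) → (Fin n → ℝ) → (Fin n → ℝ) → (Fin n → ZMod 2))

/-- The codeword `z = f_H([p_e(x_1), …, p_e(x_n)], [1/2, …, 1/2, q])` found by the encoder. -/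
def encWord (pe : X → ℝ) (H : GL (Fin n) (ZMod 2)) (q : Fin (n - k) → ℝ) (x : Fin n → X) :
    Fin n → ZMod 2 :=
  f H (fun i => pe (x i)) (concat (fun _ : Fin k => (1 / 2 : ℝ)) q)

/-- The message `m`: the first `k` bits of `z Hᵀ`. -/
def encode (hk : k ≤ n) (pe : X → ℝ) (H : GL (Fin n) (ZMod 2)) (q : Fin (n - k) → ℝ)
    (x : Fin n → X) : Fin k → ZMod 2 :=
  fun i => (encWord f pe H q x ᵥ* (H : Matrix (Fin n) (Fin n) (ZMod 2))ᵀ) (Fin.castLE hk i)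

/-- The reconstruction `ẑ = f_H([p_d(y_1), …, p_d(y_n)], [m, q])` of the decoder. -/
def decode (pd : Y → ℝ) (H : GL (Fin n) (ZMod 2)) (q : Fin (n - k) → ℝ)
    (m : Fin k → ZMod 2) (y : Fin n → Y) : Fin n → ZMod 2 :=
  f H (fun i => pd (y i)) (concat (fun i : Fin k => ((m i).val : ℝ)) q)

/-- The reconstruction `ẑ` as a function of the source block `s_i = (x_i, y_i)`, the full parity
check matrix and the parity biases, for the Wyner–Ziv code with `p_e = P_{Z|X}(1|·)` and
`p_d = P_{Z|Y}(1|·)`. -/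
def reconstruct (hk : k ≤ n) (P : X × Y → ℝ) (W : X → ZMod 2 → ℝ)
    (s : Fin n → X × Y) (H : GL (Fin n) (ZMod 2)) (q : Fin (n - k) → ℝ) : Fin n → ZMod 2 :=
  decode f (decBias P W) H q
    (encode f hk (encBias W) H q fun i => (s i).1) fun i => (s i).2

end Code

/-! ### The random experiment at block length `n` -/

section Experiment

variable {X Y : Type*} [Fintype X] [Fintype Y]

/-- Expectation of `F (s, H, q)`, where `s_1, …, s_n` are i.i.d. with law `P`, `H` is uniform on
the invertible binary `n × n` matrices, `q_1, …, q_{n-k}` are i.i.d. with law `PQ`, and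
`s`, `H`, `q` are independent. -/
def expect (P : X × Y → ℝ) (PQ : ℝ →₀ ℝ) (n k : ℕ)
    (F : (Fin n → X × Y) → GL (Fin n) (ZMod 2) → (Fin (n - k) → ℝ) → ℝ) : ℝ :=
  ∑ s : Fin n → X × Y, ∑ H : GL (Fin n) (ZMod 2),
    ∑ q ∈ Fintype.piFinset (fun _ : Fin (n - k) => PQ.support),
      (∏ i, P (s i)) * (Fintype.card (GL (Fin n) (ZMod 2)) : ℝ)⁻¹ * (∏ j, PQ (q j)) * F s H q

open Classical in
/-- Probability of the event `E (s, H, q)` in the same experiment. -/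
def prob (P : X × Y → ℝ) (PQ : ℝ →₀ ℝ) (n k : ℕ)
    (E : (Fin n → X × Y) → GL (Fin n) (ZMod 2) → (Fin (n - k) → ℝ) → Prop) : ℝ :=
  expect P PQ n k fun s H q => if E s H q then 1 else 0

open Classical in
/-- Empirical joint distribution of `(x_i, z_i)`, `i = 1, …, n`. -/
def empirical {n : ℕ} (x : Fin n → X) (z : Fin n → ZMod 2) (a : X) (b : ZMod 2) : ℝ :=
  ((Finset.univ.filter fun i => x i = a ∧ z i = b).card : ℝ) / n

end Experiment

end WPC

end

/-! Call a word heavy if its encoder weight is at least `threshold n δ`, that is `2 ^ (-n(1+δ))`.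
For an ideal pair `(z, u)`, drawn with `z_i` of bias `p_e(x_i)` and `u` of biases `[1/2, …, 1/2,
q]`, the mean of `-log₂` of the weight is about `n H(Z|X) + k + (n-k) E[H_b(Q)]`, and the condition
on `P_Q` makes this about `n`. So there are about `2 ^ n` typical pairs, and a uniform invertible
matrix puts a given one on its graph `{(z, z Hᵀ)}` with probability about `2 ^ (-n)`. The code works
exactly at this critical density, and the proof excludes four bad events.

No heavy word exists (`negl_no_heavy`). At critical density a second-moment argument needs slack.
The biases are tilted slightly towards `1/2` on their support: the entropy of the pair rises above
`n(1+γ)`, so there are exponentially more than `2 ^ n` candidates, while the original weight loses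
only a factor `2 ^ (-nδ)`. The gain is strict once some bias is outside `{0, 1/2, 1}`. If `H(Z|X) =
0`, all parity biases are `1/2` and the word determined by `x` is heavy for every `H`.

A nonzero heavy word is atypical (`negl_heavy_atypical`). An event of ideal probability `2 ^ (-nρ)`
contains at most `2 ^ (n(1+δ-ρ))` heavy pairs, and each is hit with probability at most `2 / 2 ^ n`.

The zero word is heavy and atypical (`exists_negl_zero_atypical`). It is sent to zero by every `H`,
so the randomness of the matrix gives nothing and the biases must be used.

Two different words are heavy, one for the encoder and one for the decoder that knows its message
(`negl_confusion`). A typical heavy word has decoder weight about `2 ^ (-n(H(Z|Y) + (1-R)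
E[H_b(Q)])) = 2 ^ (-n(1-2c))`, with `2c = R - I(X;Z|Y)`. At most `2 ^ (n(1-c))` pairs have decoder
weight `2 ^ (-n(1-c))` or more, so a wrong one is rarely hit.

Outside these events the encoder's word is typical and is the decoder's maximizer, so `ẑ = z`
(`negl_empirical`). Distortion is a linear function of the bounded empirical law, which gives the
convergence of expectations (`tendsto_expect_distortion`). -/

noncomputable section

namespace WPC

/-! ### Uniform invertible matrices acting on binary vectors -/

section Counting

variable {n : ℕ}

/-- The parity vector `z Hᵀ`. -/
def parity (H : GL (Fin n) (ZMod 2)) (z : Fin n → ZMod 2) : Fin n → ZMod 2 :=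
  z ᵥ* (H : Matrix (Fin n) (Fin n) (ZMod 2))ᵀ

theorem parity_eq_mulVec (H : GL (Fin n) (ZMod 2)) (z : Fin n → ZMod 2) :
    parity H z = (H : Matrix (Fin n) (Fin n) (ZMod 2)) *ᵥ z := by
  simp [parity, Matrix.vecMul_transpose]

theorem parity_mul (g H : GL (Fin n) (ZMod 2)) (z : Fin n → ZMod 2) :
    parity (g * H) z = parity g (parity H z) := by
  simp [parity_eq_mulVec, Matrix.mulVec_mulVec]

theorem parity_one (z : Fin n → ZMod 2) : parity 1 z = z := by
  simp [parity_eq_mulVec]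

theorem parity_zero (H : GL (Fin n) (ZMod 2)) : parity H 0 = 0 := by
  simp [parity_eq_mulVec]

theorem parity_injective (H : GL (Fin n) (ZMod 2)) : Function.Injective (parity H) := by
  intro a b h
  have := congrArg (parity H⁻¹) h
  simpa [← parity_mul, parity_one] using this

theorem parity_eq_zero (H : GL (Fin n) (ZMod 2)) (z : Fin n → ZMod 2) :
    parity H z = 0 ↔ z = 0 := by
  constructor
  · intro h
    exact parity_injective H (h.trans (parity_zero H).symm)
  · rintro rfl
    exact parity_zero H

theorem exists_parity_of_linearEquiv (e : (Fin n → ZMod 2) ≃ₗ[ZMod 2] (Fin n → ZMod 2)) :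
    ∃ g : GL (Fin n) (ZMod 2), ∀ z, parity g z = e z := by
  refine ⟨⟨LinearMap.toMatrix' e.toLinearMap, LinearMap.toMatrix' e.symm.toLinearMap, ?_, ?_⟩, ?_⟩
  · rw [← LinearMap.toMatrix'_comp]; simp
  · rw [← LinearMap.toMatrix'_comp]; simp
  · intro z
    rw [parity_eq_mulVec]
    simp [← Matrix.toLin'_apply]

theorem linearIndependent_pair_zmod_two {u v : Fin n → ZMod 2} (hu : u ≠ 0) (hv : v ≠ 0)
    (huv : u ≠ v) : LinearIndependent (ZMod 2) ![u, v] := by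
  rw [LinearIndependent.pair_iff' hu]
  intro a ha
  have h01 : ∀ b : ZMod 2, b = 0 ∨ b = 1 := by decide
  rcases h01 a with rfl | rfl
  · exact hv (by simpa using ha.symm)
  · exact huv (by simpa using ha)

/-- Distinct nonzero vectors over `𝔽₂` are linearly independent, since the only scalars are `0` and
`1`; hence `GL` acts transitively on such ordered pairs. -/
theorem exists_parity_pair {u v u' v' : Fin n → ZMod 2} (hu : u ≠ 0) (hv : v ≠ 0)
    (huv : u ≠ v) (hu' : u' ≠ 0) (hv' : v' ≠ 0) (huv' : u' ≠ v') :
    ∃ g : GL (Fin n) (ZMod 2), parity g u = u' ∧ parity g v = v' := by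
  have hD := linearIndependent_pair_zmod_two hu hv huv
  have hE := linearIndependent_pair_zmod_two hu' hv' huv'
  -- An isomorphism between the two spans, which then extends to an automorphism of the whole space.
  let f := hD.linearCombinationEquiv.symm ≪≫ₗ hE.linearCombinationEquiv
  obtain ⟨e, he⟩ := Submodule.exists_linearEquiv_restrict_eq f
  obtain ⟨g, hg⟩ := exists_parity_of_linearEquiv e
  have q0 : ((hD.linearCombinationEquiv (Finsupp.single 0 1)) : Fin n → ZMod 2) = u := by simp
  have q1 : ((hD.linearCombinationEquiv (Finsupp.single 1 1)) : Fin n → ZMod 2) = v := by simp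
  refine ⟨g, ?_, ?_⟩
  · rw [hg, ← q0, ← he]; simp [f]
  · rw [hg, ← q1, ← he]; simp [f]

-- Transitivity makes all fibres of `H ↦ (z Hᵀ, z' Hᵀ)` over ordered pairs of distinct nonzero
-- vectors equally large: left multiplication by a suitable `g` carries one fibre onto another. So
-- the image pair is uniform.
open Classical in
theorem card_parity_pair {z z' u u' : Fin n → ZMod 2} (hz : z ≠ 0) (hz' : z' ≠ 0)
    (hzz : z ≠ z') (hu : u ≠ 0) (hu' : u' ≠ 0) (huu : u ≠ u') :
    (Finset.univ.filter fun H : GL (Fin n) (ZMod 2) => parity H z = u ∧ parity H z' = u').card *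
      ((2 ^ n - 1) * (2 ^ n - 2)) = Fintype.card (GL (Fin n) (ZMod 2)) := by
  set S : Finset (Fin n → ZMod 2) := Finset.univ.filter (· ≠ 0) with hS
  have hScard : S.card = 2 ^ n - 1 := by
    rw [hS, Finset.filter_ne' Finset.univ 0, Finset.card_erase_of_mem (Finset.mem_univ _)]
    simp [ZMod.card]
  have hoff : S.offDiag.card = (2 ^ n - 1) * (2 ^ n - 2) := by
    rw [Finset.offDiag_card, hScard, show 2 ^ n - 2 = (2 ^ n - 1) - 1 by omega]
    generalize 2 ^ n - 1 = m
    rw [Nat.mul_sub_one]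
  have hmap : ∀ H ∈ (Finset.univ : Finset (GL (Fin n) (ZMod 2))),
      (parity H z, parity H z') ∈ S.offDiag := by
    intro H _
    simp only [Finset.mem_offDiag, hS, Finset.mem_filter, Finset.mem_univ, true_and, ne_eq,
      parity_eq_zero]
    exact ⟨hz, hz', fun h => hzz (parity_injective H h)⟩
  have hfib := Finset.card_eq_sum_card_fiberwise hmap
  rw [Finset.card_univ] at hfib
  rw [hfib, Finset.sum_const_nat (m := (Finset.univ.filter fun H : GL (Fin n) (ZMod 2) =>
    parity H z = u ∧ parity H z' = u').card), hoff, mul_comm]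
  rintro ⟨v, v'⟩ hv
  simp only [Finset.mem_offDiag, hS, Finset.mem_filter, Finset.mem_univ, true_and] at hv
  obtain ⟨g, hg, hg'⟩ := exists_parity_pair hu hu' huu hv.1 hv.2.1 hv.2.2
  symm
  refine Finset.card_bij (fun H _ => g * H) ?_ ?_ ?_
  · intro H hH
    simp only [Finset.mem_filter, Finset.mem_univ, true_and] at hH ⊢
    rw [parity_mul, parity_mul, hH.1, hH.2, hg, hg']
  · intro a _ b _ h
    exact mul_left_cancel h
  · intro H hH
    simp only [Finset.mem_filter, Finset.mem_univ, true_and, Prod.mk.injEq] at hH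
    refine ⟨g⁻¹ * H, ?_, by simp⟩
    simp only [Finset.mem_filter, Finset.mem_univ, true_and]
    rw [parity_mul, parity_mul, hH.1, hH.2, ← hg, ← hg', ← parity_mul, ← parity_mul]
    simp [parity_one]

open Classical in
theorem card_parity {z u : Fin n → ZMod 2} (hz : z ≠ 0) (hu : u ≠ 0) :
    (Finset.univ.filter fun H : GL (Fin n) (ZMod 2) => parity H z = u).card *
      (2 ^ n - 1) = Fintype.card (GL (Fin n) (ZMod 2)) := by
  set S : Finset (Fin n → ZMod 2) := Finset.univ.filter (· ≠ 0) with hS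
  have hScard : S.card = 2 ^ n - 1 := by
    rw [hS, Finset.filter_ne' Finset.univ 0, Finset.card_erase_of_mem (Finset.mem_univ _)]
    simp [ZMod.card]
  have hmap : ∀ H ∈ (Finset.univ : Finset (GL (Fin n) (ZMod 2))), parity H z ∈ S := by
    intro H _
    simpa [hS, parity_eq_zero] using hz
  have hfib := Finset.card_eq_sum_card_fiberwise hmap
  rw [Finset.card_univ] at hfib
  rw [hfib, Finset.sum_const_nat (m := (Finset.univ.filter fun H : GL (Fin n) (ZMod 2) =>
    parity H z = u).card), hScard, mul_comm]
  intro v hv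
  simp only [hS, Finset.mem_filter, Finset.mem_univ, true_and] at hv
  have hex : ∃ g : GL (Fin n) (ZMod 2), parity g u = v := by
    by_cases h : ∃ w : Fin n → ZMod 2, w ≠ 0 ∧ w ≠ u
    · by_cases huv : u = v
      · exact ⟨1, by rw [parity_one, huv]⟩
      · obtain ⟨g, hg, -⟩ := exists_parity_pair hu hv huv hv hu (Ne.symm huv)
        exact ⟨g, hg⟩
    -- Here `u` is the only nonzero vector, so `v = u` and the identity works.
    · push Not at h
      exact ⟨1, by rw [parity_one, h v hv]⟩
  obtain ⟨g, hg⟩ := hex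
  symm
  refine Finset.card_bij (fun H _ => g * H) ?_ ?_ ?_
  · intro H hH
    simp only [Finset.mem_filter, Finset.mem_univ, true_and] at hH ⊢
    rw [parity_mul, hH, hg]
  · intro a _ b _ h
    exact mul_left_cancel h
  · intro H hH
    simp only [Finset.mem_filter, Finset.mem_univ, true_and] at hH
    refine ⟨g⁻¹ * H, ?_, by simp⟩
    simp only [Finset.mem_filter, Finset.mem_univ, true_and]
    rw [parity_mul, hH, ← hg, ← parity_mul]
    simp [parity_one]

end Counting

/-! ### Indicators and averages over the parity check matrix -/

open Classical in
/-- Real-valued indicator of a proposition. -/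
def ind (p : Prop) : ℝ := if p then 1 else 0

theorem ind_true {p : Prop} (h : p) : ind p = 1 := if_pos h

theorem ind_false {p : Prop} (h : ¬p) : ind p = 0 := if_neg h

theorem ind_nonneg (p : Prop) : 0 ≤ ind p := by
  unfold ind; split_ifs <;> norm_num

theorem ind_le_one (p : Prop) : ind p ≤ 1 := by
  unfold ind; split_ifs <;> norm_num

theorem ind_mono {p q : Prop} (h : p → q) : ind p ≤ ind q := by
  by_cases hp : p
  · rw [ind_true hp, ind_true (h hp)]
  · rw [ind_false hp]; exact ind_nonneg q

theorem ind_or_le (p q : Prop) : ind (p ∨ q) ≤ ind p + ind q := by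
  by_cases hp : p
  · rw [ind_true hp, ind_true (Or.inl hp)]; linarith [ind_nonneg q]
  · rw [ind_false hp, zero_add]; exact ind_mono (fun h => h.resolve_left hp)

theorem ind_and (p q : Prop) : ind (p ∧ q) = ind p * ind q := by
  by_cases hp : p <;> by_cases hq : q <;> simp [ind, hp, hq]

theorem ind_exists_le {ι : Type*} [Fintype ι] (p : ι → Prop) : ind (∃ i, p i) ≤ ∑ i, ind (p i) := by
  by_cases h : ∃ i, p i
  · obtain ⟨i, hi⟩ := h
    rw [ind_true ⟨i, hi⟩, ← ind_true hi]
    exact Finset.single_le_sum (f := fun i => ind (p i)) (fun i _ => ind_nonneg _)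
      (Finset.mem_univ i)
  · rw [ind_false h]
    exact Finset.sum_nonneg fun i _ => ind_nonneg _

section Average

variable {n : ℕ}

/-- Average over the uniform invertible matrix. -/
def avgGL (F : GL (Fin n) (ZMod 2) → ℝ) : ℝ :=
  (Fintype.card (GL (Fin n) (ZMod 2)) : ℝ)⁻¹ * ∑ H, F H

theorem card_GL_pos : (0 : ℝ) < Fintype.card (GL (Fin n) (ZMod 2)) := by
  exact_mod_cast Fintype.card_pos

theorem avgGL_mono {F G : GL (Fin n) (ZMod 2) → ℝ} (h : ∀ H, F H ≤ G H) : avgGL F ≤ avgGL G :=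
  mul_le_mul_of_nonneg_left (Finset.sum_le_sum fun H _ => h H) (inv_nonneg.2 card_GL_pos.le)

theorem avgGL_sum {ι : Type*} (s : Finset ι) (F : ι → GL (Fin n) (ZMod 2) → ℝ) :
    avgGL (fun H => ∑ i ∈ s, F i H) = ∑ i ∈ s, avgGL (F i) := by
  unfold avgGL
  rw [Finset.sum_comm, Finset.mul_sum]

theorem avgGL_add (F G : GL (Fin n) (ZMod 2) → ℝ) :
    avgGL (fun H => F H + G H) = avgGL F + avgGL G := by
  simp [avgGL, Finset.sum_add_distrib, mul_add]

theorem avgGL_sub (F G : GL (Fin n) (ZMod 2) → ℝ) :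
    avgGL (fun H => F H - G H) = avgGL F - avgGL G := by
  simp [avgGL, mul_sub]

theorem avgGL_mul_const (F : GL (Fin n) (ZMod 2) → ℝ) (c : ℝ) :
    avgGL (fun H => F H * c) = avgGL F * c := by
  simp [avgGL, ← Finset.sum_mul, mul_assoc]

theorem avgGL_const (c : ℝ) : avgGL (fun _ : GL (Fin n) (ZMod 2) => c) = c := by
  have := (card_GL_pos (n := n)).ne'
  simp only [avgGL, Finset.sum_const, Finset.card_univ, nsmul_eq_mul]
  field_simp

theorem avgGL_ind (p : GL (Fin n) (ZMod 2) → Prop) [DecidablePred p] :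
    avgGL (fun H => ind (p H)) = (Fintype.card (GL (Fin n) (ZMod 2)) : ℝ)⁻¹ *
      (Finset.univ.filter p).card := by
  simp only [avgGL, ind]
  congr 1
  rw [Finset.card_filter, Nat.cast_sum]
  refine Finset.sum_congr rfl fun H _ => ?_
  by_cases h : p H <;> simp [h]

theorem exists_pos_of_ne_zero {z : Fin n → ZMod 2} (hz : z ≠ 0) : 1 ≤ n := by
  rcases Nat.eq_zero_or_pos n with rfl | h
  · exact absurd (Subsingleton.elim z 0) hz
  · exact h

theorem two_le_of_ne {z z' : Fin n → ZMod 2} (hz : z ≠ 0) (hz' : z' ≠ 0) (h : z ≠ z') :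
    2 ≤ n := by
  rcases Nat.lt_or_ge n 2 with h2 | h2
  · have h1 : n = 1 := by have := exists_pos_of_ne_zero hz; omega
    subst h1
    have key : ∀ w : Fin 1 → ZMod 2, w ≠ 0 → w = 1 := by decide
    exact absurd ((key z hz).trans (key z' hz').symm) h
  · exact h2

theorem avgGL_parity {z u : Fin n → ZMod 2} (hz : z ≠ 0) (hu : u ≠ 0) :
    avgGL (fun H => ind (parity H z = u)) = ((2 : ℝ) ^ n - 1)⁻¹ := by
  classical
  have h := card_parity hz hu
  have hn := exists_pos_of_ne_zero hz
  have h2 : (2 : ℝ) ^ n - 1 = ((2 ^ n - 1 : ℕ) : ℝ) := by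
    rw [Nat.cast_sub Nat.one_le_two_pow]; simp
  have hpos : 0 < 2 ^ n - 1 := by
    have : 2 ^ 1 ≤ 2 ^ n := Nat.pow_le_pow_right (by norm_num) hn
    omega
  have hG := (card_GL_pos (n := n)).ne'
  have hpos' : ((2 ^ n - 1 : ℕ) : ℝ) ≠ 0 := by exact_mod_cast hpos.ne'
  rw [avgGL_ind, h2]
  rw [← h] at hG ⊢
  rw [Nat.cast_mul] at hG ⊢
  have := left_ne_zero_of_mul hG
  field_simp

/-- The loose constant `2` replaces `1 / (2 ^ n - 1)` and lets the first-moment bounds ignore that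
`u = 0` is never hit. -/
theorem avgGL_parity_le {z : Fin n → ZMod 2} (hz : z ≠ 0) (u : Fin n → ZMod 2) :
    avgGL (fun H => ind (parity H z = u)) ≤ 2 / 2 ^ n := by
  by_cases hu : u = 0
  · have : (fun H : GL (Fin n) (ZMod 2) => ind (parity H z = u)) = fun _ => 0 := by
      funext H
      rw [hu, parity_eq_zero, ind_false hz]
    rw [this, avgGL_const]
    positivity
  · rw [avgGL_parity hz hu]
    have hn := exists_pos_of_ne_zero hz
    have : (2 : ℝ) ^ 1 ≤ 2 ^ n := pow_le_pow_right₀ (by norm_num) hn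
    rw [inv_eq_one_div, div_le_div_iff₀ (by linarith) (by linarith)]
    linarith

theorem avgGL_parity_pair {z z' u u' : Fin n → ZMod 2} (hz : z ≠ 0) (hz' : z' ≠ 0)
    (hzz : z ≠ z') (hu : u ≠ 0) (hu' : u' ≠ 0) (huu : u ≠ u') :
    avgGL (fun H => ind (parity H z = u ∧ parity H z' = u')) =
      (((2 : ℝ) ^ n - 1) * (2 ^ n - 2))⁻¹ := by
  classical
  have h := card_parity_pair hz hz' hzz hu hu' huu
  have hn := two_le_of_ne hz hz' hzz
  have hp : 2 ^ 2 ≤ 2 ^ n := Nat.pow_le_pow_right (by norm_num) hn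
  have h2 : ((2 : ℝ) ^ n - 1) * (2 ^ n - 2) = (((2 ^ n - 1) * (2 ^ n - 2) : ℕ) : ℝ) := by
    rw [Nat.cast_mul, Nat.cast_sub (by omega), Nat.cast_sub (by omega)]; simp
  have hpos : 0 < (2 ^ n - 1) * (2 ^ n - 2) := Nat.mul_pos (by omega) (by omega)
  have hG := (card_GL_pos (n := n)).ne'
  have hpos' : (((2 ^ n - 1) * (2 ^ n - 2) : ℕ) : ℝ) ≠ 0 := by exact_mod_cast hpos.ne'
  rw [avgGL_ind, h2]
  rw [← h] at hG ⊢
  rw [Nat.cast_mul] at hG ⊢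
  have := left_ne_zero_of_mul hG
  field_simp

theorem avgGL_parity_pair_le' {z z' : Fin n → ZMod 2} (hz : z ≠ 0) (hz' : z' ≠ 0)
    (hzz : z ≠ z') (u u' : Fin n → ZMod 2) :
    avgGL (fun H => ind (parity H z = u ∧ parity H z' = u')) ≤
      (((2 : ℝ) ^ n - 1) * (2 ^ n - 2))⁻¹ := by
  by_cases hu : u ≠ 0 ∧ u' ≠ 0 ∧ u ≠ u'
  · rw [avgGL_parity_pair hz hz' hzz hu.1 hu.2.1 hu.2.2]
  · have : (fun H : GL (Fin n) (ZMod 2) => ind (parity H z = u ∧ parity H z' = u')) =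
        fun _ => 0 := by
      funext H
      apply ind_false
      rintro ⟨rfl, rfl⟩
      apply hu
      simp only [ne_eq, parity_eq_zero]
      exact ⟨hz, hz', fun h => hzz (parity_injective H h)⟩
    rw [this, avgGL_const]
    have hn := two_le_of_ne hz hz' hzz
    have : (2 : ℝ) ^ 2 ≤ 2 ^ n := pow_le_pow_right₀ (by norm_num) hn
    exact inv_nonneg.2 (mul_nonneg (by linarith) (by linarith))

theorem avgGL_parity_pair_le {z z' : Fin n → ZMod 2} (hz : z ≠ 0) (hz' : z' ≠ 0)
    (hzz : z ≠ z') (u u' : Fin n → ZMod 2) :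
    avgGL (fun H => ind (parity H z = u ∧ parity H z' = u')) ≤ (2 / 2 ^ n) * (2 / 2 ^ n) := by
  refine (avgGL_parity_pair_le' hz hz' hzz u u').trans ?_
  have hn := two_le_of_ne hz hz' hzz
  have : (2 : ℝ) ^ 2 ≤ 2 ^ n := pow_le_pow_right₀ (by norm_num) hn
  rw [div_mul_div_comm, inv_eq_one_div, div_le_div_iff₀ (mul_pos (by linarith) (by linarith))
    (by positivity)]
  nlinarith

/-- Expanding over the value of `x` separates the random vector `z Hᵀ` from the test applied to it,
so that the average over `H` can be taken termwise. -/
theorem ind_exists_eq {α : Type*} [Fintype α] (x : α) (p : α → Prop) :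
    ind (p x) = ∑ u, ind (x = u) * ind (p u) := by
  rw [Finset.sum_eq_single x]
  · rw [ind_true rfl, one_mul]
  · intro b _ hb
    rw [ind_false (Ne.symm hb), zero_mul]
  · simp

/-- First-moment bound. -/
theorem avgGL_exists_le (A : (Fin n → ZMod 2) → (Fin n → ZMod 2) → Prop) :
    avgGL (fun H => ind (∃ z, z ≠ 0 ∧ A z (parity H z))) ≤
      2 / 2 ^ n * ∑ z, ∑ u, ind (A z u) := by
  calc avgGL (fun H => ind (∃ z, z ≠ 0 ∧ A z (parity H z)))
      ≤ avgGL (fun H => ∑ z, ∑ u, (ind (z ≠ 0) * ind (parity H z = u)) * ind (A z u)) := by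
        apply avgGL_mono
        intro H
        refine (ind_exists_le _).trans (Finset.sum_le_sum fun z _ => ?_)
        rw [ind_and, ind_exists_eq (parity H z) (A z), Finset.mul_sum]
        simp [mul_assoc]
    _ = ∑ z, ∑ u, avgGL (fun H => ind (z ≠ 0) * ind (parity H z = u)) * ind (A z u) := by
        rw [avgGL_sum]
        refine Finset.sum_congr rfl fun z _ => ?_
        rw [avgGL_sum]
        refine Finset.sum_congr rfl fun u _ => ?_
        rw [avgGL_mul_const]
    _ ≤ ∑ z, ∑ u, 2 / 2 ^ n * ind (A z u) := by
        refine Finset.sum_le_sum fun z _ => Finset.sum_le_sum fun u _ => ?_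
        refine mul_le_mul_of_nonneg_right ?_ (ind_nonneg _)
        by_cases hz : z ≠ 0
        · simpa [ind_true hz] using avgGL_parity_le hz u
        · simp only [ind_false hz, zero_mul, avgGL_const]
          positivity
    _ = _ := by simp [Finset.mul_sum]

/-- First-moment bound for pairs. -/
theorem avgGL_exists_pair_le
    (A : (Fin n → ZMod 2) → (Fin n → ZMod 2) → Prop)
    (B : (Fin n → ZMod 2) → (Fin n → ZMod 2) → (Fin n → ZMod 2) → Prop) :
    avgGL (fun H => ind (∃ z, ∃ z', (z ≠ 0 ∧ z' ≠ 0 ∧ z ≠ z') ∧ A z (parity H z) ∧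
        B (parity H z) z' (parity H z'))) ≤
      ∑ z, ∑ u, ind (A z u) * (2 / 2 ^ n * (2 / 2 ^ n * ∑ z', ∑ u', ind (B u z' u'))) := by
  calc avgGL (fun H => ind (∃ z, ∃ z', (z ≠ 0 ∧ z' ≠ 0 ∧ z ≠ z') ∧ A z (parity H z) ∧
        B (parity H z) z' (parity H z')))
      ≤ avgGL (fun H => ∑ z, ∑ z', ∑ u, ∑ u', (ind (z ≠ 0 ∧ z' ≠ 0 ∧ z ≠ z') *
          ind (parity H z = u ∧ parity H z' = u')) * (ind (A z u) * ind (B u z' u'))) := by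
        apply avgGL_mono
        intro H
        refine (ind_exists_le _).trans (Finset.sum_le_sum fun z _ => ?_)
        refine (ind_exists_le _).trans (Finset.sum_le_sum fun z' _ => ?_)
        rw [ind_and, ind_exists_eq (parity H z)
          (fun u => A z u ∧ B u z' (parity H z')), Finset.mul_sum]
        refine Finset.sum_le_sum fun u _ => ?_
        rw [ind_exists_eq (parity H z') (fun u' => A z u ∧ B u z' u'), Finset.mul_sum,
          Finset.mul_sum]
        refine Finset.sum_le_sum fun u' _ => ?_
        rw [ind_and (A z u), ind_and (parity H z = u)]
        apply le_of_eq
        ring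
    _ = ∑ z, ∑ z', ∑ u, ∑ u', avgGL (fun H => ind (z ≠ 0 ∧ z' ≠ 0 ∧ z ≠ z') *
          ind (parity H z = u ∧ parity H z' = u')) * (ind (A z u) * ind (B u z' u')) := by
        simp only [avgGL_sum, avgGL_mul_const]
    _ ≤ ∑ z, ∑ z', ∑ u, ∑ u', (2 / 2 ^ n * (2 / 2 ^ n)) * (ind (A z u) * ind (B u z' u')) := by
        refine Finset.sum_le_sum fun z _ => Finset.sum_le_sum fun z' _ =>
          Finset.sum_le_sum fun u _ => Finset.sum_le_sum fun u' _ => ?_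
        refine mul_le_mul_of_nonneg_right ?_ (mul_nonneg (ind_nonneg _) (ind_nonneg _))
        by_cases hz : z ≠ 0 ∧ z' ≠ 0 ∧ z ≠ z'
        · simpa [ind_true hz] using avgGL_parity_pair_le hz.1 hz.2.1 hz.2.2 u u'
        · simp only [ind_false hz, zero_mul, avgGL_const]
          positivity
    _ = _ := by
        refine Finset.sum_congr rfl fun z _ => ?_
        rw [Finset.sum_comm]
        refine Finset.sum_congr rfl fun u _ => ?_
        simp only [Finset.mul_sum]
        refine Finset.sum_congr rfl fun z' _ => Finset.sum_congr rfl fun u' _ => ?_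
        ring

/-- Second-moment bound: a large set of nonzero pairs is hit by `z ↦ z Hᵀ`. -/
theorem avgGL_forall_not_le (A : Finset ((Fin n → ZMod 2) × (Fin n → ZMod 2))) (hn : 2 ≤ n)
    (h0 : ∀ t ∈ A, t.1 ≠ 0 ∧ t.2 ≠ 0) (hA : A.Nonempty) :
    avgGL (fun H => ind (∀ z, (z, parity H z) ∉ A)) ≤
      2 ^ n / A.card + ((2 : ℝ) ^ n - 2)⁻¹ := by
  have hp : (2 : ℝ) ^ 2 ≤ 2 ^ n := pow_le_pow_right₀ (by norm_num) hn
  set M : ℝ := 2 ^ n - 1 with hM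
  have hM3 : 3 ≤ M := by rw [hM]; linarith
  have hMM : (2 : ℝ) ^ n - 2 = M - 1 := by rw [hM]; ring
  have hMp : (2 : ℝ) ^ n = M + 1 := by rw [hM]; ring
  rw [hMM, hMp]
  set a : ℝ := ((A.card : ℕ) : ℝ) with ha
  have hapos : 0 < a := by rw [ha]; exact_mod_cast hA.card_pos
  -- `N` counts the pairs of `A` on the graph of `H`. Its mean is `a / M`, and Chebyshev's
  -- inequality bounds the probability that `N = 0`.
  let N : GL (Fin n) (ZMod 2) → ℝ := fun H => ∑ t ∈ A, ind (parity H t.1 = t.2)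
  have hEN : avgGL N = a / M := by
    have : ∀ t ∈ A, avgGL (fun H => ind (parity H t.1 = t.2)) = M⁻¹ := fun t ht =>
      avgGL_parity (h0 t ht).1 (h0 t ht).2
    rw [avgGL_sum, Finset.sum_congr rfl this]
    simp [ha, div_eq_mul_inv]
  have hEN2 : avgGL (fun H => N H * N H) ≤ a / M + a * a * (M * (M - 1))⁻¹ := by
    have h1 : avgGL (fun H => N H * N H) = ∑ t ∈ A, ∑ t' ∈ A,
        avgGL (fun H => ind (parity H t.1 = t.2 ∧ parity H t'.1 = t'.2)) := by
      simp only [N, Finset.sum_mul_sum, avgGL_sum, ind_and]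
    have h2 : ∀ t ∈ A, ∑ t' ∈ A,
        avgGL (fun H => ind (parity H t.1 = t.2 ∧ parity H t'.1 = t'.2)) ≤
          M⁻¹ + a * (M * (M - 1))⁻¹ := by
      intro t ht
      -- The diagonal term is exact. Off the diagonal, equal first coordinates exclude each other,
      -- and otherwise the pair law applies.
      have hterm : ∀ t' ∈ A, avgGL (fun H => ind (parity H t.1 = t.2 ∧ parity H t'.1 = t'.2)) ≤
          (if t' = t then M⁻¹ else 0) + (M * (M - 1))⁻¹ := by
        intro t' ht'
        have hnn : 0 ≤ (M * (M - 1))⁻¹ := inv_nonneg.2 (mul_nonneg (by linarith) (by linarith))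
        by_cases htt : t' = t
        · rw [if_pos htt, ← avgGL_parity (h0 t ht).1 (h0 t ht).2]
          have : avgGL (fun H => ind (parity H t.1 = t.2 ∧ parity H t'.1 = t'.2)) ≤
              avgGL (fun H => ind (parity H t.1 = t.2)) :=
            avgGL_mono fun H => ind_mono And.left
          linarith
        · rw [if_neg htt, zero_add]
          by_cases h11 : t.1 = t'.1
          · have : (fun H : GL (Fin n) (ZMod 2) =>
                ind (parity H t.1 = t.2 ∧ parity H t'.1 = t'.2)) = fun _ => 0 := by
              funext H
              apply ind_false
              rintro ⟨h, h'⟩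
              exact htt (Prod.ext h11.symm (by rw [← h, ← h', h11]))
            rw [this, avgGL_const]
            exact hnn
          · have := avgGL_parity_pair_le' (h0 t ht).1 (h0 t' ht').1 h11 t.2 t'.2
            rwa [hMM] at this
      refine (Finset.sum_le_sum hterm).trans (le_of_eq ?_)
      rw [Finset.sum_add_distrib, Finset.sum_ite_eq', if_pos ht]
      simp [ha]
    rw [h1]
    refine (Finset.sum_le_sum h2).trans (le_of_eq ?_)
    rw [Finset.sum_const, nsmul_eq_mul, ← ha]
    ring
  set e := a / M with he
  clear_value e a M
  have hepos : 0 < e := by rw [he]; exact div_pos hapos (by linarith)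
  -- Chebyshev's inequality pointwise: `(N - e)² / e²` is nonnegative and equals `1` when `N = 0`.
  have hpt : ∀ H, ind (∀ z, (z, parity H z) ∉ A) ≤
      (N H * N H - N H * (2 * e) + e * e) * (e * e)⁻¹ := by
    intro H
    by_cases h : ∀ z, (z, parity H z) ∉ A
    · have : N H = 0 := by
        refine Finset.sum_eq_zero fun t ht => ind_false fun h' => h t.1 ?_
        rw [h']; exact ht
      rw [ind_true h, this]
      have : e * e ≠ 0 := by positivity
      field_simp
      linarith
    · rw [ind_false h]
      refine mul_nonneg ?_ (by positivity)
      nlinarith [sq_nonneg (N H - e)]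
  refine (avgGL_mono hpt).trans ?_
  rw [avgGL_mul_const, avgGL_add, avgGL_sub, avgGL_mul_const, avgGL_const, hEN]
  have hbound : avgGL (fun H => N H * N H) - e * (2 * e) + e * e ≤
      e + a * a * (M * (M - 1))⁻¹ - e * e := by linarith
  refine (mul_le_mul_of_nonneg_right hbound (by positivity)).trans ?_
  have hM0 : M ≠ 0 := by linarith
  have hM1 : M - 1 ≠ 0 := by linarith
  have heq : (e + a * a * (M * (M - 1))⁻¹ - e * e) * (e * e)⁻¹ = M / a + (M - 1)⁻¹ := by
    rw [he]
    field_simp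
    ring
  rw [heq]
  gcongr
  linarith

end Average

/-! ### Bernoulli masses and weights of binary vectors -/

/-- Mass of `b` under the Bernoulli law with bias `p`. -/
def bern (p : ℝ) (b : ZMod 2) : ℝ := p ^ b.val * (1 - p) ^ (1 - b.val)

theorem bern_zero (p : ℝ) : bern p 0 = 1 - p := by simp [bern]

theorem bern_one (p : ℝ) : bern p 1 = p := by
  have : (1 : ZMod 2).val = 1 := rfl
  simp [bern, this]

theorem zmod_two_cases (b : ZMod 2) : b = 0 ∨ b = 1 := by revert b; decide

theorem sum_zmod_two (f : ZMod 2 → ℝ) : ∑ b, f b = f 0 + f 1 := Fin.sum_univ_two f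

theorem sum_bern (p : ℝ) : ∑ b, bern p b = 1 := by
  rw [sum_zmod_two, bern_zero, bern_one]; ring

theorem bern_nonneg {p : ℝ} (hp : p ∈ Set.Icc (0 : ℝ) 1) (b : ZMod 2) : 0 ≤ bern p b := by
  rcases zmod_two_cases b with rfl | rfl
  · rw [bern_zero]; linarith [hp.2]
  · rw [bern_one]; exact hp.1

theorem bern_le_one {p : ℝ} (hp : p ∈ Set.Icc (0 : ℝ) 1) (b : ZMod 2) : bern p b ≤ 1 := by
  rcases zmod_two_cases b with rfl | rfl
  · rw [bern_zero]; linarith [hp.1]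
  · rw [bern_one]; exact hp.2

theorem bern_half (b : ZMod 2) : bern (1 / 2) b = 1 / 2 := by
  rcases zmod_two_cases b with rfl | rfl
  · rw [bern_zero]; norm_num
  · rw [bern_one]

section Weight

variable {n : ℕ}

theorem weight_eq_prod (q : Fin n → ℝ) (u : Fin n → ZMod 2) :
    weight q u = ∏ i, bern (q i) (u i) := rfl

theorem weight_nonneg {q : Fin n → ℝ} (hq : ∀ i, q i ∈ Set.Icc (0 : ℝ) 1) (u : Fin n → ZMod 2) :
    0 ≤ weight q u := Finset.prod_nonneg fun i _ => bern_nonneg (hq i) (u i)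

theorem weight_le_one {q : Fin n → ℝ} (hq : ∀ i, q i ∈ Set.Icc (0 : ℝ) 1) (u : Fin n → ZMod 2) :
    weight q u ≤ 1 := Finset.prod_le_one (fun i _ => bern_nonneg (hq i) (u i))
      fun i _ => bern_le_one (hq i) (u i)

theorem sum_weight_mul_prod (q : Fin n → ℝ) (φ : Fin n → ZMod 2 → ℝ) :
    ∑ u, weight q u * ∏ i, φ i (u i) = ∏ i, ∑ b, bern (q i) b * φ i b := by
  rw [Finset.prod_univ_sum, Fintype.piFinset_univ]
  simp [weight_eq_prod, Finset.prod_mul_distrib]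

theorem sum_weight (q : Fin n → ℝ) : ∑ u, weight q u = 1 := by
  have := sum_weight_mul_prod q fun _ _ => 1
  simpa [sum_bern] using this

theorem weight_half (u : Fin n → ZMod 2) : weight (fun _ => 1 / 2) u = (1 / 2) ^ n := by
  simp only [weight_eq_prod, bern_half, Finset.prod_const, Finset.card_univ, Fintype.card_fin]

theorem weight_val_self (u : Fin n → ZMod 2) : weight (fun i => ((u i).val : ℝ)) u = 1 := by
  rw [weight_eq_prod]
  refine Finset.prod_eq_one fun i _ => ?_
  rcases zmod_two_cases (u i) with h | h <;> rw [h]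
  · simp [bern_zero]
  · have : (1 : ZMod 2).val = 1 := rfl
    simp [bern_one, this]

theorem eq_of_weight_val_ne_zero {u v : Fin n → ZMod 2}
    (h : weight (fun i => ((u i).val : ℝ)) v ≠ 0) : v = u := by
  funext i
  rw [weight_eq_prod, Finset.prod_ne_zero_iff] at h
  have hi := h i (Finset.mem_univ i)
  have h1 : (1 : ZMod 2).val = 1 := rfl
  rcases zmod_two_cases (u i) with hu | hu <;> rcases zmod_two_cases (v i) with hv | hv <;>
    rw [hu, hv] at hi ⊢ <;> simp [bern_zero, bern_one, h1] at hi

theorem val_mem_Icc (b : ZMod 2) : ((b.val : ℝ)) ∈ Set.Icc (0 : ℝ) 1 := by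
  have h1 : (1 : ZMod 2).val = 1 := rfl
  rcases zmod_two_cases b with rfl | rfl <;> simp [h1]

/-- A product of two weights is a probability law on pairs, so few pairs are heavy. -/
theorem sum_ind_weight_le {p a : Fin n → ℝ} (hp : ∀ i, p i ∈ Set.Icc (0 : ℝ) 1)
    (ha : ∀ i, a i ∈ Set.Icc (0 : ℝ) 1) {c : ℝ} (hc : 0 < c)
    (T : (Fin n → ZMod 2) → (Fin n → ZMod 2) → Prop) :
    ∑ z, ∑ u, ind (c ≤ weight p z * weight a u ∧ T z u) ≤
      c⁻¹ * ∑ z, weight p z * ∑ u, weight a u * ind (T z u) := by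
  simp only [Finset.mul_sum]
  refine Finset.sum_le_sum fun z _ => Finset.sum_le_sum fun u _ => ?_
  have hnn := mul_nonneg (weight_nonneg hp z) (weight_nonneg ha u)
  rw [ind_and, ← mul_assoc (weight p z), ← mul_assoc]
  refine mul_le_mul_of_nonneg_right ?_ (ind_nonneg _)
  by_cases h : c ≤ weight p z * weight a u
  · rw [ind_true h, inv_mul_eq_div, le_div_iff₀ hc, one_mul]
    exact h
  · rw [ind_false h]
    positivity

theorem sum_ind_weight_le_inv {p a : Fin n → ℝ} (hp : ∀ i, p i ∈ Set.Icc (0 : ℝ) 1)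
    (ha : ∀ i, a i ∈ Set.Icc (0 : ℝ) 1) {c : ℝ} (hc : 0 < c) :
    ∑ z, ∑ u, ind (c ≤ weight p z * weight a u) ≤ c⁻¹ := by
  have h := sum_ind_weight_le hp ha hc fun _ _ => True
  simpa [ind_true, sum_weight] using h

end Weight

/-! ### Head and tail of a vector -/

section Split

variable {n k : ℕ}

/-- The first `k` entries. -/
def head {α : Type*} (hk : k ≤ n) (u : Fin n → α) : Fin k → α := fun i => u (Fin.castLE hk i)

/-- The last `n - k` entries. -/
def tail {α : Type*} (k : ℕ) (u : Fin n → α) : Fin (n - k) → α :=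
  fun j => u ⟨k + j, by omega⟩

/-- Positions split into the first `k` and the last `n - k`. -/
def splitEquiv (hk : k ≤ n) : Fin k ⊕ Fin (n - k) ≃ Fin n :=
  finSumFinEquiv.trans (finCongr (by omega))

theorem splitEquiv_inl (hk : k ≤ n) (i : Fin k) : splitEquiv hk (Sum.inl i) = Fin.castLE hk i := by
  ext; simp [splitEquiv]

theorem splitEquiv_inr (hk : k ≤ n) (j : Fin (n - k)) :
    splitEquiv hk (Sum.inr j) = ⟨k + j, by omega⟩ := by
  ext; simp [splitEquiv]

theorem concat_head (hk : k ≤ n) (a : Fin k → ℝ) (b : Fin (n - k) → ℝ) (i : Fin k) :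
    concat a b (Fin.castLE hk i) = a i := by
  simp [concat]

theorem concat_tail (a : Fin k → ℝ) (b : Fin (n - k) → ℝ) (j : Fin (n - k)) :
    concat a b ⟨k + j, by omega⟩ = b j := by
  simp [concat]

theorem concat_mem_Icc {a : Fin k → ℝ} {b : Fin (n - k) → ℝ} (ha : ∀ i, a i ∈ Set.Icc (0 : ℝ) 1)
    (hb : ∀ i, b i ∈ Set.Icc (0 : ℝ) 1) (i : Fin n) : concat a b i ∈ Set.Icc (0 : ℝ) 1 := by
  unfold concat
  split_ifs
  · exact ha _
  · exact hb _

theorem weight_concat (hk : k ≤ n) (a : Fin k → ℝ) (b : Fin (n - k) → ℝ) (u : Fin n → ZMod 2) :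
    weight (concat a b) u = weight a (head hk u) * weight b (tail k u) := by
  simp only [weight_eq_prod]
  rw [← (splitEquiv hk).prod_comp, Fintype.prod_sum_type]
  simp only [splitEquiv_inl, splitEquiv_inr, concat_head, concat_tail]
  rfl

theorem sum_head_tail (hk : k ≤ n) (F : (Fin k → ZMod 2) → (Fin (n - k) → ZMod 2) → ℝ) :
    ∑ u : Fin n → ZMod 2, F (head hk u) (tail k u) = ∑ v, ∑ w, F v w := by
  rw [← Fintype.sum_prod_type']
  let e : (Fin n → ZMod 2) ≃ (Fin k → ZMod 2) × (Fin (n - k) → ZMod 2) :=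
    ((splitEquiv hk).arrowCongr (Equiv.refl _)).symm.trans (Equiv.sumArrowEquivProdArrow _ _ _)
  rw [← e.sum_comp]
  refine Finset.sum_congr rfl fun u _ => ?_
  have h1 : (e u).1 = head hk u := by
    funext i; simp [e, head, Equiv.arrowCongr, Equiv.sumArrowEquivProdArrow, splitEquiv_inl]
  have h2 : (e u).2 = tail k u := by
    funext i; simp [e, tail, Equiv.arrowCongr, Equiv.sumArrowEquivProdArrow, splitEquiv_inr]
  rw [h1, h2]

theorem sum_weight_concat_head (hk : k ≤ n) (a : Fin k → ℝ) (b : Fin (n - k) → ℝ)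
    (F : (Fin k → ZMod 2) → ℝ) :
    ∑ u, weight (concat a b) u * F (head hk u) = ∑ v, weight a v * F v := by
  have := sum_head_tail hk fun v w => weight a v * weight b w * F v
  simp only [weight_concat hk, this]
  refine Finset.sum_congr rfl fun v _ => ?_
  rw [← Finset.sum_mul, ← Finset.mul_sum, sum_weight, mul_one]

theorem sum_weight_concat_tail (hk : k ≤ n) (a : Fin k → ℝ) (b : Fin (n - k) → ℝ)
    (F : (Fin (n - k) → ZMod 2) → ℝ) :
    ∑ u, weight (concat a b) u * F (tail k u) = ∑ w, weight b w * F w := by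
  have := sum_head_tail hk fun v w => weight a v * weight b w * F w
  simp only [weight_concat hk, this]
  rw [Finset.sum_comm]
  refine Finset.sum_congr rfl fun w _ => ?_
  rw [← Finset.sum_mul, ← Finset.sum_mul, sum_weight, one_mul]

end Split

/-! ### Independent letters and the Chernoff bound -/

section Iid

variable {A : Type*}

/-- Expectation of `F (s_1, …, s_n)` for i.i.d. letters of mass function `p` on `S`. -/
def iidExp (S : Finset A) (p : A → ℝ) (n : ℕ) (F : (Fin n → A) → ℝ) : ℝ :=
  ∑ s ∈ Fintype.piFinset (fun _ : Fin n => S), (∏ i, p (s i)) * F s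

variable {S : Finset A} {p : A → ℝ} {n : ℕ}

theorem iidExp_mono (hp : ∀ a ∈ S, 0 ≤ p a) {F G : (Fin n → A) → ℝ}
    (h : ∀ s, (∀ i, s i ∈ S) → (∀ i, 0 < p (s i)) → F s ≤ G s) :
    iidExp S p n F ≤ iidExp S p n G := by
  refine Finset.sum_le_sum fun s hs => ?_
  rw [Fintype.mem_piFinset] at hs
  by_cases h0 : ∏ i, p (s i) = 0
  · simp [h0]
  · refine mul_le_mul_of_nonneg_left (h s hs fun i => ?_)
      (Finset.prod_nonneg fun i _ => hp _ (hs i))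
    exact lt_of_le_of_ne (hp _ (hs i)) (Ne.symm (Finset.prod_ne_zero_iff.1 h0 i (Finset.mem_univ i)))

theorem iidExp_prod (g : A → ℝ) :
    iidExp S p n (fun s => ∏ i, g (s i)) = (∑ a ∈ S, p a * g a) ^ n := by
  have h := Finset.prod_univ_sum (fun _ : Fin n => S) fun _ a => p a * g a
  simp only [Finset.prod_const, Finset.card_univ, Fintype.card_fin] at h
  simp [iidExp, h, Finset.prod_mul_distrib]

theorem iidExp_mul_const (F : (Fin n → A) → ℝ) (c : ℝ) :
    iidExp S p n (fun s => F s * c) = iidExp S p n F * c := by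
  simp [iidExp, Finset.sum_mul, mul_assoc]

theorem iidExp_const_mul (F : (Fin n → A) → ℝ) (c : ℝ) :
    iidExp S p n (fun s => c * F s) = c * iidExp S p n F := by
  simp only [mul_comm c, iidExp_mul_const]

theorem iidExp_const (h1 : ∑ a ∈ S, p a = 1) (c : ℝ) : iidExp S p n (fun _ => c) = c := by
  have := iidExp_prod (S := S) (p := p) (n := n) fun _ => 1
  simp only [Finset.prod_const_one, mul_one, h1, one_pow] at this
  have h := iidExp_mul_const (S := S) (p := p) (n := n) (fun _ => 1) c
  rw [this] at h
  simpa using h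

theorem iidExp_add (F G : (Fin n → A) → ℝ) :
    iidExp S p n (fun s => F s + G s) = iidExp S p n F + iidExp S p n G := by
  simp [iidExp, mul_add, Finset.sum_add_distrib]

theorem iidExp_weight_prod (pp : A → ℝ) (φ : A → ZMod 2 → ℝ) :
    iidExp S p n (fun s => ∑ z, weight (fun i => pp (s i)) z * ∏ i, φ (s i) (z i)) =
      (∑ a ∈ S, p a * ∑ b, bern (pp a) b * φ a b) ^ n := by
  rw [← iidExp_prod]
  congr 1
  funext s
  exact sum_weight_mul_prod (fun i => pp (s i)) fun i => φ (s i)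

/-- For small `t`, `exp (t (g - m))` is at most `1 + t (g - m)` plus a quadratic term; the mean of
the linear term is negative and wins. -/
theorem exists_exp_moment_lt_one {ι : Type*} (S : Finset ι) (w g : ι → ℝ) (hw : ∀ i ∈ S, 0 ≤ w i)
    (h1 : ∑ i ∈ S, w i = 1) {m : ℝ} (hm : ∑ i ∈ S, w i * g i < m) :
    ∃ t, 0 < t ∧ ∑ i ∈ S, w i * Real.exp (t * (g i - m)) < 1 := by
  set B : ℝ := 1 + ∑ i ∈ S, |g i - m| with hB
  have hB1 : 1 ≤ B := by
    have : 0 ≤ ∑ i ∈ S, |g i - m| := Finset.sum_nonneg fun i _ => abs_nonneg _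
    linarith
  have hgB : ∀ i ∈ S, |g i - m| ≤ B := fun i hi => by
    have := Finset.single_le_sum (f := fun i => |g i - m|) (fun i _ => abs_nonneg _) hi
    linarith
  set gap := m - ∑ i ∈ S, w i * g i with hgap
  have hgap0 : 0 < gap := by linarith
  -- The first bound keeps the exponent in `[-1, 1]`, where `exp x ≤ 1 + x + x²`; the second makes
  -- the quadratic term at most half the linear gain `t * gap`.
  set t := min (1 / B) (gap / (2 * B ^ 2)) with ht
  have ht0 : 0 < t := lt_min (by positivity) (by positivity)
  have htB : t * B ≤ 1 := by
    have : t ≤ 1 / B := min_le_left _ _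
    rwa [le_div_iff₀ (by linarith)] at this
  have htg : t * (2 * B ^ 2) ≤ gap := by
    have : t ≤ gap / (2 * B ^ 2) := min_le_right _ _
    rwa [le_div_iff₀ (by positivity)] at this
  refine ⟨t, ht0, ?_⟩
  have hterm : ∀ i ∈ S, w i * Real.exp (t * (g i - m)) ≤
      w i * (1 - t * m + t ^ 2 * B ^ 2) + t * (w i * g i) := by
    intro i hi
    have hx : |t * (g i - m)| ≤ t * B := by
      rw [abs_mul, abs_of_pos ht0]
      exact mul_le_mul_of_nonneg_left (hgB i hi) ht0.le
    have hexp := (abs_le.1 (Real.abs_exp_sub_one_sub_id_le (hx.trans htB))).2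
    have hsq : (t * (g i - m)) ^ 2 ≤ t ^ 2 * B ^ 2 := by
      rw [← mul_pow]
      exact sq_le_sq' (by linarith [(abs_le.1 hx).1]) (abs_le.1 hx).2
    have : Real.exp (t * (g i - m)) ≤ 1 - t * m + t ^ 2 * B ^ 2 + t * g i := by linarith
    calc w i * Real.exp (t * (g i - m)) ≤ w i * (1 - t * m + t ^ 2 * B ^ 2 + t * g i) :=
          mul_le_mul_of_nonneg_left this (hw i hi)
      _ = _ := by ring
  refine (Finset.sum_le_sum hterm).trans_lt ?_
  rw [Finset.sum_add_distrib, ← Finset.sum_mul, h1, ← Finset.mul_sum]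
  nlinarith [mul_pos ht0 hgap0]

/-- Chernoff bound for i.i.d. pairs `(s_i, z_i)` with `s_i ∼ p` and `z_i ∼ Bern (pp s_i)`. -/
theorem exists_chernoff (hp : ∀ a ∈ S, 0 ≤ p a) (h1 : ∑ a ∈ S, p a = 1) (pp : A → ℝ)
    (hpp : ∀ a ∈ S, pp a ∈ Set.Icc (0 : ℝ) 1) (g : A → ZMod 2 → ℝ) {m : ℝ}
    (hm : ∑ a ∈ S, p a * ∑ b, bern (pp a) b * g a b < m) :
    ∃ r : ℝ, 0 ≤ r ∧ r < 1 ∧ ∀ n : ℕ, iidExp S p n (fun s => ∑ z, weight (fun i => pp (s i)) z *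
      ind ((n : ℝ) * m ≤ ∑ i, g (s i) (z i))) ≤ r ^ n := by
  obtain ⟨t, ht, hlt⟩ := exists_exp_moment_lt_one (S ×ˢ (Finset.univ : Finset (ZMod 2)))
    (fun x => p x.1 * bern (pp x.1) x.2) (fun x => g x.1 x.2)
    (fun x hx => mul_nonneg (hp _ (Finset.mem_product.1 hx).1)
      (bern_nonneg (hpp _ (Finset.mem_product.1 hx).1) _))
    (by rw [Finset.sum_product]; simp [← Finset.mul_sum, sum_bern, h1])
    (m := m) (by rw [Finset.sum_product]; simpa [Finset.mul_sum, mul_assoc] using hm)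
  rw [Finset.sum_product] at hlt
  have hr : ∑ a ∈ S, p a * ∑ b, bern (pp a) b * Real.exp (t * (g a b - m)) < 1 := by
    simpa [Finset.mul_sum, mul_assoc] using hlt
  -- `r` is the exponential moment of one letter; it multiplies over independent letters.
  refine ⟨_, ?_, hr, fun n => ?_⟩
  · exact Finset.sum_nonneg fun a ha => mul_nonneg (hp a ha) (Finset.sum_nonneg fun b _ =>
      mul_nonneg (bern_nonneg (hpp a ha) b) (Real.exp_pos _).le)
  · rw [← iidExp_weight_prod]
    refine iidExp_mono hp fun s hs _ => Finset.sum_le_sum fun z _ => ?_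
    refine mul_le_mul_of_nonneg_left ?_ (weight_nonneg (fun i => hpp _ (hs i)) z)
    rw [← Real.exp_sum]
    by_cases h : (n : ℝ) * m ≤ ∑ i, g (s i) (z i)
    · rw [ind_true h]
      refine Real.one_le_exp ?_
      rw [← Finset.mul_sum, Finset.sum_sub_distrib]
      refine mul_nonneg ht.le ?_
      simp
      linarith
    · rw [ind_false h]
      exact (Real.exp_pos _).le

end Iid

/-! ### Single-letter entropies -/

section Entropy

variable {X Y : Type*}

/-- Cross entropy `E[-log₂ Bern_{p'}(B)]` in bits, for `B ∼ Bern_p`. -/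
def crossEnt (p p' : ℝ) : ℝ := ∑ b, bern p b * -Real.logb 2 (bern p' b)

theorem crossEnt_self (p : ℝ) : crossEnt p p = Hb p := by
  simp only [crossEnt, sum_zmod_two, bern_zero, bern_one, Hb, Real.binEntropy, Real.logb,
    Real.log_inv]
  ring

theorem Hb_le_one (p : ℝ) : Hb p ≤ 1 := by
  unfold Hb
  rw [div_le_one (Real.log_pos (by norm_num))]
  exact Real.binEntropy_le_log_two

theorem Hb_lt_one {p : ℝ} (hp : p ≠ 1 / 2) : Hb p < 1 := by
  unfold Hb
  rw [div_lt_one (Real.log_pos (by norm_num)), Real.binEntropy_lt_log_two]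
  simpa using hp

theorem Hb_nonneg {p : ℝ} (hp : p ∈ Set.Icc (0 : ℝ) 1) : 0 ≤ Hb p :=
  div_nonneg (Real.binEntropy_nonneg hp.1 hp.2) (Real.log_pos (by norm_num)).le

theorem Hb_eq_zero {p : ℝ} (h : Hb p = 0) : p = 0 ∨ p = 1 := by
  unfold Hb at h
  have h2 : Real.log 2 ≠ 0 := (Real.log_pos (by norm_num)).ne'
  rw [div_eq_zero_iff, or_iff_left h2] at h
  exact Real.binEntropy_eq_zero.1 h

variable {P : X × Y → ℝ} {W : X → ZMod 2 → ℝ}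

theorem bern_encBias (hW : ∀ x, W x ∈ stdSimplex ℝ (ZMod 2)) (x : X) (b : ZMod 2) :
    bern (encBias W x) b = W x b := by
  have h := (hW x).2
  rw [sum_zmod_two] at h
  rcases zmod_two_cases b with rfl | rfl
  · rw [bern_zero, encBias]; linarith
  · rw [bern_one, encBias]

theorem encBias_mem (hW : ∀ x, W x ∈ stdSimplex ℝ (ZMod 2)) (x : X) :
    encBias W x ∈ Set.Icc (0 : ℝ) 1 := by
  have h := (hW x).2
  rw [sum_zmod_two] at h
  have h0 := (hW x).1 0
  have h1 := (hW x).1 1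
  exact ⟨h1, by unfold encBias; linarith⟩

theorem sum_channel (hW : ∀ x, W x ∈ stdSimplex ℝ (ZMod 2)) (x : X) : ∑ b, W x b = 1 := (hW x).2

variable [Fintype X]

theorem sum_lawYZ (hW : ∀ x, W x ∈ stdSimplex ℝ (ZMod 2)) (y : Y) :
    ∑ b, lawYZ P W (y, b) = margSnd P y := by
  simp only [lawYZ, margSnd]
  rw [Finset.sum_comm]
  refine Finset.sum_congr rfl fun x _ => ?_
  rw [← Finset.mul_sum, sum_channel hW, mul_one]

theorem bern_decBias (hW : ∀ x, W x ∈ stdSimplex ℝ (ZMod 2)) {y : Y} (hy : margSnd P y ≠ 0)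
    (b : ZMod 2) : bern (decBias P W y) b = lawYZ P W (y, b) / margSnd P y := by
  have h := sum_lawYZ (P := P) hW y
  rw [sum_zmod_two] at h
  rcases zmod_two_cases b with rfl | rfl
  · rw [bern_zero, decBias, ← h]
    rw [← h] at hy
    field_simp
    ring
  · rw [bern_one, decBias]

variable [Fintype Y]

theorem lawYZ_nonneg (hP : P ∈ stdSimplex ℝ (X × Y)) (hW : ∀ x, W x ∈ stdSimplex ℝ (ZMod 2))
    (t : Y × ZMod 2) : 0 ≤ lawYZ P W t :=
  Finset.sum_nonneg fun x _ => mul_nonneg (hP.1 _) ((hW x).1 _)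

theorem margSnd_nonneg (hP : P ∈ stdSimplex ℝ (X × Y)) (y : Y) : 0 ≤ margSnd P y :=
  Finset.sum_nonneg fun x _ => hP.1 (x, y)

theorem le_margSnd (hP : P ∈ stdSimplex ℝ (X × Y)) (x : X) (y : Y) : P (x, y) ≤ margSnd P y :=
  Finset.single_le_sum (f := fun x => P (x, y)) (fun x _ => hP.1 (x, y)) (Finset.mem_univ x)

/-- At a letter of probability zero the quotient is `0`, so no positivity is needed. -/
theorem decBias_mem (hP : P ∈ stdSimplex ℝ (X × Y)) (hW : ∀ x, W x ∈ stdSimplex ℝ (ZMod 2))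
    (y : Y) : decBias P W y ∈ Set.Icc (0 : ℝ) 1 := by
  have h := sum_lawYZ (P := P) hW y
  rw [sum_zmod_two] at h
  refine ⟨div_nonneg (lawYZ_nonneg hP hW _) (margSnd_nonneg hP y), ?_⟩
  refine div_le_one_of_le₀ ?_ (margSnd_nonneg hP y)
  linarith [lawYZ_nonneg hP hW (y, 0)]

/-- Absolute continuity: a symbol possible given `x` is possible given any `y` that occurs with `x`.
This keeps the decoder's log-weights finite on words the encoder can choose. -/
theorem bern_decBias_pos (hP : P ∈ stdSimplex ℝ (X × Y))
    (hW : ∀ x, W x ∈ stdSimplex ℝ (ZMod 2)) {s : X × Y} (hs : 0 < P s) {b : ZMod 2}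
    (hb : 0 < bern (encBias W s.1) b) : 0 < bern (decBias P W s.2) b := by
  have hy : 0 < margSnd P s.2 := hs.trans_le (le_margSnd hP s.1 s.2)
  rw [bern_decBias hW hy.ne']
  rw [bern_encBias hW] at hb
  refine div_pos (lt_of_lt_of_le (mul_pos hs hb) ?_) hy
  exact Finset.single_le_sum (f := fun x => P (x, s.2) * W x b)
    (fun x _ => mul_nonneg (hP.1 _) ((hW x).1 _)) (Finset.mem_univ s.1)

/-- `H(Z | X)` as an expectation over the source letter. -/
theorem condEntropy_lawXZ (hW : ∀ x, W x ∈ stdSimplex ℝ (ZMod 2)) :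
    condEntropy (lawXZ P W) = ∑ s, P s * Hb (encBias W s.1) := by
  have hm : ∀ a, margFst (lawXZ P W) a = margFst P a := fun a => by
    simp only [margFst, lawXZ, ← Finset.mul_sum, sum_channel hW, mul_one]
  simp only [condEntropy, hm, ← crossEnt_self, crossEnt, bern_encBias hW]
  rw [Fintype.sum_prod_type, ← Finset.sum_neg_distrib]
  refine Finset.sum_congr rfl fun x _ => ?_
  dsimp only
  rw [← Finset.sum_mul, ← Finset.sum_neg_distrib, Finset.mul_sum]
  refine Finset.sum_congr rfl fun b _ => ?_
  change -(margFst P x * W x b * _) = margFst P x * _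
  by_cases h : margFst P x = 0
  · simp [h]
  · rw [lawXZ]
    simp only
    rw [mul_div_cancel_left₀ _ h]
    ring

/-- Given `X`, `Z` does not depend on `Y`, so `I(X;Z|Y) = H(Z|Y) - H(Z|X)`. The first entropy
appears as a mean cross entropy because the decoder scores with `P_{Z|Y}` words drawn from
`P_{Z|X}`. -/
theorem condMutualInfo_lawXYZ (hP : P ∈ stdSimplex ℝ (X × Y))
    (hW : ∀ x, W x ∈ stdSimplex ℝ (ZMod 2)) :
    condMutualInfo (lawXYZ P W) =
      ∑ s : X × Y, P s * crossEnt (encBias W s.1) (decBias P W s.2) -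
        condEntropy (lawXZ P W) := by
  rw [condEntropy_lawXZ hW, ← Finset.sum_sub_distrib, Fintype.sum_prod_type]
  simp only [← crossEnt_self, crossEnt, bern_encBias hW, condMutualInfo, ← mul_sub,
    ← Finset.sum_sub_distrib]
  refine Finset.sum_congr rfl fun x _ => Finset.sum_congr rfl fun y _ => ?_
  rw [Finset.mul_sum]
  refine Finset.sum_congr rfl fun b _ => ?_
  have e1 : ∑ a', ∑ c', lawXYZ P W (a', y, c') = margSnd P y := by
    simp only [lawXYZ, ← Finset.mul_sum, sum_channel hW, mul_one, margSnd]
  have e2 : ∑ c', lawXYZ P W (x, y, c') = P (x, y) := by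
    simp only [lawXYZ, ← Finset.mul_sum, sum_channel hW, mul_one]
  have e3 : ∑ a', lawXYZ P W (a', y, b) = lawYZ P W (y, b) := rfl
  rw [e1, e2, e3]
  simp only [lawXYZ]
  by_cases hp : P (x, y) = 0
  · simp [hp]
  by_cases hw : W x b = 0
  · simp [hw]
  have hp' : 0 < P (x, y) := lt_of_le_of_ne (hP.1 _) (Ne.symm hp)
  have hw' : 0 < W x b := lt_of_le_of_ne ((hW x).1 b) (Ne.symm hw)
  have hy : 0 < margSnd P y := hp'.trans_le (le_margSnd hP x y)
  have hd := bern_decBias_pos (s := (x, y)) hP hW hp' (b := b) (by rwa [bern_encBias hW])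
  have hb : lawYZ P W (y, b) = bern (decBias P W y) b * margSnd P y := by
    rw [bern_decBias hW hy.ne', div_mul_cancel₀ _ hy.ne']
  have hr : P (x, y) * W x b * margSnd P y / (P (x, y) * lawYZ P W (y, b)) =
      W x b / bern (decBias P W y) b := by
    rw [hb]
    simp only at hd
    field_simp
  rw [hr, Real.logb_div hw hd.ne']
  ring

/-- Gibbs' inequality letter by letter. It serves to deduce `R > 0` from the rate hypothesis. -/
theorem condMutualInfo_nonneg (hP : P ∈ stdSimplex ℝ (X × Y))
    (hW : ∀ x, W x ∈ stdSimplex ℝ (ZMod 2)) : 0 ≤ condMutualInfo (lawXYZ P W) := by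
  rw [condMutualInfo_lawXYZ hP hW, condEntropy_lawXZ hW, ← Finset.sum_sub_distrib]
  have hl2 : 0 < Real.log 2 := Real.log_pos (by norm_num)
  refine Finset.sum_nonneg fun s _ => ?_
  rw [← mul_sub]
  by_cases hs : P s = 0
  · simp [hs]
  have hs' : 0 < P s := lt_of_le_of_ne (hP.1 _) (Ne.symm hs)
  refine mul_nonneg hs'.le ?_
  simp only [← crossEnt_self, crossEnt, ← Finset.sum_sub_distrib]
  -- `log t ≤ t - 1` applied to the likelihood ratio; the left sides sum to zero because both masses
  -- have total `1`.
  have key : ∀ b ∈ (Finset.univ : Finset (ZMod 2)),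
      (bern (encBias W s.1) b - bern (decBias P W s.2) b) / Real.log 2 ≤
      bern (encBias W s.1) b * -Real.logb 2 (bern (decBias P W s.2) b) -
        bern (encBias W s.1) b * -Real.logb 2 (bern (encBias W s.1) b) := by
    intro b _
    have hd0 := bern_nonneg (decBias_mem hP hW s.2) b
    have he0 := bern_nonneg (encBias_mem hW s.1) b
    rcases he0.eq_or_lt with he | he
    · rw [← he]
      simp only [zero_mul, sub_zero, zero_sub]
      exact div_nonpos_of_nonpos_of_nonneg (by linarith) hl2.le
    · have hd := bern_decBias_pos hP hW hs' he
      have hlog := Real.log_le_sub_one_of_pos (div_pos hd he)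
      rw [Real.log_div hd.ne' he.ne'] at hlog
      have h2 : bern (encBias W s.1) b * (Real.log (bern (decBias P W s.2) b) -
          Real.log (bern (encBias W s.1) b)) ≤
          bern (decBias P W s.2) b - bern (encBias W s.1) b := by
        calc _ ≤ bern (encBias W s.1) b *
              (bern (decBias P W s.2) b / bern (encBias W s.1) b - 1) :=
              mul_le_mul_of_nonneg_left hlog he.le
          _ = _ := by field_simp
      simp only [Real.logb]
      rw [div_le_iff₀ hl2]
      have h3 : (bern (encBias W s.1) b * -(Real.log (bern (decBias P W s.2) b) / Real.log 2) -
        bern (encBias W s.1) b * -(Real.log (bern (encBias W s.1) b) / Real.log 2)) *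
          Real.log 2 = -(bern (encBias W s.1) b * (Real.log (bern (decBias P W s.2) b) -
          Real.log (bern (encBias W s.1) b))) := by
        field_simp
        ring
      rw [h3]
      linarith
  refine le_trans ?_ (Finset.sum_le_sum key)
  rw [← Finset.sum_div, Finset.sum_sub_distrib, sum_bern, sum_bern]
  simp

end Entropy

/-! ### The random experiment -/

section Experiment

variable {X Y : Type*} [Fintype X] [Fintype Y]

/-- Expectation over the source block and the parity biases only. -/
def srcExp (P : X × Y → ℝ) (PQ : ℝ →₀ ℝ) (n m : ℕ)
    (G : (Fin n → X × Y) → (Fin m → ℝ) → ℝ) : ℝ :=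
  iidExp Finset.univ P n fun s => iidExp PQ.support PQ m fun q => G s q

variable {P : X × Y → ℝ} {PQ : ℝ →₀ ℝ} {n k m : ℕ}

theorem expect_eq_srcExp
    (F : (Fin n → X × Y) → GL (Fin n) (ZMod 2) → (Fin (n - k) → ℝ) → ℝ) :
    expect P PQ n k F = srcExp P PQ n (n - k) fun s q => avgGL fun H => F s H q := by
  simp only [expect, srcExp, iidExp, avgGL, Fintype.piFinset_univ]
  refine Finset.sum_congr rfl fun s _ => ?_
  rw [Finset.sum_comm, Finset.mul_sum]
  refine Finset.sum_congr rfl fun q _ => ?_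
  simp only [Finset.mul_sum]
  refine Finset.sum_congr rfl fun H _ => ?_
  ring

theorem srcExp_mono (hP : P ∈ stdSimplex ℝ (X × Y)) (hPQ : IsParityBiasLaw PQ)
    {F G : (Fin n → X × Y) → (Fin m → ℝ) → ℝ}
    (h : ∀ s q, (∀ i, 0 < P (s i)) → (∀ j, q j ∈ PQ.support) → F s q ≤ G s q) :
    srcExp P PQ n m F ≤ srcExp P PQ n m G :=
  iidExp_mono (fun a _ => hP.1 a) fun s _ hs => iidExp_mono (fun a _ => hPQ.nonneg a)
    fun q hq _ => h s q hs hq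

theorem srcExp_fst (hPQ : IsParityBiasLaw PQ) (F : (Fin n → X × Y) → ℝ) :
    srcExp P PQ n m (fun s _ => F s) = iidExp Finset.univ P n F := by
  unfold srcExp
  congr 1
  funext s
  exact iidExp_const hPQ.sum_eq_one _

theorem srcExp_snd (hP : P ∈ stdSimplex ℝ (X × Y)) (F : (Fin m → ℝ) → ℝ) :
    srcExp P PQ n m (fun _ q => F q) = iidExp PQ.support PQ m F :=
  iidExp_const hP.2 _

theorem srcExp_const (hP : P ∈ stdSimplex ℝ (X × Y)) (hPQ : IsParityBiasLaw PQ) (c : ℝ) :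
    srcExp P PQ n m (fun _ _ => c) = c := by
  rw [srcExp_fst hPQ, iidExp_const hP.2]

theorem srcExp_add (F G : (Fin n → X × Y) → (Fin m → ℝ) → ℝ) :
    srcExp P PQ n m (fun s q => F s q + G s q) = srcExp P PQ n m F + srcExp P PQ n m G := by
  simp only [srcExp, iidExp_add]

theorem srcExp_const_mul (F : (Fin n → X × Y) → (Fin m → ℝ) → ℝ) (c : ℝ) :
    srcExp P PQ n m (fun s q => c * F s q) = c * srcExp P PQ n m F := by
  simp only [srcExp, iidExp_const_mul]

theorem prob_eq_srcExp
    (E : (Fin n → X × Y) → GL (Fin n) (ZMod 2) → (Fin (n - k) → ℝ) → Prop) :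
    prob P PQ n k E = srcExp P PQ n (n - k) fun s q => avgGL fun H => ind (E s H q) :=
  expect_eq_srcExp _

theorem expect_mono (hP : P ∈ stdSimplex ℝ (X × Y)) (hPQ : IsParityBiasLaw PQ)
    {F G : (Fin n → X × Y) → GL (Fin n) (ZMod 2) → (Fin (n - k) → ℝ) → ℝ}
    (h : ∀ s H q, (∀ i, 0 < P (s i)) → (∀ j, q j ∈ PQ.support) → F s H q ≤ G s H q) :
    expect P PQ n k F ≤ expect P PQ n k G := by
  rw [expect_eq_srcExp, expect_eq_srcExp]
  exact srcExp_mono hP hPQ fun s q hs hq => avgGL_mono fun H => h s H q hs hq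

theorem prob_mono (hP : P ∈ stdSimplex ℝ (X × Y)) (hPQ : IsParityBiasLaw PQ)
    {E E' : (Fin n → X × Y) → GL (Fin n) (ZMod 2) → (Fin (n - k) → ℝ) → Prop}
    (h : ∀ s H q, (∀ i, 0 < P (s i)) → (∀ j, q j ∈ PQ.support) → E s H q → E' s H q) :
    prob P PQ n k E ≤ prob P PQ n k E' := by
  rw [prob_eq_srcExp, prob_eq_srcExp]
  exact srcExp_mono hP hPQ fun s q hs hq => avgGL_mono fun H => ind_mono (h s H q hs hq)

theorem prob_nonneg (hP : P ∈ stdSimplex ℝ (X × Y)) (hPQ : IsParityBiasLaw PQ)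
    (E : (Fin n → X × Y) → GL (Fin n) (ZMod 2) → (Fin (n - k) → ℝ) → Prop) :
    0 ≤ prob P PQ n k E := by
  rw [prob_eq_srcExp]
  have h := srcExp_const (n := n) (m := n - k) hP hPQ 0
  rw [← h]
  refine srcExp_mono hP hPQ fun s q _ _ => ?_
  rw [← avgGL_const (n := n) 0]
  exact avgGL_mono fun H => ind_nonneg _

theorem prob_or_le (hP : P ∈ stdSimplex ℝ (X × Y)) (hPQ : IsParityBiasLaw PQ)
    (E E' : (Fin n → X × Y) → GL (Fin n) (ZMod 2) → (Fin (n - k) → ℝ) → Prop) :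
    prob P PQ n k (fun s H q => E s H q ∨ E' s H q) ≤ prob P PQ n k E + prob P PQ n k E' := by
  rw [prob_eq_srcExp, prob_eq_srcExp, prob_eq_srcExp, ← srcExp_add]
  refine srcExp_mono hP hPQ fun s q _ _ => ?_
  rw [← avgGL_add]
  exact avgGL_mono fun H => ind_or_le _ _

theorem prob_le_srcExp (hP : P ∈ stdSimplex ℝ (X × Y)) (hPQ : IsParityBiasLaw PQ)
    {E : (Fin n → X × Y) → GL (Fin n) (ZMod 2) → (Fin (n - k) → ℝ) → Prop}
    {G : (Fin n → X × Y) → (Fin (n - k) → ℝ) → ℝ}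
    (h : ∀ s q, (∀ i, 0 < P (s i)) → (∀ j, q j ∈ PQ.support) →
      avgGL (fun H => ind (E s H q)) ≤ G s q) :
    prob P PQ n k E ≤ srcExp P PQ n (n - k) G := by
  rw [prob_eq_srcExp]
  exact srcExp_mono hP hPQ h

/-- A sequence of events whose probability tends to `0`. -/
def Negl (P : X × Y → ℝ) (PQ : ℝ →₀ ℝ) (R : ℝ)
    (E : ∀ n, (Fin n → X × Y) → GL (Fin n) (ZMod 2) → (Fin (n - msgLen R n) → ℝ) → Prop) : Prop :=
  Tendsto (fun n : ℕ => prob P PQ n (msgLen R n) (E n)) atTop (𝓝 0)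

variable {R : ℝ}
  {E E' : ∀ n, (Fin n → X × Y) → GL (Fin n) (ZMod 2) → (Fin (n - msgLen R n) → ℝ) → Prop}

theorem Negl.of_le (hP : P ∈ stdSimplex ℝ (X × Y)) (hPQ : IsParityBiasLaw PQ) {b : ℕ → ℝ}
    (hb : Tendsto b atTop (𝓝 0)) (h : ∀ᶠ n in atTop, prob P PQ n (msgLen R n) (E n) ≤ b n) :
    Negl P PQ R E :=
  tendsto_of_tendsto_of_tendsto_of_le_of_le' tendsto_const_nhds hb
    (Eventually.of_forall fun _ => prob_nonneg hP hPQ _) h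

theorem Negl.mono (hP : P ∈ stdSimplex ℝ (X × Y)) (hPQ : IsParityBiasLaw PQ)
    (hE : Negl P PQ R E')
    (h : ∀ᶠ n in atTop, ∀ s H q, (∀ i, 0 < P (s i)) → (∀ j, q j ∈ PQ.support) →
      E n s H q → E' n s H q) : Negl P PQ R E :=
  Negl.of_le hP hPQ hE (h.mono fun _ hn => prob_mono hP hPQ hn)

theorem Negl.or (hP : P ∈ stdSimplex ℝ (X × Y)) (hPQ : IsParityBiasLaw PQ)
    (hE : Negl P PQ R E) (hE' : Negl P PQ R E') :
    Negl P PQ R fun n s H q => E n s H q ∨ E' n s H q := by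
  have := Tendsto.add hE hE'
  rw [add_zero] at this
  exact Negl.of_le hP hPQ this (Eventually.of_forall fun n => prob_or_le hP hPQ _ _)

theorem msgLen_cast_le (hR : 0 ≤ R) (n : ℕ) : (msgLen R n : ℝ) ≤ n * R :=
  Nat.floor_le (by positivity)

theorem le_msgLen_cast (R : ℝ) (n : ℕ) : n * R - 1 ≤ (msgLen R n : ℝ) := by
  have := Nat.lt_floor_add_one ((n : ℝ) * R)
  unfold msgLen
  linarith

theorem cast_sub_msgLen (hR : R < 1) (n : ℕ) :
    ((n - msgLen R n : ℕ) : ℝ) = n - (msgLen R n : ℝ) := Nat.cast_sub (msgLen_le hR n)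

end Experiment

/-! ### Exponential rates -/

section Rates

theorem two_rpow_neg_nat_mul (n : ℕ) (ρ : ℝ) : (2 : ℝ) ^ (-(n * ρ)) = ((2 : ℝ) ^ (-ρ)) ^ n := by
  rw [← Real.rpow_natCast, ← Real.rpow_mul (by norm_num)]
  congr 1
  ring

theorem tendsto_two_rpow_neg {ρ : ℝ} (hρ : 0 < ρ) :
    Tendsto (fun n : ℕ => (2 : ℝ) ^ (-(n * ρ))) atTop (𝓝 0) := by
  simp only [two_rpow_neg_nat_mul]
  exact tendsto_pow_atTop_nhds_zero_of_lt_one (by positivity)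
    (Real.rpow_lt_one_of_one_lt_of_neg (by norm_num) (by linarith))

theorem tendsto_const_mul_two_rpow_neg (C : ℝ) {ρ : ℝ} (hρ : 0 < ρ) :
    Tendsto (fun n : ℕ => C * (2 : ℝ) ^ (-(n * ρ))) atTop (𝓝 0) := by
  simpa using (tendsto_two_rpow_neg hρ).const_mul C

theorem two_rpow_neg_le {ρ ρ' : ℝ} (h : ρ ≤ ρ') (n : ℕ) :
    (2 : ℝ) ^ (-(n * ρ')) ≤ 2 ^ (-(n * ρ)) :=
  Real.rpow_le_rpow_of_exponent_le (by norm_num)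
    (neg_le_neg (mul_le_mul_of_nonneg_left h (Nat.cast_nonneg n)))

theorem exists_rate {a r : ℝ} (ha : 0 < a) (h0 : 0 ≤ r) (h1 : r < 1) :
    ∃ ρ : ℝ, 0 < ρ ∧ ∀ n m : ℕ, n * a ≤ m → r ^ m ≤ (2 : ℝ) ^ (-(n * ρ)) := by
  -- Keeps the base positive, so that its logarithm is meaningful even for `r = 0`.
  set r' := max r (1 / 2) with hr'
  have hr0 : 0 < r' := lt_of_lt_of_le (by norm_num) (le_max_right _ _)
  have hr1 : r' < 1 := max_lt h1 (by norm_num)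
  have hl : Real.logb 2 r' < 0 := Real.logb_neg (by norm_num) hr0 hr1
  refine ⟨a * -Real.logb 2 r', mul_pos ha (by linarith), fun n m hnm => ?_⟩
  calc r ^ m ≤ r' ^ m := pow_le_pow_left₀ h0 (le_max_left _ _) m
    _ = (2 : ℝ) ^ (Real.logb 2 r' * m) := by
        rw [Real.rpow_mul (by norm_num), Real.rpow_logb (by norm_num) (by norm_num) hr0,
          Real.rpow_natCast]
    _ ≤ _ := by
        refine Real.rpow_le_rpow_of_exponent_le (by norm_num) ?_
        nlinarith

theorem mul_one_sub_le_tail {R : ℝ} (h0 : 0 ≤ R) (h1 : R < 1) (n : ℕ) :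
    n * (1 - R) ≤ ((n - msgLen R n : ℕ) : ℝ) := by
  rw [cast_sub_msgLen h1]
  linarith [msgLen_cast_le h0 n]

theorem tail_le_mul_one_sub {R : ℝ} (h1 : R < 1) (n : ℕ) :
    ((n - msgLen R n : ℕ) : ℝ) ≤ n * (1 - R) + 1 := by
  rw [cast_sub_msgLen h1]
  linarith [le_msgLen_cast R n]

/-- Replacing `n - ⌊nR⌋` by `n (1 - R)` in an exponent costs a bounded amount, later absorbed by a
term linear in `n`. -/
theorem abs_tail_mul_sub_le {R : ℝ} (h0 : 0 ≤ R) (h1 : R < 1) (n : ℕ) (c : ℝ) :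
    |((n - msgLen R n : ℕ) : ℝ) * c - n * (1 - R) * c| ≤ |c| := by
  rw [← sub_mul, abs_mul]
  refine mul_le_of_le_one_left (abs_nonneg c) (abs_le.2 ⟨?_, ?_⟩)
  · linarith [mul_one_sub_le_tail h0 h1 n]
  · linarith [tail_le_mul_one_sub h1 n]

variable {A : Type*} {S : Finset A} {p : A → ℝ}

/-- Exponential form of the Chernoff bound, with block length `m ≥ n a`. -/
theorem exists_chernoff_rate (hp : ∀ a ∈ S, 0 ≤ p a) (h1 : ∑ a ∈ S, p a = 1) (pp : A → ℝ)
    (hpp : ∀ a ∈ S, pp a ∈ Set.Icc (0 : ℝ) 1) (g : A → ZMod 2 → ℝ) {m : ℝ}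
    (hm : ∑ a ∈ S, p a * ∑ b, bern (pp a) b * g a b < m) {c : ℝ} (hc : 0 < c) :
    ∃ ρ : ℝ, 0 < ρ ∧ ∀ n l : ℕ, n * c ≤ l →
      iidExp S p l (fun s => ∑ z, weight (fun i => pp (s i)) z *
        ind ((l : ℝ) * m ≤ ∑ i, g (s i) (z i))) ≤ (2 : ℝ) ^ (-(n * ρ)) := by
  obtain ⟨r, hr0, hr1, hr⟩ := exists_chernoff hp h1 pp hpp g hm
  obtain ⟨ρ, hρ, h⟩ := exists_rate hc hr0 hr1
  exact ⟨ρ, hρ, fun n l hl => (hr l).trans (h n l hl)⟩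

/-- Chernoff bound for a finite family of deviations. -/
theorem exists_chernoff_family (hp : ∀ a ∈ S, 0 ≤ p a) (h1 : ∑ a ∈ S, p a = 1) (pp : A → ℝ)
    (hpp : ∀ a ∈ S, pp a ∈ Set.Icc (0 : ℝ) 1) {ι : Type*} [Fintype ι]
    (g : ι → A → ZMod 2 → ℝ) (m : ι → ℝ)
    (hm : ∀ i, ∑ a ∈ S, p a * ∑ b, bern (pp a) b * g i a b < m i) {c : ℝ} (hc : 0 < c) :
    ∃ ρ : ℝ, 0 < ρ ∧ ∀ n l : ℕ, n * c ≤ l →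
      iidExp S p l (fun s => ∑ z, weight (fun i => pp (s i)) z *
        ind (∃ i, (l : ℝ) * m i ≤ ∑ j, g i (s j) (z j))) ≤
          Fintype.card ι * (2 : ℝ) ^ (-(n * ρ)) := by
  choose ρ hρ h using fun i => exists_chernoff_rate hp h1 pp hpp (g i) (hm i) hc
  have hsum : ∀ i, (ρ i)⁻¹ ≤ 1 + ∑ j, (ρ j)⁻¹ := fun i => by
    have := Finset.single_le_sum (f := fun j => (ρ j)⁻¹) (fun j _ => (inv_pos.2 (hρ j)).le)
      (Finset.mem_univ i)
    linarith
  have hpos : 0 < 1 + ∑ j, (ρ j)⁻¹ := by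
    have : 0 ≤ ∑ j, (ρ j)⁻¹ := Finset.sum_nonneg fun j _ => (inv_pos.2 (hρ j)).le
    linarith
  -- A positive rate below every `ρ i`, also meaningful for an empty family.
  refine ⟨(1 + ∑ j, (ρ j)⁻¹)⁻¹, inv_pos.2 hpos, fun n l hl => ?_⟩
  calc _ ≤ iidExp S p l (fun s => ∑ i, ∑ z, weight (fun i => pp (s i)) z *
        ind ((l : ℝ) * m i ≤ ∑ j, g i (s j) (z j))) := by
        refine iidExp_mono hp fun s hs _ => ?_
        rw [Finset.sum_comm]
        refine Finset.sum_le_sum fun z _ => ?_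
        rw [← Finset.mul_sum]
        exact mul_le_mul_of_nonneg_left (ind_exists_le _)
          (weight_nonneg (fun i => hpp _ (hs i)) z)
    _ = ∑ i, iidExp S p l (fun s => ∑ z, weight (fun i => pp (s i)) z *
        ind ((l : ℝ) * m i ≤ ∑ j, g i (s j) (z j))) := by
        simp only [iidExp]
        rw [Finset.sum_comm]
        simp only [Finset.mul_sum]
    _ ≤ ∑ _i : ι, (2 : ℝ) ^ (-(n * (1 + ∑ j, (ρ j)⁻¹)⁻¹)) :=
        Finset.sum_le_sum fun i _ => (h i n l hl).trans
          (two_rpow_neg_le (inv_le_of_inv_le₀ (hρ i) (hsum i)) n)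
    _ = _ := by simp

end Rates

/-! ### Weights of pairs seen by the encoder and the decoder -/

section PairWeight

variable {A : Type*} {n k : ℕ}

/-- Weight of a pair `(z, u)` with biases `pp (s_i)` for `z` and `[1/2, …, 1/2, qq (q_j)]`
for `u`. -/
def pairWeight (pp : A → ℝ) (qq : ℝ → ℝ) (s : Fin n → A) (q : Fin (n - k) → ℝ)
    (z u : Fin n → ZMod 2) : ℝ :=
  weight (fun i => pp (s i)) z * weight (concat (fun _ : Fin k => (1 / 2 : ℝ)) fun j => qq (q j)) u

/-- Weight of a pair `(z, u)` with biases `pp (s_i)` for `z` and `[m, q]` for `u`. -/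
def msgWeight (pp : A → ℝ) (s : Fin n → A) (m : Fin k → ZMod 2) (q : Fin (n - k) → ℝ)
    (z u : Fin n → ZMod 2) : ℝ :=
  weight (fun i => pp (s i)) z * weight (concat (fun i : Fin k => ((m i).val : ℝ)) q) u

/-- The weight threshold `2 ^ (-n (1 + δ))`. -/
def threshold (n : ℕ) (δ : ℝ) : ℝ := (2 : ℝ) ^ (-(n * (1 + δ)))

theorem threshold_pos (n : ℕ) (δ : ℝ) : 0 < threshold n δ := Real.rpow_pos_of_pos (by norm_num) _

theorem threshold_inv (n : ℕ) (δ : ℝ) : (threshold n δ)⁻¹ = 2 ^ n * (2 : ℝ) ^ (n * δ) := by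
  rw [threshold, ← Real.rpow_neg (by norm_num), neg_neg, mul_add, mul_one,
    Real.rpow_add (by norm_num), Real.rpow_natCast]

theorem half_mem_Icc : (1 / 2 : ℝ) ∈ Set.Icc (0 : ℝ) 1 := by constructor <;> norm_num

/-- Union bound, with the coordinates irrelevant to each event summed out. The result involves only
quantities that Chernoff bounds control. -/
theorem sum_weight_ind_or_le (hk : k ≤ n) {p : Fin n → ℝ} {b : Fin (n - k) → ℝ}
    (hp : ∀ i, p i ∈ Set.Icc (0 : ℝ) 1) (hb : ∀ j, b j ∈ Set.Icc (0 : ℝ) 1)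
    (T : (Fin n → ZMod 2) → Prop) (U : (Fin (n - k) → ZMod 2) → Prop) :
    ∑ z, weight p z * ∑ u, weight (concat (fun _ : Fin k => (1 / 2 : ℝ)) b) u *
        ind (T z ∨ U (tail k u)) ≤
      ∑ z, weight p z * ind (T z) + ∑ v, weight b v * ind (U v) := by
  have ha : ∀ i, concat (fun _ : Fin k => (1 / 2 : ℝ)) b i ∈ Set.Icc (0 : ℝ) 1 :=
    concat_mem_Icc (fun _ => half_mem_Icc) hb
  have h3 : ∀ z, ∑ u, weight (concat (fun _ : Fin k => (1 / 2 : ℝ)) b) u *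
      ind (T z ∨ U (tail k u)) ≤ ind (T z) + ∑ v, weight b v * ind (U v) := by
    intro z
    rw [← sum_weight_concat_tail hk (fun _ : Fin k => (1 / 2 : ℝ)) b fun v => ind (U v)]
    calc _ ≤ ∑ u, (weight (concat (fun _ : Fin k => (1 / 2 : ℝ)) b) u * ind (T z) +
          weight (concat (fun _ : Fin k => (1 / 2 : ℝ)) b) u * ind (U (tail k u))) := by
          refine Finset.sum_le_sum fun u _ => ?_
          rw [← mul_add]
          exact mul_le_mul_of_nonneg_left (ind_or_le _ _) (weight_nonneg ha u)
      _ = _ := by rw [Finset.sum_add_distrib, ← Finset.sum_mul, sum_weight, one_mul]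
  refine (Finset.sum_le_sum fun z _ =>
    mul_le_mul_of_nonneg_left (h3 z) (weight_nonneg hp z)).trans (le_of_eq ?_)
  simp only [mul_add]
  rw [Finset.sum_add_distrib, ← Finset.sum_mul, sum_weight, one_mul]

theorem weight_concat_half (hk : k ≤ n) (q : Fin (n - k) → ℝ) (u : Fin n → ZMod 2) :
    weight (concat (fun _ : Fin k => (1 / 2 : ℝ)) q) u = (1 / 2) ^ k * weight q (tail k u) := by
  rw [weight_concat hk, weight_half]

theorem pairWeight_nonneg {pp : A → ℝ} {qq : ℝ → ℝ} {s : Fin n → A} {q : Fin (n - k) → ℝ}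
    (hp : ∀ i, pp (s i) ∈ Set.Icc (0 : ℝ) 1) (hq : ∀ j, qq (q j) ∈ Set.Icc (0 : ℝ) 1)
    (z u : Fin n → ZMod 2) : 0 ≤ pairWeight pp qq s q z u :=
  mul_nonneg (weight_nonneg hp z) (weight_nonneg (concat_mem_Icc (fun _ => half_mem_Icc) hq) u)

theorem logb_weight {q : Fin n → ℝ} {u : Fin n → ZMod 2} (h : weight q u ≠ 0) :
    Real.logb 2 (weight q u) = ∑ i, Real.logb 2 (bern (q i) (u i)) := by
  rw [weight_eq_prod] at h ⊢
  rw [Real.logb_prod]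
  exact fun i _ => Finset.prod_ne_zero_iff.1 h i (Finset.mem_univ i)

theorem logb_pairWeight (hk : k ≤ n) {pp : A → ℝ} {qq : ℝ → ℝ} {s : Fin n → A}
    {q : Fin (n - k) → ℝ} {z u : Fin n → ZMod 2} (h : pairWeight pp qq s q z u ≠ 0) :
    Real.logb 2 (pairWeight pp qq s q z u) = ∑ i, Real.logb 2 (bern (pp (s i)) (z i)) - k +
      ∑ j, Real.logb 2 (bern (qq (q j)) (tail k u j)) := by
  rw [pairWeight, weight_concat_half hk] at h ⊢
  have h1 := left_ne_zero_of_mul h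
  have h2 := right_ne_zero_of_mul h
  have h3 := right_ne_zero_of_mul h2
  rw [Real.logb_mul h1 h2, Real.logb_mul (left_ne_zero_of_mul h2) h3, logb_weight h1,
    logb_weight h3, Real.logb_pow, one_div, Real.logb_inv, Real.logb_self_eq_one (by norm_num)]
  ring

end PairWeight

/-! ### Negligible events -/

section Negligible

variable {X Y : Type*} [Fintype X] [Fintype Y] {P : X × Y → ℝ} {W : X → ZMod 2 → ℝ} {R : ℝ}
  {PQ : ℝ →₀ ℝ}

/-- Encoder bias as a function of the source letter pair. -/
def srcBias (Y : Type*) (W : X → ZMod 2 → ℝ) (s : X × Y) : ℝ := encBias W s.1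

/-- Decoder bias as a function of the source letter pair. -/
def sideBias (P : X × Y → ℝ) (W : X → ZMod 2 → ℝ) (s : X × Y) : ℝ := decBias P W s.2

/-- An event on `(s, z)` and `(q, u)` of exponentially small probability under the ideal law is
not caused by a nonzero heavy word. -/
theorem negl_heavy_atypical (hP : P ∈ stdSimplex ℝ (X × Y))
    (hW : ∀ x, W x ∈ stdSimplex ℝ (ZMod 2)) (hR1 : R < 1) (hPQ : IsParityBiasLaw PQ)
    (T : ∀ n, (Fin n → X × Y) → (Fin n → ZMod 2) → Prop)
    (U : ∀ m : ℕ, (Fin m → ℝ) → (Fin m → ZMod 2) → Prop)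
    {C ρ δ : ℝ} (hδ : δ < ρ)
    (hT : ∀ n, iidExp Finset.univ P n (fun s => ∑ z, weight (fun i => srcBias Y W (s i)) z *
      ind (T n s z)) ≤ C * (2 : ℝ) ^ (-(n * ρ)))
    (hU : ∀ n, iidExp PQ.support PQ (n - msgLen R n) (fun q => ∑ v, weight q v *
      ind (U (n - msgLen R n) q v)) ≤ C * (2 : ℝ) ^ (-(n * ρ))) :
    Negl P PQ R fun n s H q => ∃ z, z ≠ 0 ∧
      (threshold n δ ≤ pairWeight (srcBias Y W) (fun t => t) s q z (parity H z) ∧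
        (T n s z ∨ U _ q (tail (msgLen R n) (parity H z)))) := by
  refine Negl.of_le hP hPQ (tendsto_const_mul_two_rpow_neg (4 * C) (sub_pos.2 hδ))
    (Eventually.of_forall fun n => ?_)
  have hk := msgLen_le hR1 n
  set k := msgLen R n with hkdef
  -- Heaviness turns counting into mass at the price `(threshold n δ)⁻¹ = 2 ^ n * 2 ^ (nδ)`; the
  -- hitting probability `2 / 2 ^ n` cancels the `2 ^ n`.
  refine (prob_le_srcExp (G := fun s q => 2 * (2 : ℝ) ^ (n * δ) *
    (∑ z, weight (fun i => srcBias Y W (s i)) z * ind (T n s z) +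
      ∑ v, weight q v * ind (U (n - k) q v))) hP hPQ fun s q _ hq => ?_).trans ?_
  · have hq' : ∀ j, q j ∈ Set.Icc (0 : ℝ) 1 := fun j => hPQ.mem_Icc _ (hq j)
    have hp : ∀ i, srcBias Y W (s i) ∈ Set.Icc (0 : ℝ) 1 := fun i => encBias_mem hW _
    have ha : ∀ i, concat (fun _ : Fin k => (1 / 2 : ℝ)) q i ∈ Set.Icc (0 : ℝ) 1 :=
      concat_mem_Icc (fun _ => half_mem_Icc) hq'
    refine (avgGL_exists_le fun z u =>
      threshold n δ ≤ pairWeight (srcBias Y W) (fun t => t) s q z u ∧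
        (T n s z ∨ U _ q (tail k u))).trans ?_
    have h1 := sum_ind_weight_le hp ha (threshold_pos n δ)
      fun z u => T n s z ∨ U _ q (tail k u)
    refine (mul_le_mul_of_nonneg_left h1 (by positivity)).trans ?_
    rw [threshold_inv]
    have h2 := sum_weight_ind_or_le hk hp hq' (T n s) (U (n - k) q)
    calc _ = 2 * (2 : ℝ) ^ (n * δ) * _ := by
          rw [← mul_assoc]
          congr 1
          field_simp
      _ ≤ _ := mul_le_mul_of_nonneg_left h2 (by positivity)
  · rw [srcExp_const_mul, srcExp_add, srcExp_fst hPQ, srcExp_snd hP]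
    calc _ ≤ 2 * (2 : ℝ) ^ (n * δ) * (C * (2 : ℝ) ^ (-(n * ρ)) + C * (2 : ℝ) ^ (-(n * ρ))) :=
          mul_le_mul_of_nonneg_left (add_le_add (hT n) (hU n)) (by positivity)
      _ = 4 * C * ((2 : ℝ) ^ (n * δ) * (2 : ℝ) ^ (-(n * ρ))) := by ring
      _ = _ := by
          rw [← Real.rpow_add (by norm_num)]
          congr 2
          ring

/-- Two distinct words are not simultaneously heavy for the encoder and the decoder. -/
theorem negl_confusion (hP : P ∈ stdSimplex ℝ (X × Y))
    (hW : ∀ x, W x ∈ stdSimplex ℝ (ZMod 2)) (hR1 : R < 1)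
    (hPQ : IsParityBiasLaw PQ) {c δ : ℝ} (hc : 0 < c) (hδc : δ < c) (hδR : δ < R) :
    Negl P PQ R fun n s H q => ∃ z z', z ≠ z' ∧
      threshold n δ ≤ pairWeight (srcBias Y W) (fun t => t) s q z (parity H z) ∧
      threshold n (-c) ≤ msgWeight (sideBias P W) s
        (head (msgLen_le hR1 n) (parity H z)) q z' (parity H z') := by
  have hb : Tendsto (fun n : ℕ => 4 * (2 : ℝ) ^ (-(n * (c - δ))) +
      (2 * (2 : ℝ) ^ (-(n * c)) + 4 * (2 : ℝ) ^ (-(n * (R - δ))))) atTop (𝓝 0) := by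
    simpa using (tendsto_const_mul_two_rpow_neg 4 (sub_pos.2 hδc)).add
      ((tendsto_const_mul_two_rpow_neg 2 hc).add
        (tendsto_const_mul_two_rpow_neg 4 (sub_pos.2 hδR)))
  refine Negl.of_le hP hPQ hb (Eventually.of_forall fun n => ?_)
  have hk := msgLen_le hR1 n
  have hkR := le_msgLen_cast R n
  set k := msgLen R n with hkdef
  refine (prob_le_srcExp (G := fun _ _ => _) hP hPQ fun s q _ hq => ?_).trans
    (srcExp_const hP hPQ _).le
  have hq' : ∀ j, q j ∈ Set.Icc (0 : ℝ) 1 := fun j => hPQ.mem_Icc _ (hq j)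
  have hp : ∀ i, srcBias Y W (s i) ∈ Set.Icc (0 : ℝ) 1 := fun i => encBias_mem hW _
  have hd : ∀ i, sideBias P W (s i) ∈ Set.Icc (0 : ℝ) 1 := fun i => decBias_mem hP hW _
  have ha : ∀ i, concat (fun _ : Fin k => (1 / 2 : ℝ)) q i ∈ Set.Icc (0 : ℝ) 1 :=
    concat_mem_Icc (fun _ => half_mem_Icc) hq'
  have hm : ∀ m : Fin k → ZMod 2, ∀ i, concat (fun i : Fin k => ((m i).val : ℝ)) q i ∈
      Set.Icc (0 : ℝ) 1 := fun m => concat_mem_Icc (fun i => val_mem_Icc (m i)) hq'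
  let A : (Fin n → ZMod 2) → (Fin n → ZMod 2) → Prop := fun z u =>
    threshold n δ ≤ pairWeight (srcBias Y W) (fun t => t) s q z u
  let B : (Fin n → ZMod 2) → (Fin n → ZMod 2) → (Fin n → ZMod 2) → Prop := fun u z' u' =>
    threshold n (-c) ≤ msgWeight (sideBias P W) s (head hk u) q z' u'
  have hA : ∑ z, ∑ u, ind (A z u) ≤ 2 ^ n * (2 : ℝ) ^ (n * δ) := by
    rw [← threshold_inv]
    exact sum_ind_weight_le_inv hp ha (threshold_pos n δ)
  -- For a fixed message `[m, q]` still defines a probability law, so at most `2 ^ (n(1-c))` pairs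
  -- are heavy for the decoder.
  have hB : ∀ u, 2 / 2 ^ n * ∑ z', ∑ u', ind (B u z' u') ≤ 2 * (2 : ℝ) ^ (-(n * c)) := by
    intro u
    have := sum_ind_weight_le_inv hd (hm (head hk u)) (threshold_pos n (-c))
    rw [threshold_inv] at this
    refine (mul_le_mul_of_nonneg_left this (by positivity)).trans (le_of_eq ?_)
    rw [mul_neg]
    field_simp
  have hAnn : ∀ z u, 0 ≤ ind (A z u) := fun z u => ind_nonneg _
  -- The image of the zero word is not random. If `z = 0` the message is zero and one random image
  -- remains; if `z' = 0` then positive decoder weight forces the message of `z` to be zero.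
  have hsplit : ∀ H : GL (Fin n) (ZMod 2),
      ind (∃ z z', z ≠ z' ∧ A z (parity H z) ∧ B (parity H z) z' (parity H z')) ≤
      ind (∃ z, ∃ z', (z ≠ 0 ∧ z' ≠ 0 ∧ z ≠ z') ∧ A z (parity H z) ∧
        B (parity H z) z' (parity H z')) +
      (ind (∃ z', z' ≠ 0 ∧ B 0 z' (parity H z')) +
        ind (∃ z, z ≠ 0 ∧ (A z (parity H z) ∧ head hk (parity H z) = 0))) := by
    intro H
    refine le_trans (ind_mono ?_) ((ind_or_le _ _).trans (add_le_add_right (ind_or_le _ _) _))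
    rintro ⟨z, z', hzz, h1, h2⟩
    by_cases hz : z = 0
    · subst hz
      rw [parity_zero] at h2
      exact Or.inr (Or.inl ⟨z', Ne.symm hzz, h2⟩)
    by_cases hz' : z' = 0
    · subst hz'
      refine Or.inr (Or.inr ⟨z, hz, h1, ?_⟩)
      have h3 := (threshold_pos n (-c)).trans_le h2
      rw [parity_zero, msgWeight, weight_concat hk] at h3
      have h4 := left_ne_zero_of_mul (right_ne_zero_of_mul h3.ne')
      exact (eq_of_weight_val_ne_zero h4).symm
    · exact Or.inl ⟨z, z', ⟨hz, hz', hzz⟩, h1, h2⟩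
  refine (avgGL_mono hsplit).trans ?_
  rw [avgGL_add, avgGL_add]
  refine add_le_add ?_ (add_le_add ?_ ?_)
  · refine (avgGL_exists_pair_le A B).trans ?_
    calc ∑ z, ∑ u, ind (A z u) * (2 / 2 ^ n * (2 / 2 ^ n * ∑ z', ∑ u', ind (B u z' u')))
        ≤ ∑ z, ∑ u, ind (A z u) * (2 / 2 ^ n * (2 * (2 : ℝ) ^ (-(n * c)))) := by
          refine Finset.sum_le_sum fun z _ => Finset.sum_le_sum fun u _ => ?_
          exact mul_le_mul_of_nonneg_left
            (mul_le_mul_of_nonneg_left (hB u) (by positivity)) (hAnn z u)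
      _ = (∑ z, ∑ u, ind (A z u)) * (2 / 2 ^ n * (2 * (2 : ℝ) ^ (-(n * c)))) := by
          simp only [Finset.sum_mul]
      _ ≤ (2 ^ n * (2 : ℝ) ^ (n * δ)) * (2 / 2 ^ n * (2 * (2 : ℝ) ^ (-(n * c)))) :=
          mul_le_mul_of_nonneg_right hA (by positivity)
      _ = 4 * ((2 : ℝ) ^ (n * δ) * (2 : ℝ) ^ (-(n * c))) := by field_simp; norm_num
      _ = _ := by
          rw [← Real.rpow_add (by norm_num)]
          congr 2
          ring
  · exact (avgGL_exists_le fun z' u' => B 0 z' u').trans (hB 0)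
  · refine (avgGL_exists_le fun z u => A z u ∧ head hk u = 0).trans ?_
    have h1 := sum_ind_weight_le hp ha (threshold_pos n δ) fun _ u => head hk u = 0
    have h2 : ∑ u, weight (concat (fun _ : Fin k => (1 / 2 : ℝ)) q) u * ind (head hk u = 0) =
        (1 / 2) ^ k := by
      rw [sum_weight_concat_head hk _ _ fun v => ind (v = 0), Finset.sum_eq_single 0]
      · rw [ind_true rfl, mul_one, weight_half]
      · intro v _ hv
        rw [ind_false hv, mul_zero]
      · simp
    simp only [h2] at h1
    rw [← Finset.sum_mul, sum_weight, one_mul, threshold_inv] at h1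
    refine (mul_le_mul_of_nonneg_left h1 (by positivity)).trans ?_
    -- The factor `2` pays for the rounding in `k ≥ nR - 1`.
    have h3 : (1 / 2 : ℝ) ^ k ≤ 2 * (2 : ℝ) ^ (-(n * R)) := by
      have : (1 / 2 : ℝ) ^ k = (2 : ℝ) ^ (-(k : ℝ)) := by
        rw [Real.rpow_neg (by norm_num), Real.rpow_natCast]
        simp
      rw [this]
      calc (2 : ℝ) ^ (-(k : ℝ)) ≤ (2 : ℝ) ^ (1 + -(n * R)) :=
            Real.rpow_le_rpow_of_exponent_le (by norm_num) (by linarith)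
        _ = _ := by rw [Real.rpow_add (by norm_num), Real.rpow_one]
    calc 2 / 2 ^ n * (2 ^ n * (2 : ℝ) ^ (n * δ) * (1 / 2) ^ k)
        = 2 * (2 : ℝ) ^ (n * δ) * (1 / 2) ^ k := by field_simp
      _ ≤ 2 * (2 : ℝ) ^ (n * δ) * (2 * (2 : ℝ) ^ (-(n * R))) :=
          mul_le_mul_of_nonneg_left h3 (by positivity)
      _ = 4 * ((2 : ℝ) ^ (n * δ) * (2 : ℝ) ^ (-(n * R))) := by ring
      _ = _ := by
          rw [← Real.rpow_add (by norm_num)]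
          congr 2
          ring

end Negligible

/-! ### The zero word -/

section Zero

variable {X Y : Type*} [Fintype X] [Fintype Y] {P : X × Y → ℝ} {W : X → ZMod 2 → ℝ} {R : ℝ}
  {PQ : ℝ →₀ ℝ}

theorem encBias_eq_zero_or_one (hP : P ∈ stdSimplex ℝ (X × Y))
    (hW : ∀ x, W x ∈ stdSimplex ℝ (ZMod 2)) (h : condEntropy (lawXZ P W) = 0) {s : X × Y}
    (hs : 0 < P s) : encBias W s.1 = 0 ∨ encBias W s.1 = 1 := by
  rw [condEntropy_lawXZ hW, Finset.sum_eq_zero_iff_of_nonneg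
    fun s _ => mul_nonneg (hP.1 s) (Hb_nonneg (encBias_mem hW s.1))] at h
  have := h s (Finset.mem_univ s)
  exact Hb_eq_zero ((mul_eq_zero.1 this).resolve_left hs.ne')

/-- `H_b ≤ 1` with equality only at `1/2`, so a mean equal to `1` leaves no other point. -/
theorem eq_half_of_mem_support (hPQ : IsParityBiasLaw PQ)
    (h : (PQ.sum fun q w => w * Hb q) = 1) {q : ℝ} (hq : q ∈ PQ.support) : q = 1 / 2 := by
  have h1 := hPQ.sum_eq_one
  simp only [Finsupp.sum] at h h1
  have h2 : ∑ q ∈ PQ.support, PQ q * (1 - Hb q) = 0 := by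
    simp only [mul_sub, mul_one, Finset.sum_sub_distrib, h, h1, sub_self]
  rw [Finset.sum_eq_zero_iff_of_nonneg
    fun q _ => mul_nonneg (hPQ.nonneg q) (by linarith [Hb_le_one q])] at h2
  have h3 := (mul_eq_zero.1 (h2 q hq)).resolve_left (Finsupp.mem_support_iff.1 hq)
  by_contra hne
  linarith [Hb_lt_one hne]

theorem sum_comp_one_sub (hPQ : IsParityBiasLaw PQ) (g : ℝ → ℝ) :
    ∑ q ∈ PQ.support, PQ q * g (1 - q) = ∑ q ∈ PQ.support, PQ q * g q := by
  refine Finset.sum_bij' (fun q _ => 1 - q) (fun q _ => 1 - q) ?_ ?_ ?_ ?_ ?_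
  · intro q hq
    rw [Finsupp.mem_support_iff] at hq ⊢
    rwa [hPQ.symm]
  · intro q hq
    rw [Finsupp.mem_support_iff] at hq ⊢
    rwa [hPQ.symm]
  · intro q _; ring
  · intro q _; ring
  · intro q _
    rw [hPQ.symm]

theorem sqrt_le_half_add {x : ℝ} (hx : 0 ≤ x) : √x ≤ (x + 1) / 2 := by
  nlinarith [sq_nonneg (√x - 1), Real.sq_sqrt hx]

theorem sqrt_lt_half_add {x : ℝ} (hx : 0 ≤ x) (h1 : x ≠ 1) : √x < (x + 1) / 2 := by
  have : √x - 1 ≠ 0 := by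
    intro h
    have h2 : √x = 1 := by linarith
    rw [Real.sqrt_eq_one] at h2
    exact h1 h2
  have := sq_pos_of_ne_zero this
  nlinarith [Real.sq_sqrt hx]

/-- By symmetry `2(1 - Q)` has mean exactly `1`, so its powers do not decay in mean; its square root
does, since `√x ≤ (x + 1) / 2` is strict off `x = 1`. -/
theorem sum_sqrt_lt_one (hPQ : IsParityBiasLaw PQ) {q₀ : ℝ} (hq₀ : q₀ ∈ PQ.support)
    (hne : q₀ ≠ 1 / 2) : ∑ q ∈ PQ.support, PQ q * √(2 * (1 - q)) < 1 := by
  have h1 : ∑ q ∈ PQ.support, PQ q = 1 := hPQ.sum_eq_one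
  have hsym := sum_comp_one_sub hPQ fun q => q
  simp only [mul_sub, mul_one, Finset.sum_sub_distrib, h1] at hsym
  have hnn : ∀ q ∈ PQ.support, 0 ≤ 2 * (1 - q) := fun q hq => by
    linarith [(hPQ.mem_Icc q hq).2]
  calc ∑ q ∈ PQ.support, PQ q * √(2 * (1 - q))
      < ∑ q ∈ PQ.support, PQ q * ((2 * (1 - q) + 1) / 2) := by
        refine Finset.sum_lt_sum (fun q hq => mul_le_mul_of_nonneg_left
          (sqrt_le_half_add (hnn q hq)) (hPQ.nonneg q)) ⟨q₀, hq₀, ?_⟩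
        refine mul_lt_mul_of_pos_left (sqrt_lt_half_add (hnn q₀ hq₀) ?_) ?_
        · intro h
          apply hne
          linarith
        · exact lt_of_le_of_ne (hPQ.nonneg q₀) (Ne.symm (Finsupp.mem_support_iff.1 hq₀))
    _ = ∑ q ∈ PQ.support, (3 / 2 * PQ q - PQ q * q) := by
        refine Finset.sum_congr rfl fun q _ => ?_
        ring
    _ = 1 := by
        rw [Finset.sum_sub_distrib, ← Finset.mul_sum, h1]
        linarith

/-- When the parity biases are not all `1/2`, the zero word is never heavy. -/
theorem exists_negl_zero_heavy (hP : P ∈ stdSimplex ℝ (X × Y))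
    (hW : ∀ x, W x ∈ stdSimplex ℝ (ZMod 2)) (hR0 : 0 ≤ R) (hR1 : R < 1)
    (hPQ : IsParityBiasLaw PQ) {q₀ : ℝ} (hq₀ : q₀ ∈ PQ.support) (hne : q₀ ≠ 1 / 2) :
    ∃ ρ : ℝ, 0 < ρ ∧ ∀ δ, 0 ≤ δ → δ < ρ → Negl P PQ R fun n s _ q =>
      threshold n δ ≤ pairWeight (k := msgLen R n) (srcBias Y W) (fun t => t) s q 0 0 := by
  have hr0 : 0 ≤ ∑ q ∈ PQ.support, PQ q * √(2 * (1 - q)) :=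
    Finset.sum_nonneg fun q _ => mul_nonneg (hPQ.nonneg q) (Real.sqrt_nonneg _)
  obtain ⟨ρ, hρ, h⟩ := exists_rate (a := 1 - R) (by linarith) hr0 (sum_sqrt_lt_one hPQ hq₀ hne)
  refine ⟨ρ, hρ, fun δ hδ0 hδ => ?_⟩
  refine Negl.of_le hP hPQ (tendsto_const_mul_two_rpow_neg 1 (sub_pos.2 hδ))
    (Eventually.of_forall fun n => ?_)
  have hk := msgLen_le hR1 n
  have hl := mul_one_sub_le_tail hR0 hR1 n
  set k := msgLen R n with hkdef
  -- Markov's inequality for the square root: a heavy zero word forces `∏ 2(1 - q_j) ≥ 2 ^ (-nδ)`,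
  -- hence the same lower bound for its root, as `2 ^ (-nδ) ≤ 1`.
  refine (prob_le_srcExp (G := fun _ q => (2 : ℝ) ^ (n * δ) * ∏ j, √(2 * (1 - q j))) hP hPQ
    fun s q _ hq => ?_).trans ?_
  · rw [avgGL_const]
    have hq' : ∀ j, q j ∈ Set.Icc (0 : ℝ) 1 := fun j => hPQ.mem_Icc _ (hq j)
    by_cases hth : threshold n δ ≤ pairWeight (k := k) (srcBias Y W) (fun t => t) s q 0 0
    swap
    · rw [ind_false hth]
      exact mul_nonneg (by positivity) (Finset.prod_nonneg fun j _ => Real.sqrt_nonneg _)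
    rw [ind_true hth]
    have hnn : ∀ j, 0 ≤ 2 * (1 - q j) := fun j => by linarith [(hq' j).2]
    set x := ∏ j, (2 * (1 - q j)) with hx
    have hx0 : 0 ≤ x := Finset.prod_nonneg fun j _ => hnn j
    have hsqrt : ∏ j, √(2 * (1 - q j)) = √x := by
      refine ((Real.sqrt_eq_iff_mul_self_eq hx0 (Finset.prod_nonneg fun j _ =>
        Real.sqrt_nonneg _)).2 ?_).symm
      rw [← Finset.prod_mul_distrib]
      exact Finset.prod_congr rfl fun j _ => (Real.mul_self_sqrt (hnn j)).symm
    have hw : pairWeight (k := k) (srcBias Y W) (fun t => t) s q 0 0 ≤ (2 ^ n)⁻¹ * x := by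
      rw [pairWeight, weight_concat_half hk]
      have h1 : weight q (tail k 0) = ∏ j, (1 - q j) := by
        rw [weight_eq_prod]
        exact Finset.prod_congr rfl fun j _ => bern_zero _
      have h2 : x = 2 ^ (n - k) * ∏ j, (1 - q j) := by
        rw [hx, Finset.prod_mul_distrib]
        simp
      have h3 : (2 : ℝ) ^ n = 2 ^ k * 2 ^ (n - k) := by rw [← pow_add]; congr 1; omega
      have h4 : 0 ≤ ∏ j, (1 - q j) := Finset.prod_nonneg fun j _ => by linarith [(hq' j).2]
      rw [h1, h2, h3]
      have h5 : ((2 : ℝ) ^ k * 2 ^ (n - k))⁻¹ * (2 ^ (n - k) * ∏ j, (1 - q j)) =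
          (1 / 2) ^ k * ∏ j, (1 - q j) := by
        rw [one_div, inv_pow]
        field_simp
      rw [h5]
      exact mul_le_of_le_one_left (by positivity) (weight_le_one (fun i => encBias_mem hW _) _)
    have hx1 : (2 : ℝ) ^ (-(n * δ)) ≤ x := by
      have h1 := hth.trans hw
      have h2 : threshold n δ = (2 ^ n)⁻¹ * (2 : ℝ) ^ (-(n * δ)) := by
        rw [threshold, mul_add, mul_one, neg_add, Real.rpow_add (by norm_num),
          Real.rpow_neg (by norm_num) (n : ℝ), Real.rpow_natCast]
      rw [h2] at h1
      exact le_of_mul_le_mul_left h1 (by positivity)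
    have hy1 : (2 : ℝ) ^ (-(n * δ)) ≤ 1 :=
      Real.rpow_le_one_of_one_le_of_nonpos (by norm_num) (by
        have : 0 ≤ n * δ := by positivity
        linarith)
    have hy : (2 : ℝ) ^ (-(n * δ)) ≤ √x := by
      refine Real.le_sqrt_of_sq_le ?_
      have : (0 : ℝ) < (2 : ℝ) ^ (-(n * δ)) := by positivity
      nlinarith
    rw [hsqrt]
    calc (1 : ℝ) = (2 : ℝ) ^ (n * δ) * (2 : ℝ) ^ (-(n * δ)) := by
          rw [← Real.rpow_add (by norm_num)]; simp
      _ ≤ _ := mul_le_mul_of_nonneg_left hy (by positivity)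
  · rw [srcExp_const_mul, srcExp_snd hP, iidExp_prod fun a => √(2 * (1 - a))]
    calc _ ≤ (2 : ℝ) ^ (n * δ) * (2 : ℝ) ^ (-(n * ρ)) :=
          mul_le_mul_of_nonneg_left (h n _ hl) (by positivity)
      _ = _ := by
          rw [← Real.rpow_add (by norm_num), one_mul]
          congr 1
          ring

/-- When `Z` is a function of `X`, a heavy zero word is typical. -/
theorem negl_zero_heavy_atypical (hP : P ∈ stdSimplex ℝ (X × Y))
    (hW : ∀ x, W x ∈ stdSimplex ℝ (ZMod 2)) (hPQ : IsParityBiasLaw PQ)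
    (hH : condEntropy (lawXZ P W) = 0)
    (T : ∀ n, (Fin n → X × Y) → (Fin n → ZMod 2) → Prop) {C ρ : ℝ} (hρ : 0 < ρ) (δ : ℝ)
    (hT : ∀ n, iidExp Finset.univ P n (fun s => ∑ z, weight (fun i => srcBias Y W (s i)) z *
      ind (T n s z)) ≤ C * (2 : ℝ) ^ (-(n * ρ))) :
    Negl P PQ R fun n s _ q =>
      threshold n δ ≤ pairWeight (k := msgLen R n) (srcBias Y W) (fun t => t) s q 0 0 ∧
        T n s 0 := by
  refine Negl.of_le hP hPQ (tendsto_const_mul_two_rpow_neg C hρ)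
    (Eventually.of_forall fun n => ?_)
  refine (prob_le_srcExp (G := fun s _ => ∑ z, weight (fun i => srcBias Y W (s i)) z *
      ind (T n s z)) hP hPQ fun s q hs hq => ?_).trans ((srcExp_fst hPQ _).le.trans (hT n))
  rw [avgGL_const]
  have hp : ∀ i, srcBias Y W (s i) ∈ Set.Icc (0 : ℝ) 1 := fun i => encBias_mem hW _
  have hnn : ∀ z ∈ (Finset.univ : Finset (Fin n → ZMod 2)),
      0 ≤ weight (fun i => srcBias Y W (s i)) z * ind (T n s z) := fun z _ =>
    mul_nonneg (weight_nonneg hp z) (ind_nonneg _)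
  by_cases h : threshold n δ ≤ pairWeight (k := msgLen R n) (srcBias Y W) (fun t => t) s q 0 0 ∧
      T n s 0
  swap
  · rw [ind_false h]
    exact Finset.sum_nonneg hnn
  · have hne := ((threshold_pos n δ).trans_le h.1).ne'
    rw [pairWeight] at hne
    have hne' := left_ne_zero_of_mul hne
    -- All encoder biases are `0` or `1`, so a nonzero weight equals `1`. The zero word then carries
    -- the whole ideal law given `s`, and `hT` applies to it.
    have h1 : weight (fun i => srcBias Y W (s i)) 0 = 1 := by
      rw [weight_eq_prod] at hne' ⊢
      refine Finset.prod_eq_one fun i _ => ?_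
      have hi := Finset.prod_ne_zero_iff.1 hne' i (Finset.mem_univ i)
      simp only [Pi.zero_apply, bern_zero] at hi ⊢
      rcases encBias_eq_zero_or_one hP hW hH (hs i) with h0 | h0
      · simp [srcBias, h0]
      · simp [srcBias, h0] at hi
    refine le_trans (le_of_eq ?_) (Finset.single_le_sum hnn (Finset.mem_univ 0))
    rw [h1, ind_true h, ind_true h.2, one_mul]

end Zero

/-! ### Tilting a Bernoulli law towards the uniform one -/

section Tilt

/-- The bias `p` moved towards `1/2` by the fraction `η`, on the same support. -/
def tilt (η p : ℝ) : ℝ := if p = 0 ∨ p = 1 then p else p + η * (1 / 2 - p)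

variable {η p : ℝ}

theorem tilt_mem (h0 : 0 ≤ η) (h1 : η ≤ 1) (hp : p ∈ Set.Icc (0 : ℝ) 1) :
    tilt η p ∈ Set.Icc (0 : ℝ) 1 := by
  unfold tilt
  split_ifs
  · exact hp
  · obtain ⟨hp0, hp1⟩ := hp
    constructor <;> nlinarith

/-- The reason for leaving `0` and `1` fixed in `tilt`: a pair charged by the tilted law keeps
positive original weight. -/
theorem bern_ne_zero_of_tilt {b : ZMod 2} (h : bern (tilt η p) b ≠ 0) : bern p b ≠ 0 := by
  intro h0
  apply h
  rcases zmod_two_cases b with rfl | rfl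
  · rw [bern_zero] at h0 ⊢
    have hp : p = 1 := by linarith
    simp [tilt, hp]
  · rw [bern_one] at h0 ⊢
    simp [tilt, h0]

/-- Cross entropy is affine in its first argument, so the cost of tilting is of order `η`. -/
theorem crossEnt_tilt (η p : ℝ) :
    crossEnt (tilt η p) p = Hb p + η * (crossEnt (tilt 1 p) p - Hb p) := by
  rw [← crossEnt_self]
  unfold tilt
  split_ifs
  · ring
  · simp only [crossEnt, sum_zmod_two, bern_zero, bern_one]
    ring

theorem Hb_half : Hb (1 / 2) = 1 := by
  rw [Hb, one_div, Real.binEntropy_two_inv]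
  exact div_self (Real.log_pos (by norm_num)).ne'

/-- Concavity of the entropy on the segment from `p` to `1/2`, where it equals `1`. The gain
vanishes at `p = 1/2`, and at `0` and `1` there is no tilt; hence the exceptional set `{0, 1/2, 1}`.
-/
theorem Hb_add_le_Hb_tilt (h0 : 0 ≤ η) (h1 : η ≤ 1) (hp : p ∈ Set.Icc (0 : ℝ) 1)
    (hp0 : p ≠ 0) (hp1 : p ≠ 1) : Hb p + η * (1 - Hb p) ≤ Hb (tilt η p) := by
  have hc := Real.strictConcave_binEntropy.concaveOn.2 hp half_mem_Icc (sub_nonneg.2 h1) h0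
    (by ring)
  have ht : tilt η p = (1 - η) • p + η • (1 / 2) := by
    rw [tilt, if_neg (by tauto)]
    simp only [smul_eq_mul]
    ring
  rw [← ht] at hc
  have h2 := Hb_half
  simp only [Hb, smul_eq_mul] at hc h2 ⊢
  have hl : 0 < Real.log 2 := Real.log_pos (by norm_num)
  rw [div_eq_one_iff_eq hl.ne'] at h2
  rw [h2] at hc
  rw [le_div_iff₀ hl]
  field_simp
  linarith

theorem Hb_le_Hb_tilt (h0 : 0 ≤ η) (h1 : η ≤ 1) (hp : p ∈ Set.Icc (0 : ℝ) 1) :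
    Hb p ≤ Hb (tilt η p) := by
  by_cases h : p = 0 ∨ p = 1
  · rw [tilt, if_pos h]
  · push Not at h
    have := Hb_add_le_Hb_tilt h0 h1 hp h.1 h.2
    have h2 := mul_nonneg h0 (sub_nonneg.2 (Hb_le_one p))
    linarith

theorem Hb_lt_Hb_tilt (h0 : 0 < η) (h1 : η ≤ 1) (hp : p ∈ Set.Icc (0 : ℝ) 1)
    (hne : p ∉ ({0, 1 / 2, 1} : Set ℝ)) : Hb p < Hb (tilt η p) := by
  simp only [Set.mem_insert_iff, Set.mem_singleton_iff, not_or] at hne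
  have := Hb_add_le_Hb_tilt h0.le h1 hp hne.1 hne.2.2
  have h2 := mul_pos h0 (sub_pos.2 (Hb_lt_one hne.2.1))
  linarith

end Tilt

/-! ### Existence of a heavy word -/

section Existence

/-- If a second law on pairs is spread out and mostly supported on heavy pairs, then some heavy
pair is of the form `(z, z Hᵀ)`, except with small probability. -/
theorem avgGL_no_heavy_le {n : ℕ} (hn : 2 ≤ n) {p a p' a' : Fin n → ℝ}
    (hp' : ∀ i, p' i ∈ Set.Icc (0 : ℝ) 1) (ha' : ∀ i, a' i ∈ Set.Icc (0 : ℝ) 1)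
    (T : (Fin n → ZMod 2) → (Fin n → ZMod 2) → Prop) {θ M : ℝ} (hM : 4 * 2 ^ n < M)
    (h : ∀ z u, weight p' z * weight a' u ≠ 0 → ¬T z u →
      θ ≤ weight p z * weight a u ∧ weight p' z * weight a' u ≤ M⁻¹) :
    avgGL (fun H => ind (∀ z, weight p z * weight a (parity H z) < θ)) ≤
      2 * ∑ z, weight p' z * ∑ u, weight a' u * ind (T z u) +
        (2 ^ n / (M / 2 - 2 * 2 ^ n) + ((2 : ℝ) ^ n - 2)⁻¹) := by
  classical
  set β := ∑ z, weight p' z * ∑ u, weight a' u * ind (T z u) with hβ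
  have hβ0 : 0 ≤ β := Finset.sum_nonneg fun z _ => mul_nonneg (weight_nonneg hp' z)
    (Finset.sum_nonneg fun u _ => mul_nonneg (weight_nonneg ha' u) (ind_nonneg _))
  have h2n : (0 : ℝ) < 2 ^ n := by positivity
  have h4 : (2 : ℝ) ^ 2 ≤ 2 ^ n := pow_le_pow_right₀ (by norm_num) hn
  have hM0 : 0 < M := by linarith
  have hrest : 0 ≤ 2 ^ n / (M / 2 - 2 * 2 ^ n) + ((2 : ℝ) ^ n - 2)⁻¹ :=
    add_nonneg (div_nonneg h2n.le (by linarith)) (inv_nonneg.2 (by linarith))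
  -- When the exceptional mass is at least `1/2`, the term `2 * β` makes the bound trivial.
  by_cases hβ2 : 1 / 2 ≤ β
  · calc _ ≤ avgGL (fun _ : GL (Fin n) (ZMod 2) => (1 : ℝ)) := avgGL_mono fun H => ind_le_one _
      _ = 1 := avgGL_const 1
      _ ≤ _ := by linarith
  · push Not at hβ2
    set G : Finset ((Fin n → ZMod 2) × (Fin n → ZMod 2)) :=
      Finset.univ.filter fun t => weight p' t.1 * weight a' t.2 ≠ 0 ∧ ¬T t.1 t.2 with hG
    set A := G.filter fun t => t.1 ≠ 0 ∧ t.2 ≠ 0 with hA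
    -- `G` carries mass at least `1 - β > 1/2`, while each of its pairs has mass at most `M⁻¹`.
    have hGcard : M / 2 ≤ G.card := by
      have h1 : (1 : ℝ) = ∑ t : (Fin n → ZMod 2) × (Fin n → ZMod 2),
          weight p' t.1 * weight a' t.2 := by
        rw [Fintype.sum_prod_type]
        simp only [← Finset.mul_sum, sum_weight, mul_one]
      have h2 : β = ∑ t : (Fin n → ZMod 2) × (Fin n → ZMod 2),
          weight p' t.1 * weight a' t.2 * ind (T t.1 t.2) := by
        rw [Fintype.sum_prod_type, hβ]
        simp only [Finset.mul_sum, mul_assoc]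
      have h3 : 1 - β ≤ ∑ t ∈ G, M⁻¹ := by
        rw [h1, h2, ← Finset.sum_sub_distrib, hG, Finset.sum_filter]
        refine Finset.sum_le_sum fun t _ => ?_
        by_cases ht : weight p' t.1 * weight a' t.2 = 0
        · rw [ht, if_neg (by simp)]
          simp
        by_cases hT : T t.1 t.2
        · rw [ind_true hT, if_neg (by simp [hT])]
          simp
        · rw [ind_false hT, if_pos ⟨ht, hT⟩]
          simpa using (h t.1 t.2 ht hT).2
      rw [Finset.sum_const, nsmul_eq_mul, ← div_eq_mul_inv, le_div_iff₀ hM0] at h3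
      nlinarith
    -- Pairs with a zero coordinate, at most `2 * 2 ^ n` of them, are dropped because the
    -- second-moment bound needs nonzero pairs.
    have hAcard : M / 2 - 2 * 2 ^ n ≤ A.card := by
      have hsub : G ⊆ A ∪ (Finset.univ.image (fun u => ((0 : Fin n → ZMod 2), u)) ∪
          Finset.univ.image fun z => (z, (0 : Fin n → ZMod 2))) := by
        rintro ⟨z, u⟩ ht
        simp only [Finset.mem_union, hA, Finset.mem_filter, ht, true_and, Finset.mem_image,
          Finset.mem_univ, Prod.mk.injEq]
        by_cases hz : z = 0
        · exact Or.inr (Or.inl ⟨u, hz.symm, rfl⟩)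
        by_cases hu : u = 0
        · exact Or.inr (Or.inr ⟨z, rfl, hu.symm⟩)
        · exact Or.inl ⟨hz, hu⟩
      have hc1 := (Finset.card_le_card hsub).trans ((Finset.card_union_le _ _).trans
        (add_le_add_right (Finset.card_union_le _ _) _))
      have huniv : (Finset.univ : Finset (Fin n → ZMod 2)).card = 2 ^ n := by
        simp [ZMod.card]
      have hc2 : (Finset.univ.image (fun u => ((0 : Fin n → ZMod 2), u))).card ≤ 2 ^ n :=
        Finset.card_image_le.trans huniv.le
      have hc3 : (Finset.univ.image fun z => (z, (0 : Fin n → ZMod 2))).card ≤ 2 ^ n :=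
        Finset.card_image_le.trans huniv.le
      have hc4 : G.card ≤ A.card + (2 ^ n + 2 ^ n) := by omega
      have hc5 : (G.card : ℝ) ≤ A.card + (2 ^ n + 2 ^ n) := by exact_mod_cast hc4
      linarith
    have hApos : (0 : ℝ) < A.card := by linarith
    have hmain := avgGL_forall_not_le A hn (fun t ht => (Finset.mem_filter.1 ht).2)
      (Finset.card_pos.1 (by exact_mod_cast hApos))
    have hle : avgGL (fun H => ind (∀ z, weight p z * weight a (parity H z) < θ)) ≤
        avgGL (fun H => ind (∀ z, (z, parity H z) ∉ A)) := by
      refine avgGL_mono fun H => ind_mono fun hz z hzA => ?_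
      have ht := (Finset.mem_filter.1 (Finset.mem_filter.1 hzA).1).2
      exact absurd (h z (parity H z) ht.1 ht.2).1 (not_le.2 (hz z))
    refine (hle.trans hmain).trans ?_
    have hdiv : (2 : ℝ) ^ n / A.card ≤ 2 ^ n / (M / 2 - 2 * 2 ^ n) :=
      div_le_div_of_nonneg_left h2n.le (by linarith) hAcard
    linarith

variable {X Y : Type*} [Fintype X] [Fintype Y] {P : X × Y → ℝ} {W : X → ZMod 2 → ℝ} {R : ℝ}
  {PQ : ℝ →₀ ℝ}

/-- When `Z` is a function of `X`, a heavy word exists. -/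
theorem exists_heavy_of_condEntropy_eq_zero (hP : P ∈ stdSimplex ℝ (X × Y))
    (hW : ∀ x, W x ∈ stdSimplex ℝ (ZMod 2)) (hH : condEntropy (lawXZ P W) = 0)
    {n k : ℕ} (hk : k ≤ n) {s : Fin n → X × Y} (hs : ∀ i, 0 < P (s i)) {q : Fin (n - k) → ℝ}
    (hq : ∀ j, q j = 1 / 2) {δ : ℝ} (hδ : 0 ≤ δ) (H : GL (Fin n) (ZMod 2)) :
    ∃ z, threshold n δ ≤ pairWeight (srcBias Y W) (fun t => t) s q z (parity H z) := by
  classical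
  -- The value of `Z` determined by the source letter: its source weight is `1`, and with all parity
  -- biases `1/2` the pair weight is exactly `2 ^ (-n)`.
  refine ⟨fun i => if srcBias Y W (s i) = 1 then 1 else 0, ?_⟩
  have h1 : weight (fun i => srcBias Y W (s i))
      (fun i => if srcBias Y W (s i) = 1 then 1 else 0) = 1 := by
    rw [weight_eq_prod]
    refine Finset.prod_eq_one fun i _ => ?_
    rcases encBias_eq_zero_or_one hP hW hH (hs i) with h | h
    · simp [srcBias, h, bern_zero]
    · simp [srcBias, h, bern_one]
  have h2 : q = fun _ => 1 / 2 := funext hq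
  rw [pairWeight, h1, weight_concat_half hk, h2, weight_half, one_mul, ← pow_add,
    show k + (n - k) = n by omega, threshold]
  calc (2 : ℝ) ^ (-(n * (1 + δ))) ≤ (2 : ℝ) ^ (-(n : ℝ)) := by
        refine Real.rpow_le_rpow_of_exponent_le (by norm_num) ?_
        nlinarith [(Nat.cast_nonneg n : (0 : ℝ) ≤ n)]
    _ = (1 / 2) ^ n := by
        rw [Real.rpow_neg (by norm_num), Real.rpow_natCast]
        simp

end Existence

/-! ### Heavy words from the tilted law -/

section Existence

theorem tendsto_two_rpow_atTop {γ : ℝ} (hγ : 0 < γ) :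
    Tendsto (fun n : ℕ => (2 : ℝ) ^ (n * γ)) atTop atTop := by
  have h1 : (1 : ℝ) < 2 ^ γ := Real.one_lt_rpow (by norm_num) hγ
  refine (tendsto_pow_atTop_atTop_of_one_lt h1).congr fun n => ?_
  rw [← Real.rpow_natCast, ← Real.rpow_mul (by norm_num), mul_comm]

theorem threshold_le_of_logb {n : ℕ} {δ x : ℝ} (hx : 0 < x)
    (h : -(n * (1 + δ)) ≤ Real.logb 2 x) : threshold n δ ≤ x :=
  (Real.le_logb_iff_rpow_le (by norm_num) hx).1 h

theorem le_threshold_of_logb {n : ℕ} {δ x : ℝ} (hx : 0 < x)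
    (h : Real.logb 2 x ≤ -(n * (1 + δ))) : x ≤ threshold n δ :=
  (Real.logb_le_iff_le_rpow (by norm_num) hx).1 h

variable {A : Type*} {S : Finset A} {p : A → ℝ}

/-- Under the tilted law, the empirical log-masses of the original and the tilted law exceed
their means by less than `ε` per letter, except with exponentially small probability. -/
theorem exists_tilt_rate (hp : ∀ a ∈ S, 0 ≤ p a) (h1 : ∑ a ∈ S, p a = 1) (pp : A → ℝ)
    (hpp : ∀ a ∈ S, pp a ∈ Set.Icc (0 : ℝ) 1) {η ε : ℝ} (h0 : 0 ≤ η) (hη : η ≤ 1) (hε : 0 < ε)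
    {c : ℝ} (hc : 0 < c) :
    ∃ ρ : ℝ, 0 < ρ ∧ ∀ n l : ℕ, n * c ≤ l →
      iidExp S p l (fun s => ∑ z, weight (fun i => tilt η (pp (s i))) z *
        ind ((l : ℝ) * (∑ a ∈ S, p a * crossEnt (tilt η (pp a)) (pp a) + ε) ≤
            ∑ j, -Real.logb 2 (bern (pp (s j)) (z j)) ∨
          (l : ℝ) * (-∑ a ∈ S, p a * Hb (tilt η (pp a)) + ε) ≤
            ∑ j, Real.logb 2 (bern (tilt η (pp (s j))) (z j)))) ≤
          2 * (2 : ℝ) ^ (-(n * ρ)) := by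
  obtain ⟨ρ, hρ, h⟩ := exists_chernoff_family hp h1 (fun a => tilt η (pp a))
    (fun a ha => tilt_mem h0 hη (hpp a ha)) (ι := Bool)
    (fun i a b => if i then Real.logb 2 (bern (tilt η (pp a)) b) else
      -Real.logb 2 (bern (pp a) b))
    (fun i => if i then -∑ a ∈ S, p a * Hb (tilt η (pp a)) + ε else
      ∑ a ∈ S, p a * crossEnt (tilt η (pp a)) (pp a) + ε)
    (by
      rintro (_ | _)
      · simp only [Bool.false_eq_true, if_false]
        exact lt_add_of_pos_right _ hε
      · simp only [if_true]
        have : ∑ a ∈ S, p a * ∑ b, bern (tilt η (pp a)) b *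
            Real.logb 2 (bern (tilt η (pp a)) b) = -∑ a ∈ S, p a * Hb (tilt η (pp a)) := by
          rw [← Finset.sum_neg_distrib]
          refine Finset.sum_congr rfl fun a _ => ?_
          rw [← crossEnt_self, crossEnt, ← mul_neg, ← Finset.sum_neg_distrib]
          simp
        rw [this]
        exact lt_add_of_pos_right _ hε) hc
  refine ⟨ρ, hρ, fun n l hl => ?_⟩
  have h2 := h n l hl
  simpa [Bool.exists_bool] using h2

variable {X Y : Type*} [Fintype X] [Fintype Y] {P : X × Y → ℝ} {W : X → ZMod 2 → ℝ} {R : ℝ}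
  {PQ : ℝ →₀ ℝ}

/-- The tilted pair law serves as the second law in `avgGL_no_heavy_le`: its typical pairs are
lighter than `2 ^ (-n(1+γ))` under the tilted law, hence numerous, and still heavier than `2 ^
(-n(1+δ))` under the original one. The balance `hQ` centres both exponents at `1`. -/
theorem negl_no_heavy_of_gap (hP : P ∈ stdSimplex ℝ (X × Y))
    (hW : ∀ x, W x ∈ stdSimplex ℝ (ZMod 2)) (hR0 : 0 ≤ R) (hR1 : R < 1)
    (hPQ : IsParityBiasLaw PQ)
    (hQ : ∑ s, P s * Hb (srcBias Y W s) + (1 - R) * ∑ q ∈ PQ.support, PQ q * Hb q = 1 - R)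
    (hgap : ∀ η, 0 < η → η ≤ 1 → 1 - R < ∑ s, P s * Hb (tilt η (srcBias Y W s)) +
      (1 - R) * ∑ q ∈ PQ.support, PQ q * Hb (tilt η q)) {δ : ℝ} (hδ : 0 < δ) :
    Negl P PQ R fun n s H q => ∀ z,
      pairWeight (k := msgLen R n) (srcBias Y W) (fun t => t) s q z (parity H z) <
        threshold n δ := by
  -- By `crossEnt_tilt`, tilting raises the mean exponent of the original weight by `η * K`; `η` is
  -- taken so that this is at most `δ / 4`.
  set KX := ∑ s, P s * (crossEnt (tilt 1 (srcBias Y W s)) (srcBias Y W s) - Hb (srcBias Y W s))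
  set KQ := ∑ q ∈ PQ.support, PQ q * (crossEnt (tilt 1 q) q - Hb q)
  set K := KX + (1 - R) * KQ with hK
  obtain ⟨η, hη0, hη1, hηK⟩ : ∃ η : ℝ, 0 < η ∧ η ≤ 1 ∧ η * K ≤ δ / 4 := by
    have hpos : 0 < 4 * (|K| + 1) := by positivity
    refine ⟨min 1 (δ / (4 * (|K| + 1))), lt_min one_pos (by positivity), min_le_left _ _, ?_⟩
    calc min 1 (δ / (4 * (|K| + 1))) * K ≤ min 1 (δ / (4 * (|K| + 1))) * |K| :=
          mul_le_mul_of_nonneg_left (le_abs_self K) (le_min zero_le_one (by positivity))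
      _ ≤ δ / (4 * (|K| + 1)) * |K| :=
          mul_le_mul_of_nonneg_right (min_le_right _ _) (abs_nonneg _)
      _ ≤ δ / 4 := by
          rw [div_mul_eq_mul_div, div_le_div_iff₀ hpos (by norm_num)]
          nlinarith [abs_nonneg K]
  set tX := ∑ s, P s * Hb (tilt η (srcBias Y W s)) with htX
  set tQ := ∑ q ∈ PQ.support, PQ q * Hb (tilt η q) with htQ
  set cX := ∑ s, P s * crossEnt (tilt η (srcBias Y W s)) (srcBias Y W s) with hcX
  set cQ := ∑ q ∈ PQ.support, PQ q * crossEnt (tilt η q) q with hcQ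
  have hc : cX + (1 - R) * cQ ≤ 1 - R + δ / 4 := by
    have e1 : cX = ∑ s, P s * Hb (srcBias Y W s) + η * KX := by
      simp only [hcX, crossEnt_tilt η, KX, mul_add, Finset.sum_add_distrib, Finset.mul_sum]
      congr 1
      exact Finset.sum_congr rfl fun s _ => by ring
    have e2 : cQ = ∑ q ∈ PQ.support, PQ q * Hb q + η * KQ := by
      simp only [hcQ, crossEnt_tilt η, KQ, mul_add, Finset.sum_add_distrib, Finset.mul_sum]
      congr 1
      exact Finset.sum_congr rfl fun s _ => by ring
    rw [hK] at hηK
    rw [e1, e2]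
    linarith
  have hg := hgap η hη0 hη1
  set gap := tX + (1 - R) * tQ - (1 - R) with hgapdef
  have hgap0 : 0 < gap := by linarith
  -- The other half of the entropy gain is left for the fluctuation `ε` and for rounding.
  set γ := gap / 2 with hγ
  have hγ0 : 0 < γ := by positivity
  set ε := min (δ / 8) (gap / 8) with hε
  have hε0 : 0 < ε := lt_min (by positivity) (by positivity)
  have hεδ : ε ≤ δ / 8 := min_le_left _ _
  have hεg : ε ≤ gap / 8 := min_le_right _ _
  have hRε : (1 - R) * ε ≤ ε := by nlinarith
  obtain ⟨ρ₁, hρ₁, h₁⟩ := exists_tilt_rate (S := Finset.univ) (p := P) (fun a _ => hP.1 a) hP.2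
    (srcBias Y W) (fun a _ => encBias_mem hW _) hη0.le hη1 hε0 (c := 1) one_pos
  obtain ⟨ρ₂, hρ₂, h₂⟩ := exists_tilt_rate (S := PQ.support) (p := PQ) (fun a _ => hPQ.nonneg a)
    hPQ.sum_eq_one (fun t => t) (fun a ha => hPQ.mem_Icc a ha) hη0.le hη1 hε0
    (c := 1 - R) (by linarith)
  -- Writing `k = n - (n - k)`, the exponents contain `n - k` with coefficients `cQ + ε - 1` and `tQ
  -- - ε - 1`; `D` dominates the error of replacing it by `n (1 - R)`.
  set D := |cQ + ε - 1| + |tQ - ε - 1| with hD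
  have hb : Tendsto (fun n : ℕ => 2 * (2 * (2 : ℝ) ^ (-(n * ρ₁)) + 2 * (2 : ℝ) ^ (-(n * ρ₂))) +
      (((2 : ℝ) ^ (n * γ) * (1 / 2) - 2)⁻¹ + ((2 : ℝ) ^ n - 2)⁻¹)) atTop (𝓝 0) := by
    have t1 := ((tendsto_const_mul_two_rpow_neg 2 hρ₁).add
      (tendsto_const_mul_two_rpow_neg 2 hρ₂)).const_mul 2
    have t2 : Tendsto (fun n : ℕ => ((2 : ℝ) ^ (n * γ) * (1 / 2) - 2)⁻¹) atTop (𝓝 0) :=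
      tendsto_inv_atTop_zero.comp (tendsto_atTop_add_const_right _ (-2)
        ((tendsto_two_rpow_atTop hγ0).atTop_mul_const (by norm_num)))
    have t3 : Tendsto (fun n : ℕ => ((2 : ℝ) ^ n - 2)⁻¹) atTop (𝓝 0) :=
      tendsto_inv_atTop_zero.comp (tendsto_atTop_add_const_right _ (-2)
        (tendsto_pow_atTop_atTop_of_one_lt (by norm_num : (1 : ℝ) < 2)))
    simpa using t1.add (t2.add t3)
  refine Negl.of_le hP hPQ hb ?_
  filter_upwards [eventually_ge_atTop 2, (tendsto_two_rpow_atTop hγ0).eventually_gt_atTop 4,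
    (tendsto_natCast_atTop_atTop.atTop_mul_const
      (half_pos hδ)).eventually_ge_atTop D,
    (tendsto_natCast_atTop_atTop.atTop_mul_const
      (half_pos hγ0)).eventually_ge_atTop D] with n hn2 hn4 hnδ hnγ
  have hk := msgLen_le hR1 n
  have hlR := mul_one_sub_le_tail hR0 hR1 n
  have hlabs := abs_tail_mul_sub_le hR0 hR1 n
  have hlk := cast_sub_msgLen hR1 n
  set k := msgLen R n with hkdef
  set T : (Fin n → X × Y) → (Fin n → ZMod 2) → Prop := fun s z =>
    ((n : ℝ) * (cX + ε) ≤ ∑ j, -Real.logb 2 (bern (srcBias Y W (s j)) (z j)) ∨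
      (n : ℝ) * (-tX + ε) ≤ ∑ j, Real.logb 2 (bern (tilt η (srcBias Y W (s j))) (z j))) with hT
  set U : (Fin (n - k) → ℝ) → (Fin (n - k) → ZMod 2) → Prop := fun q v =>
    (((n - k : ℕ) : ℝ) * (cQ + ε) ≤ ∑ j, -Real.logb 2 (bern (q j) (v j)) ∨
      ((n - k : ℕ) : ℝ) * (-tQ + ε) ≤ ∑ j, Real.logb 2 (bern (tilt η (q j)) (v j))) with hU
  have hT1 := h₁ n n (by simp)
  have hU1 := h₂ n (n - k) hlR
  refine (prob_le_srcExp (G := fun s q => 2 * (∑ z, weight (fun i => tilt η (srcBias Y W (s i))) z *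
      ind (T s z) + ∑ v, weight (fun j => tilt η (q j)) v * ind (U q v)) +
      (((2 : ℝ) ^ (n * γ) * (1 / 2) - 2)⁻¹ + ((2 : ℝ) ^ n - 2)⁻¹)) hP hPQ
      fun s q _ hq => ?_).trans ?_
  · have hq' : ∀ j, q j ∈ Set.Icc (0 : ℝ) 1 := fun j => hPQ.mem_Icc _ (hq j)
    have hp : ∀ i, srcBias Y W (s i) ∈ Set.Icc (0 : ℝ) 1 := fun i => encBias_mem hW _
    have hqt : ∀ j, tilt η (q j) ∈ Set.Icc (0 : ℝ) 1 := fun j => tilt_mem hη0.le hη1 (hq' j)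
    have hpt : ∀ i, tilt η (srcBias Y W (s i)) ∈ Set.Icc (0 : ℝ) 1 := fun i =>
      tilt_mem hη0.le hη1 (hp i)
    have hat : ∀ i, concat (fun _ : Fin k => (1 / 2 : ℝ)) (fun j => tilt η (q j)) i ∈
        Set.Icc (0 : ℝ) 1 := concat_mem_Icc (fun _ => half_mem_Icc) hqt
    have h2n : (0 : ℝ) < 2 ^ n := by positivity
    have hM : 4 * 2 ^ n < (threshold n γ)⁻¹ := by
      rw [threshold_inv, mul_comm]
      exact mul_lt_mul_of_pos_left hn4 h2n
    have key := avgGL_no_heavy_le hn2 (p := fun i => srcBias Y W (s i))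
      (a := concat (fun _ : Fin k => (1 / 2 : ℝ)) q) hpt hat
      (fun z u => T s z ∨ U q (tail k u)) (θ := threshold n δ) hM ?_
    · refine key.trans (add_le_add ?_ (add_le_add (le_of_eq ?_) le_rfl))
      · exact mul_le_mul_of_nonneg_left (sum_weight_ind_or_le hk hpt hqt _ _) (by norm_num)
      · have : (2 : ℝ) ^ (n * γ) * (1 / 2) - 2 ≠ 0 := by linarith
        rw [threshold_inv]
        have e : (2 : ℝ) ^ n * 2 ^ (n * γ) / 2 - 2 * 2 ^ n =
            2 ^ n * (2 ^ (n * γ) * (1 / 2) - 2) := by ring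
        rw [e]
        field_simp
    -- Taking logarithms, the typicality inequalities give the lower bound on the original weight
    -- and the upper bound on the tilted one.
    · intro z u hne hTU
      have hne2 : pairWeight (srcBias Y W) (fun t => t) s q z u ≠ 0 := by
        have h3 := left_ne_zero_of_mul hne
        have h4 := right_ne_zero_of_mul hne
        refine mul_ne_zero ?_ ?_
        · rw [weight_eq_prod] at h3 ⊢
          exact Finset.prod_ne_zero_iff.2 fun i hi =>
            bern_ne_zero_of_tilt (Finset.prod_ne_zero_iff.1 h3 i hi)
        · rw [weight_concat_half hk] at h4 ⊢
          refine mul_ne_zero (left_ne_zero_of_mul h4) ?_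
          have h5 := right_ne_zero_of_mul h4
          rw [weight_eq_prod] at h5 ⊢
          exact Finset.prod_ne_zero_iff.2 fun i hi =>
            bern_ne_zero_of_tilt (Finset.prod_ne_zero_iff.1 h5 i hi)
      have l1 := logb_pairWeight hk hne2
      have l2 := logb_pairWeight (pp := fun t => tilt η (srcBias Y W t)) (qq := tilt η) hk hne
      simp only [hT, hU, not_or, not_le, Finset.sum_neg_distrib] at hTU
      obtain ⟨⟨a1, a2⟩, a3, a4⟩ := hTU
      have b1 := (abs_le.1 (hlabs (cQ + ε - 1))).2
      have b2 := (abs_le.1 (hlabs (tQ - ε - 1))).1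
      have b3 : |cQ + ε - 1| ≤ D := le_add_of_nonneg_right (abs_nonneg _)
      have b4 : |tQ - ε - 1| ≤ D := le_add_of_nonneg_left (abs_nonneg _)
      have hn0 : (0 : ℝ) ≤ n := Nat.cast_nonneg n
      constructor
      · refine threshold_le_of_logb (lt_of_le_of_ne (pairWeight_nonneg
          (qq := fun t => t) hp hq' z u) (Ne.symm hne2)) ?_
        change _ ≤ Real.logb 2 (pairWeight (srcBias Y W) (fun t => t) s q z u)
        rw [l1]
        have b5 := mul_le_mul_of_nonneg_left
          (show cX + (1 - R) * cQ + ε + (1 - R) * ε ≤ 1 - R + δ / 2 by linarith) hn0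
        rw [hlk] at a3 b1
        linarith
      · rw [inv_inv]
        refine le_threshold_of_logb (lt_of_le_of_ne (pairWeight_nonneg
          (pp := fun t => tilt η (srcBias Y W t)) (qq := tilt η) hpt hqt z u) (Ne.symm hne)) ?_
        change Real.logb 2 (pairWeight (fun t => tilt η (srcBias Y W t)) (tilt η) s q z u) ≤ _
        rw [l2]
        have b5 := mul_le_mul_of_nonneg_left
          (show 1 - R + γ + γ / 2 ≤ tX + (1 - R) * tQ - ε - (1 - R) * ε by
            rw [hγ]; linarith) hn0
        rw [hlk] at a4 b2
        linarith
  · rw [srcExp_add, srcExp_const_mul, srcExp_add, srcExp_const hP hPQ, srcExp_fst hPQ,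
      srcExp_snd hP]
    exact add_le_add (mul_le_mul_of_nonneg_left (add_le_add hT1 hU1) (by norm_num)) le_rfl

/-- A heavy word exists with probability tending to `1`. -/
theorem negl_no_heavy (hP : P ∈ stdSimplex ℝ (X × Y))
    (hW : ∀ x, W x ∈ stdSimplex ℝ (ZMod 2)) (hR0 : 0 ≤ R) (hR1 : R < 1)
    (hPQ : IsParityBiasLaw PQ)
    (hQ : (PQ.sum fun q w => w * Hb q) = 1 - condEntropy (lawXZ P W) / (1 - R))
    (hnd : condEntropy (lawXZ P W) = 0 ∨
      (∃ x, margFst P x ≠ 0 ∧ W x 1 ∉ ({0, 1 / 2, 1} : Set ℝ)) ∨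
      ∃ q ∈ PQ.support, q ∉ ({0, 1 / 2, 1} : Set ℝ)) {δ : ℝ} (hδ : 0 < δ) :
    Negl P PQ R fun n s H q => ∀ z,
      pairWeight (k := msgLen R n) (srcBias Y W) (fun t => t) s q z (parity H z) <
        threshold n δ := by
  have hR1' : 0 < 1 - R := by linarith
  rcases hnd with hH | hnd
  -- Now `E[H_b(Q)] = 1`, so all parity biases are `1/2` and a heavy word exists for every `H`; the
  -- bad event has probability zero.
  · rw [hH, zero_div, sub_zero] at hQ
    refine Negl.of_le hP hPQ tendsto_const_nhds (Eventually.of_forall fun n => ?_)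
    refine (prob_le_srcExp (G := fun _ _ => 0) hP hPQ fun s q hs hq => ?_).trans
      (srcExp_const hP hPQ _).le
    rw [← avgGL_const (n := n) 0]
    refine avgGL_mono fun H => (ind_false ?_).le
    obtain ⟨z, hz⟩ := exists_heavy_of_condEntropy_eq_zero hP hW hH (msgLen_le hR1 n) hs
      (fun j => eq_half_of_mem_support hPQ hQ (hq j)) hδ.le H
    exact fun h => absurd (h z) (not_lt.2 hz)
  · have hQ' : ∑ s, P s * Hb (srcBias Y W s) +
        (1 - R) * ∑ q ∈ PQ.support, PQ q * Hb q = 1 - R := by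
      have : (∑ q ∈ PQ.support, PQ q * Hb q) = 1 - condEntropy (lawXZ P W) / (1 - R) := hQ
      rw [this, condEntropy_lawXZ hW]
      simp only [srcBias]
      field_simp
      ring
    refine negl_no_heavy_of_gap hP hW hR0 hR1 hPQ hQ' (fun η hη0 hη1 => ?_) hδ
    have hX : ∀ s ∈ (Finset.univ : Finset (X × Y)),
        P s * Hb (srcBias Y W s) ≤ P s * Hb (tilt η (srcBias Y W s)) := fun s _ =>
      mul_le_mul_of_nonneg_left (Hb_le_Hb_tilt hη0.le hη1 (encBias_mem hW _)) (hP.1 s)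
    have hq : ∀ q ∈ PQ.support, PQ q * Hb q ≤ PQ q * Hb (tilt η q) := fun q hq =>
      mul_le_mul_of_nonneg_left (Hb_le_Hb_tilt hη0.le hη1 (hPQ.mem_Icc q hq)) (hPQ.nonneg q)
    have hXs := Finset.sum_le_sum hX
    have hqs := mul_le_mul_of_nonneg_left (Finset.sum_le_sum hq) hR1'.le
    rcases hnd with ⟨x, hx, hxW⟩ | ⟨q₀, hq₀, hq₀'⟩
    · obtain ⟨y, hy⟩ : ∃ y, P (x, y) ≠ 0 := by
        by_contra hcon
        push Not at hcon
        exact hx (Finset.sum_eq_zero fun y _ => hcon y)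
      have := Finset.sum_lt_sum hX ⟨(x, y), Finset.mem_univ _, mul_lt_mul_of_pos_left
        (Hb_lt_Hb_tilt hη0 hη1 (encBias_mem hW _) hxW)
        (lt_of_le_of_ne (hP.1 _) (Ne.symm hy))⟩
      linarith
    · have := mul_lt_mul_of_pos_left (Finset.sum_lt_sum hq ⟨q₀, hq₀, mul_lt_mul_of_pos_left
        (Hb_lt_Hb_tilt hη0 hη1 (hPQ.mem_Icc q₀ hq₀) hq₀')
        (lt_of_le_of_ne (hPQ.nonneg _) (Ne.symm (Finsupp.mem_support_iff.1 hq₀)))⟩) hR1'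
      linarith

end Existence

/-! ### Linearity of the expectation -/

section Expectation

variable {X Y : Type*} [Fintype X] [Fintype Y] {P : X × Y → ℝ} {PQ : ℝ →₀ ℝ} {n k : ℕ}

theorem expect_const (hP : P ∈ stdSimplex ℝ (X × Y)) (hPQ : IsParityBiasLaw PQ) (c : ℝ) :
    expect P PQ n k (fun _ _ _ => c) = c := by
  rw [expect_eq_srcExp]
  simp only [avgGL_const]
  exact srcExp_const hP hPQ c

theorem expect_add (F G : (Fin n → X × Y) → GL (Fin n) (ZMod 2) → (Fin (n - k) → ℝ) → ℝ) :
    expect P PQ n k (fun s H q => F s H q + G s H q) = expect P PQ n k F + expect P PQ n k G := by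
  simp only [expect, mul_add, Finset.sum_add_distrib]

theorem expect_const_mul (c : ℝ)
    (F : (Fin n → X × Y) → GL (Fin n) (ZMod 2) → (Fin (n - k) → ℝ) → ℝ) :
    expect P PQ n k (fun s H q => c * F s H q) = c * expect P PQ n k F := by
  simp only [expect, Finset.mul_sum]
  refine Finset.sum_congr rfl fun s _ => Finset.sum_congr rfl fun H _ =>
    Finset.sum_congr rfl fun q _ => ?_
  ring

end Expectation

/-! ### Empirical distributions -/

section Empirical

variable {X Y : Type*} {n : ℕ}

theorem empirical_eq (x : Fin n → X) (z : Fin n → ZMod 2) (a : X) (b : ZMod 2) :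
    empirical x z a b = (∑ i, ind (x i = a ∧ z i = b)) / n := by
  classical
  simp only [empirical, ind]
  congr 1
  rw [Finset.card_filter, Nat.cast_sum]
  refine Finset.sum_congr rfl fun i _ => ?_
  by_cases h : x i = a ∧ z i = b <;> simp [h]

theorem empirical_nonneg (x : Fin n → X) (z : Fin n → ZMod 2) (a : X) (b : ZMod 2) :
    0 ≤ empirical x z a b := by
  unfold empirical
  positivity

theorem empirical_le_one (x : Fin n → X) (z : Fin n → ZMod 2) (a : X) (b : ZMod 2) :
    empirical x z a b ≤ 1 := by
  rw [empirical_eq]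
  refine div_le_one_of_le₀ ?_ (Nat.cast_nonneg n)
  exact (Finset.sum_le_sum fun i _ => ind_le_one _).trans (by simp)

variable [Fintype X] [Fintype Y] {P : X × Y → ℝ} {W : X → ZMod 2 → ℝ}

/-- Makes the average distortion a fixed linear function of the empirical law, so convergence of the
latter suffices. -/
theorem average_eq_sum_empirical (x : Fin n → X) (z : Fin n → ZMod 2) (d : X → ZMod 2 → ℝ) :
    (∑ i, d (x i) (z i)) / n = ∑ a, ∑ b, empirical x z a b * d a b := by
  have h : ∀ i, d (x i) (z i) = ∑ a, ∑ b, ind (x i = a ∧ z i = b) * d a b := by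
    intro i
    rw [Finset.sum_eq_single (x i), Finset.sum_eq_single (z i)]
    · rw [ind_true ⟨rfl, rfl⟩, one_mul]
    · intro b _ hb
      rw [ind_false fun h => hb h.2.symm, zero_mul]
    · simp
    · intro a _ ha
      exact Finset.sum_eq_zero fun b _ => by rw [ind_false fun h => ha h.1.symm, zero_mul]
    · simp
  simp only [empirical_eq, h]
  rw [Finset.sum_comm, Finset.sum_div]
  refine Finset.sum_congr rfl fun a _ => ?_
  rw [Finset.sum_comm, Finset.sum_div]
  refine Finset.sum_congr rfl fun b _ => ?_
  rw [← Finset.sum_mul]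
  ring

theorem lawXZ_nonneg (hP : P ∈ stdSimplex ℝ (X × Y)) (hW : ∀ x, W x ∈ stdSimplex ℝ (ZMod 2))
    (t : X × ZMod 2) : 0 ≤ lawXZ P W t :=
  mul_nonneg (Finset.sum_nonneg fun _ _ => hP.1 _) ((hW _).1 _)

theorem lawXZ_le_one (hP : P ∈ stdSimplex ℝ (X × Y)) (hW : ∀ x, W x ∈ stdSimplex ℝ (ZMod 2))
    (t : X × ZMod 2) : lawXZ P W t ≤ 1 := by
  have hm0 : ∀ x, 0 ≤ margFst P x := fun x => Finset.sum_nonneg fun _ _ => hP.1 _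
  have hm1 : margFst P t.1 ≤ 1 := by
    have h := hP.2
    rw [Fintype.sum_prod_type] at h
    exact (Finset.single_le_sum (f := margFst P) (fun x _ => hm0 x)
      (Finset.mem_univ t.1)).trans h.le
  have hw1 : W t.1 t.2 ≤ 1 :=
    (Finset.single_le_sum (f := W t.1) (fun b _ => (hW t.1).1 b)
      (Finset.mem_univ t.2)).trans (hW t.1).2.le
  exact mul_le_one₀ hm1 ((hW _).1 _) hw1

theorem mean_ind_eq_lawXZ (hW : ∀ x, W x ∈ stdSimplex ℝ (ZMod 2)) (a : X) (b : ZMod 2) :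
    ∑ s, P s * ∑ b', bern (srcBias Y W s) b' * ind (s.1 = a ∧ b' = b) = lawXZ P W (a, b) := by
  have h : ∀ s : X × Y, ∑ b', bern (srcBias Y W s) b' * ind (s.1 = a ∧ b' = b) =
      W a b * ind (s.1 = a) := by
    intro s
    rw [Finset.sum_eq_single b]
    · by_cases hs : s.1 = a
      · rw [ind_true ⟨hs, rfl⟩, ind_true hs, srcBias, bern_encBias hW, hs]
      · rw [ind_false fun h => hs h.1, ind_false hs, mul_zero, mul_zero]
    · intro b' _ hb
      rw [ind_false fun h => hb h.2, mul_zero]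
    · simp
  simp only [h]
  rw [Fintype.sum_prod_type, Finset.sum_eq_single a]
  · simp only [ind_true, mul_one, lawXZ, margFst, Finset.sum_mul]
  · intro x _ hx
    exact Finset.sum_eq_zero fun y _ => by rw [ind_false hx, mul_zero, mul_zero]
  · simp

end Empirical

/-! ### Convergence of the empirical distribution -/

section Main

variable {X Y : Type*} [Fintype X] [Fintype Y] {P : X × Y → ℝ} {W : X → ZMod 2 → ℝ} {R : ℝ}
  {PQ : ℝ →₀ ℝ}

/-- `(s, z)` is atypical: an empirical frequency of `(x, z)` is off by `ε`, or the decoder weight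
of `z` is too small. -/
def AtypicalWord (P : X × Y → ℝ) (W : X → ZMod 2 → ℝ) (ε ε' : ℝ) (n : ℕ) (s : Fin n → X × Y)
    (z : Fin n → ZMod 2) : Prop :=
  (∃ a b, ε ≤ |empirical (fun i => (s i).1) z a b - lawXZ P W (a, b)|) ∨
    (n : ℝ) * (∑ t : X × Y, P t * crossEnt (srcBias Y W t) (sideBias P W t) + ε') ≤
      ∑ i, -Real.logb 2 (bern (sideBias P W (s i)) (z i))

/-- `(q, v)` is atypical: the weight of the parity bits `v` is too small. -/
def AtypicalParity (PQ : ℝ →₀ ℝ) (ε' : ℝ) (m : ℕ) (q : Fin m → ℝ) (v : Fin m → ZMod 2) : Prop :=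
  (m : ℝ) * ((PQ.sum fun q w => w * Hb q) + ε') ≤ ∑ j, -Real.logb 2 (bern (q j) (v j))

/-- Atypicality is a finite union of one-sided deviations: `none` stands for the decoder log-weight,
`some (a, b, ±)` for the two sides of each empirical frequency. -/
theorem exists_rate_atypicalWord (hP : P ∈ stdSimplex ℝ (X × Y))
    (hW : ∀ x, W x ∈ stdSimplex ℝ (ZMod 2)) {ε ε' : ℝ} (hε : 0 < ε) (hε' : 0 < ε') :
    ∃ C ρ : ℝ, 0 ≤ C ∧ 0 < ρ ∧ ∀ n, iidExp Finset.univ P n (fun s =>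
      ∑ z, weight (fun i => srcBias Y W (s i)) z * ind (AtypicalWord P W ε ε' n s z)) ≤
        C * (2 : ℝ) ^ (-(n * ρ)) := by
  obtain ⟨ρ, hρ, h⟩ := exists_chernoff_family (S := Finset.univ) (p := P) (fun a _ => hP.1 a) hP.2
    (srcBias Y W) (fun a _ => encBias_mem hW _) (ι := Option (X × ZMod 2 × Bool))
    (fun i s b => i.elim (-Real.logb 2 (bern (sideBias P W s) b)) fun t =>
      if t.2.2 then ind (s.1 = t.1 ∧ b = t.2.1) else -ind (s.1 = t.1 ∧ b = t.2.1))
    (fun i => i.elim (∑ t : X × Y, P t * crossEnt (srcBias Y W t) (sideBias P W t) + ε')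
      fun t => if t.2.2 then lawXZ P W (t.1, t.2.1) + ε else -lawXZ P W (t.1, t.2.1) + ε)
    (by
      rintro (_ | ⟨a, b, _ | _⟩)
      · exact lt_add_of_pos_right _ hε'
      · simp only [Option.elim_some, Bool.false_eq_true, if_false]
        rw [← mean_ind_eq_lawXZ (P := P) hW a b]
        simp only [mul_neg, Finset.sum_neg_distrib]
        exact lt_add_of_pos_right _ hε
      · simp only [Option.elim_some, if_true]
        rw [mean_ind_eq_lawXZ hW a b]
        exact lt_add_of_pos_right _ hε) (c := 1) one_pos
  refine ⟨_, ρ, Nat.cast_nonneg _, hρ, fun n => le_trans (iidExp_mono (fun a _ => hP.1 a)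
    fun s _ _ => Finset.sum_le_sum fun z _ => ?_) (h n n (by simp))⟩
  refine mul_le_mul_of_nonneg_left (ind_mono ?_) (weight_nonneg (fun i => encBias_mem hW _) z)
  rintro (⟨a, b, hab⟩ | hz)
  · rcases Nat.eq_zero_or_pos n with rfl | hn
    -- For `n = 0` the frequencies are divisions by zero, but the deviation inequality reads `0 ≤
    -- 0`.
    · exact ⟨none, by simp⟩
    have hn' : (0 : ℝ) < n := by exact_mod_cast hn
    rw [empirical_eq] at hab
    rcases le_abs.1 hab with h1 | h1
    · refine ⟨some (a, b, true), ?_⟩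
      simp only [Option.elim_some, if_true]
      have h2 := (le_div_iff₀ hn').1 (le_sub_iff_add_le.1 h1)
      linarith
    · rw [neg_sub] at h1
      refine ⟨some (a, b, false), ?_⟩
      simp only [Option.elim_some, Bool.false_eq_true, if_false, Finset.sum_neg_distrib]
      have h2 := (div_le_iff₀ hn').1 (le_sub_comm.1 h1)
      linarith
  · exact ⟨none, hz⟩

theorem exists_rate_atypicalParity (hR0 : 0 ≤ R) (hR1 : R < 1) (hPQ : IsParityBiasLaw PQ) {ε' : ℝ}
    (hε' : 0 < ε') :
    ∃ ρ : ℝ, 0 < ρ ∧ ∀ n, iidExp PQ.support PQ (n - msgLen R n) (fun q =>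
      ∑ v, weight q v * ind (AtypicalParity PQ ε' (n - msgLen R n) q v)) ≤
        (2 : ℝ) ^ (-(n * ρ)) := by
  obtain ⟨ρ, hρ, h⟩ := exists_chernoff_rate (S := PQ.support) (p := PQ)
    (fun a _ => hPQ.nonneg a) hPQ.sum_eq_one (fun t => t) (fun a ha => hPQ.mem_Icc a ha)
    (fun q b => -Real.logb 2 (bern q b)) (m := (PQ.sum fun q w => w * Hb q) + ε')
    (by
      simp only [Finsupp.sum, ← crossEnt_self, crossEnt]
      exact lt_add_of_pos_right _ hε') (c := 1 - R) (by linarith)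
  exact ⟨ρ, hρ, fun n => h n _ (mul_one_sub_le_tail hR0 hR1 n)⟩

/-- A heavy zero word is typical. -/
theorem exists_negl_zero_atypical (hP : P ∈ stdSimplex ℝ (X × Y))
    (hW : ∀ x, W x ∈ stdSimplex ℝ (ZMod 2)) (hR0 : 0 ≤ R) (hR1 : R < 1)
    (hPQ : IsParityBiasLaw PQ)
    (hQ : (PQ.sum fun q w => w * Hb q) = 1 - condEntropy (lawXZ P W) / (1 - R))
    {ε ε' : ℝ} (hε : 0 < ε) (hε' : 0 < ε') :
    ∃ ρ : ℝ, 0 < ρ ∧ ∀ δ, 0 ≤ δ → δ < ρ → Negl P PQ R fun n s _ q =>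
      threshold n δ ≤ pairWeight (k := msgLen R n) (srcBias Y W) (fun t => t) s q 0 0 ∧
        (AtypicalWord P W ε ε' n s 0 ∨ AtypicalParity PQ ε' _ q (tail (msgLen R n) 0)) := by
  have hR1' : 0 < 1 - R := by linarith
  by_cases hH : condEntropy (lawXZ P W) = 0
  · obtain ⟨C, ρ, -, hρ, hT⟩ := exists_rate_atypicalWord hP hW hε hε'
    rw [hH, zero_div, sub_zero] at hQ
    refine ⟨ρ, hρ, fun δ _ _ => Negl.mono hP hPQ
      (negl_zero_heavy_atypical hP hW hPQ hH _ hρ δ hT) ?_⟩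
    filter_upwards [eventually_gt_atTop 0] with n hn s H q hs hq
    rintro ⟨h1, h2 | h2⟩
    · exact ⟨h1, h2⟩
    · exfalso
      have hl := mul_one_sub_le_tail hR0 hR1 n
      have hn' : (0 : ℝ) < n := by exact_mod_cast hn
      have hlpos := (mul_pos hn' hR1').trans_le hl
      rw [AtypicalParity, hQ] at h2
      -- Every parity bit costs exactly one bit, so the total cannot exceed its mean by the factor
      -- `1 + ε'`.
      have h3 : ∀ j, -Real.logb 2 (bern (q j) (tail (msgLen R n) 0 j)) = 1 := fun j => by
        rw [eq_half_of_mem_support hPQ hQ (hq j), bern_half, one_div, Real.logb_inv,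
          Real.logb_self_eq_one (by norm_num), neg_neg]
      simp only [h3, Finset.sum_const, Finset.card_univ, Fintype.card_fin, nsmul_eq_mul] at h2
      nlinarith [mul_pos hlpos hε']
  -- If all biases were `1/2`, then `E[H_b(Q)] = 1` and `H(Z|X) = 0`.
  · obtain ⟨q₀, hq₀, hne⟩ : ∃ q₀ ∈ PQ.support, q₀ ≠ 1 / 2 := by
      by_contra hcon
      push Not at hcon
      have h1 : (PQ.sum fun q w => w * Hb q) = 1 := by
        rw [← hPQ.sum_eq_one]
        exact Finset.sum_congr rfl fun q hq => by
          simp only [hcon q hq, Hb_half, mul_one]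
      rw [h1] at hQ
      have h2 : condEntropy (lawXZ P W) / (1 - R) = 0 := by linarith
      exact hH ((div_eq_zero_iff.1 h2).resolve_right hR1'.ne')
    obtain ⟨ρ, hρ, h⟩ := exists_negl_zero_heavy (W := W) hP hW hR0 hR1 hPQ hq₀ hne
    exact ⟨ρ, hρ, fun δ h0 hδ => Negl.mono hP hPQ (h δ h0 hδ)
      (Eventually.of_forall fun n s H q _ _ hE => hE.1)⟩

/-- A heavy typical word is also heavy for the decoder that knows its first parity bits. -/
theorem eventually_threshold_le_msgWeight (hP : P ∈ stdSimplex ℝ (X × Y))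
    (hW : ∀ x, W x ∈ stdSimplex ℝ (ZMod 2)) (hR0 : 0 ≤ R) (hR1 : R < 1)
    (hPQ : IsParityBiasLaw PQ) {c ε ε' : ℝ} (hc : 0 < c) (hε' : 0 ≤ ε') (hεc : 4 * ε' ≤ c)
    (hsum : ∑ t : X × Y, P t * crossEnt (srcBias Y W t) (sideBias P W t) +
      (1 - R) * (PQ.sum fun q w => w * Hb q) = 1 - 2 * c) (δ : ℝ) :
    ∀ᶠ n in atTop, ∀ (s : Fin n → X × Y) (q : Fin (n - msgLen R n) → ℝ) (z u : Fin n → ZMod 2),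
      (∀ i, 0 < P (s i)) → (∀ j, q j ∈ PQ.support) →
      threshold n δ ≤ pairWeight (srcBias Y W) (fun t => t) s q z u →
      ¬AtypicalWord P W ε ε' n s z → ¬AtypicalParity PQ ε' _ q (tail (msgLen R n) u) →
      threshold n (-c) ≤ msgWeight (sideBias P W) s (head (msgLen_le hR1 n) u) q z u := by
  set EQ := PQ.sum fun q w => w * Hb q with hEQ
  -- From the exponent `1 - 2c` to `1 - c` there is a margin `c`: half absorbs the two deviations
  -- `ε'`, half absorbs the rounding of `nR`.
  filter_upwards [(tendsto_natCast_atTop_atTop.atTop_mul_const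
      (half_pos hc)).eventually_ge_atTop |EQ + ε'|] with n hn s q z u hs hq hth hT hU
  have hk := msgLen_le hR1 n
  have hlabs := (abs_le.1 (abs_tail_mul_sub_le hR0 hR1 n (EQ + ε'))).2
  have hne := ((threshold_pos n δ).trans_le hth).ne'
  rw [pairWeight, weight_concat_half hk] at hne
  have hp := left_ne_zero_of_mul hne
  have hv := right_ne_zero_of_mul (right_ne_zero_of_mul hne)
  have hd : 0 < weight (fun i => sideBias P W (s i)) z := by
    rw [weight_eq_prod] at hp ⊢
    refine Finset.prod_pos fun i hi => bern_decBias_pos hP hW (hs i) ?_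
    exact lt_of_le_of_ne (bern_nonneg (encBias_mem hW _) _)
      (Ne.symm (Finset.prod_ne_zero_iff.1 hp i hi))
  have hv0 : 0 < weight q (tail (msgLen R n) u) :=
    lt_of_le_of_ne (weight_nonneg (fun j => hPQ.mem_Icc _ (hq j)) _) (Ne.symm hv)
  rw [msgWeight, weight_concat hk, weight_val_self, one_mul]
  refine threshold_le_of_logb (mul_pos hd hv0) ?_
  rw [Real.logb_mul hd.ne' hv, logb_weight hd.ne', logb_weight hv]
  simp only [AtypicalWord, AtypicalParity, not_or, not_le, Finset.sum_neg_distrib] at hT hU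
  rw [← hEQ] at hU
  have h1 := hT.2
  have hn0 : (0 : ℝ) ≤ n := Nat.cast_nonneg n
  have h2 : (1 - R) * ε' ≤ ε' := by nlinarith
  have h3 := mul_le_mul_of_nonneg_left
    (show ∑ t : X × Y, P t * crossEnt (srcBias Y W t) (sideBias P W t) + ε' +
      (1 - R) * (EQ + ε') ≤ 1 - c - c / 2 by linarith) hn0
  linarith

/-- The empirical joint distribution of source and reconstruction converges in probability. -/
theorem negl_empirical (hP : P ∈ stdSimplex ℝ (X × Y))
    (hW : ∀ x, W x ∈ stdSimplex ℝ (ZMod 2)) (hR1 : R < 1)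
    (hR : condMutualInfo (lawXYZ P W) < R) (hPQ : IsParityBiasLaw PQ)
    (hQ : (PQ.sum fun q w => w * Hb q) = 1 - condEntropy (lawXZ P W) / (1 - R))
    (hnd : condEntropy (lawXZ P W) = 0 ∨
      (∃ x, margFst P x ≠ 0 ∧ W x 1 ∉ ({0, 1 / 2, 1} : Set ℝ)) ∨
      ∃ q ∈ PQ.support, q ∉ ({0, 1 / 2, 1} : Set ℝ))
    (f : ∀ n : ℕ, GL (Fin n) (ZMod 2) → (Fin n → ℝ) → (Fin n → ℝ) → (Fin n → ZMod 2))
    (hf : ∀ n, IsQuery (f n)) {ε : ℝ} (hε : 0 < ε) :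
    Negl P PQ R fun n s H q => ∃ a b, ε ≤ |empirical (fun i => (s i).1)
      (reconstruct (f n) (msgLen_le hR1 n) P W s H q) a b - lawXZ P W (a, b)| := by
  have hI := condMutualInfo_nonneg hP hW
  have hR0 : 0 < R := hI.trans_lt hR
  -- Half the rate margin; the typical decoder exponent is `1 - 2c` and the decoding threshold is
  -- put at `1 - c`.
  set c := (R - condMutualInfo (lawXYZ P W)) / 2 with hc
  have hc0 : 0 < c := by rw [hc]; linarith
  have hsum : ∑ t : X × Y, P t * crossEnt (srcBias Y W t) (sideBias P W t) +
      (1 - R) * (PQ.sum fun q w => w * Hb q) = 1 - 2 * c := by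
    have h1 := condMutualInfo_lawXYZ hP hW
    have h2 : (1 - R) * (1 - condEntropy (lawXZ P W) / (1 - R)) =
        1 - R - condEntropy (lawXZ P W) := by
      have : 1 - R ≠ 0 := by linarith
      field_simp
    rw [hQ, h2, hc]
    simp only [srcBias, sideBias]
    linarith
  have hc4 : 0 < c / 4 := by positivity
  obtain ⟨C, ρ₁, hC, hρ₁, hT⟩ := exists_rate_atypicalWord (P := P) (W := W) hP hW hε hc4
  obtain ⟨ρ₂, hρ₂, hU⟩ := exists_rate_atypicalParity hR0.le hR1 hPQ hc4
  obtain ⟨ρ₃, hρ₃, hZ⟩ := exists_negl_zero_atypical hP hW hR0.le hR1 hPQ hQ hε hc4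
  -- `δ` must lie below all the rates: those of atypicality, of the zero word, and `c` and `R` for
  -- confusion.
  set ρ := min (min ρ₁ ρ₂) (min ρ₃ (min c R)) with hρdef
  have hρ : 0 < ρ := lt_min (lt_min hρ₁ hρ₂) (lt_min hρ₃ (lt_min hc0 hR0))
  have hle1 : min ρ₁ ρ₂ ≤ ρ₁ := min_le_left _ _
  have hle2 : min ρ₁ ρ₂ ≤ ρ₂ := min_le_right _ _
  set δ := ρ / 2 with hδ
  have hδ0 : 0 < δ := by positivity
  have hδρ : δ < ρ := by rw [hδ]; linarith
  have hδ12 : δ < min ρ₁ ρ₂ := hδρ.trans_le (min_le_left _ _)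
  have hδ3 : δ < ρ₃ := hδρ.trans_le ((min_le_right _ _).trans (min_le_left _ _))
  have hδc : δ < c := hδρ.trans_le
    ((min_le_right _ _).trans ((min_le_right _ _).trans (min_le_left _ _)))
  have hδR : δ < R := hδρ.trans_le
    ((min_le_right _ _).trans ((min_le_right _ _).trans (min_le_right _ _)))
  have N1 := negl_no_heavy hP hW hR0.le hR1 hPQ hQ hnd hδ0
  have N2 := negl_heavy_atypical hP hW hR1 hPQ (AtypicalWord P W ε (c / 4))
    (AtypicalParity PQ (c / 4)) (C := C + 1) hδ12
    (fun n => (hT n).trans (mul_le_mul (by linarith) (two_rpow_neg_le hle1 n)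
      (by positivity) (by linarith)))
    (fun n => (hU n).trans (le_trans (two_rpow_neg_le hle2 n)
      (le_mul_of_one_le_left (by positivity) (by linarith))))
  have N3 := hZ δ hδ0.le hδ3
  have N4 := negl_confusion hP hW hR1 hPQ hc0 hδc hδR
  refine Negl.mono hP hPQ (Negl.or hP hPQ N1 (Negl.or hP hPQ N2 (Negl.or hP hPQ N3 N4))) ?_
  filter_upwards [eventually_threshold_le_msgWeight hP hW hR0.le hR1 hPQ hc0 hc4.le
    (by linarith) hsum δ (ε := ε)] with n hn s H q hs hq hE
  have hk := msgLen_le hR1 n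
  have hq' : ∀ j, q j ∈ Set.Icc (0 : ℝ) 1 := fun j => hPQ.mem_Icc _ (hq j)
  set z := encWord (f n) (encBias W) H q (fun i => (s i).1) with hz
  have hzmax : ∀ z', pairWeight (srcBias Y W) (fun t => t) s q z' (parity H z') ≤
      pairWeight (srcBias Y W) (fun t => t) s q z (parity H z) :=
    hf n H (fun i => encBias W (s i).1) (concat (fun _ : Fin (msgLen R n) => (1 / 2 : ℝ)) q)
      (fun i => encBias_mem hW _) (concat_mem_Icc (fun _ => half_mem_Icc) hq')
  set z' := reconstruct (f n) hk P W s H q with hz'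
  have hzmax' : msgWeight (sideBias P W) s (head hk (parity H z)) q z (parity H z) ≤
      msgWeight (sideBias P W) s (head hk (parity H z)) q z' (parity H z') :=
    hf n H (fun i => decBias P W (s i).2)
      (concat (fun i : Fin (msgLen R n) => ((head hk (parity H z) i).val : ℝ)) q)
      (fun i => decBias_mem hP hW _) (concat_mem_Icc (fun i => val_mem_Icc _) hq') z
  -- Outside the four events the encoder's maximizer is heavy because some word is, hence typical,
  -- hence heavy for the decoder. The decoder's maximizer is at least as heavy, so absence of
  -- confusion gives `z = z'`.
  by_contra hcon
  rw [not_or, not_or, not_or] at hcon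
  obtain ⟨h1, h2, h3, h4⟩ := hcon
  push Not at h1
  obtain ⟨w, hw⟩ := h1
  have hheavy := hw.trans (hzmax w)
  have htyp : ¬(AtypicalWord P W ε (c / 4) n s z ∨
      AtypicalParity PQ (c / 4) _ q (tail (msgLen R n) (parity H z))) := by
    intro hbad
    by_cases hz0 : z = 0
    · rw [hz0, parity_zero] at hheavy hbad
      exact h3 ⟨hheavy, hbad⟩
    · exact h2 ⟨z, hz0, hheavy, hbad⟩
  rw [not_or] at htyp
  have hdec := (hn s q z (parity H z) hs hq hheavy htyp.1 htyp.2).trans hzmax'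
  have heq : z = z' := by
    by_contra hne
    exact h4 ⟨z, z', hne, hheavy, hdec⟩
  rw [← heq] at hE
  exact htyp.1 (Or.inl hE)

/-- The expected distortion converges. -/
theorem tendsto_expect_distortion (hP : P ∈ stdSimplex ℝ (X × Y))
    (hW : ∀ x, W x ∈ stdSimplex ℝ (ZMod 2)) (hPQ : IsParityBiasLaw PQ)
    (z : ∀ n, (Fin n → X × Y) → GL (Fin n) (ZMod 2) → (Fin (n - msgLen R n) → ℝ) →
      (Fin n → ZMod 2))
    (h : ∀ ε : ℝ, 0 < ε → Negl P PQ R fun n s H q =>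
      ∃ a b, ε ≤ |empirical (fun i => (s i).1) (z n s H q) a b - lawXZ P W (a, b)|)
    (d : X → ZMod 2 → ℝ) :
    Tendsto (fun n : ℕ => expect P PQ n (msgLen R n) fun s H q =>
      (∑ i, d (s i).1 (z n s H q i)) / n) atTop (𝓝 (∑ a, ∑ b, lawXZ P W (a, b) * d a b)) := by
  set L := ∑ a, ∑ b, lawXZ P W (a, b) * d a b with hL
  set C := 1 + ∑ a, ∑ b, |d a b| with hC
  have hC0 : 0 < C := by
    have : 0 ≤ ∑ a, ∑ b, |d a b| :=
      Finset.sum_nonneg fun a _ => Finset.sum_nonneg fun b _ => abs_nonneg _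
    linarith
  rw [Metric.tendsto_atTop']
  intro e he
  -- The error is at most `C * ε` from the good event plus `C` times the bad probability, itself
  -- below `ε`; together less than `e`.
  set ε := e / (2 * C) with hε
  have hε0 : 0 < ε := by positivity
  have hCε : C * ε = e / 2 := by rw [hε]; field_simp
  have hev := (h ε hε0).eventually_lt_const hε0
  obtain ⟨N, hN⟩ := eventually_atTop.1 hev
  refine ⟨N, fun n hn => ?_⟩
  have hprob := hN n hn.le
  set E : (Fin n → X × Y) → GL (Fin n) (ZMod 2) → (Fin (n - msgLen R n) → ℝ) → Prop :=
    fun s H q =>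
      ∃ a b, ε ≤ |empirical (fun i => (s i).1) (z n s H q) a b - lawXZ P W (a, b)| with hE
  have hpt : ∀ s H q, |(∑ i, d (s i).1 (z n s H q i)) / n - L| ≤ C * (ε + ind (E s H q)) := by
    intro s H q
    rw [average_eq_sum_empirical (fun i => (s i).1) (z n s H q) d, hL]
    simp only [← Finset.sum_sub_distrib, ← sub_mul]
    have hdiff : ∀ a b, |empirical (fun i => (s i).1) (z n s H q) a b - lawXZ P W (a, b)| ≤
        ε + ind (E s H q) := by
      intro a b
      by_cases hb : E s H q
      · rw [ind_true hb, abs_le]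
        have h1 := empirical_nonneg (fun i => (s i).1) (z n s H q) a b
        have h2 := empirical_le_one (fun i => (s i).1) (z n s H q) a b
        have h3 := lawXZ_nonneg hP hW (a, b)
        have h4 := lawXZ_le_one hP hW (a, b)
        constructor <;> linarith
      · rw [ind_false hb, add_zero]
        by_contra hlt
        exact hb ⟨a, b, (not_le.1 hlt).le⟩
    have hnn : 0 ≤ ε + ind (E s H q) := add_nonneg hε0.le (ind_nonneg _)
    calc |∑ a, ∑ b, (empirical (fun i => (s i).1) (z n s H q) a b - lawXZ P W (a, b)) * d a b|
        ≤ ∑ a, ∑ b, |(empirical (fun i => (s i).1) (z n s H q) a b -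
            lawXZ P W (a, b)) * d a b| :=
          (Finset.abs_sum_le_sum_abs _ _).trans
            (Finset.sum_le_sum fun a _ => Finset.abs_sum_le_sum_abs _ _)
      _ ≤ ∑ a, ∑ b, (ε + ind (E s H q)) * |d a b| := by
          refine Finset.sum_le_sum fun a _ => Finset.sum_le_sum fun b _ => ?_
          rw [abs_mul]
          exact mul_le_mul_of_nonneg_right (hdiff a b) (abs_nonneg _)
      _ = (∑ a, ∑ b, |d a b|) * (ε + ind (E s H q)) := by
          simp only [← Finset.mul_sum]
          ring
      _ ≤ C * (ε + ind (E s H q)) := mul_le_mul_of_nonneg_right (by linarith) hnn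
  have hval : ∀ σ τ : ℝ, expect P PQ n (msgLen R n) (fun s H q => σ + τ * ind (E s H q)) =
      σ + τ * prob P PQ n (msgLen R n) E := by
    intro σ τ
    rw [expect_add, expect_const hP hPQ, expect_const_mul]
    rfl
  have hup := expect_mono (n := n) (k := msgLen R n) hP hPQ
    (F := fun s H q => (∑ i, d (s i).1 (z n s H q i)) / n)
    (G := fun s H q => (L + C * ε) + C * ind (E s H q))
    fun s H q _ _ => by linarith [(abs_le.1 (hpt s H q)).2]
  have hlo := expect_mono (n := n) (k := msgLen R n) hP hPQ
    (F := fun s H q => (L - C * ε) + (-C) * ind (E s H q))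
    (G := fun s H q => (∑ i, d (s i).1 (z n s H q i)) / n)
    fun s H q _ _ => by linarith [(abs_le.1 (hpt s H q)).1]
  rw [hval] at hup hlo
  have hCp : C * prob P PQ n (msgLen R n) E < C * ε := mul_lt_mul_of_pos_left hprob hC0
  rw [Real.dist_eq, abs_lt]
  constructor <;> linarith

end Main

end WPC

end

theorem mainTheorem4 {X Y : Type*} [Fintype X] [Fintype Y]
    (P : X × Y → ℝ) (hP : P ∈ stdSimplex ℝ (X × Y))
    (W : X → ZMod 2 → ℝ) (hW : ∀ x, W x ∈ stdSimplex ℝ (ZMod 2))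
    (R : ℝ) (hR1 : R < 1)
    (hR : WPC.condMutualInfo (WPC.lawXYZ P W) < R)
    (PQ : ℝ →₀ ℝ) (hPQ : WPC.IsParityBiasLaw PQ)
    (hQ : (PQ.sum fun q w => w * WPC.Hb q) =
      1 - WPC.condEntropy (WPC.lawXZ P W) / (1 - R))
    (hnd : WPC.condEntropy (WPC.lawXZ P W) = 0 ∨
      (∃ x, WPC.margFst P x ≠ 0 ∧ W x 1 ∉ ({0, 1 / 2, 1} : Set ℝ)) ∨
      ∃ q ∈ PQ.support, q ∉ ({0, 1 / 2, 1} : Set ℝ))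
    (f : ∀ n : ℕ, GL (Fin n) (ZMod 2) → (Fin n → ℝ) → (Fin n → ℝ) → (Fin n → ZMod 2))
    (hf : ∀ n, WPC.IsQuery (f n)) :
    (∀ ε : ℝ, 0 < ε →
      Tendsto (fun n : ℕ => WPC.prob P PQ n (WPC.msgLen R n) fun s H q =>
          ∃ a b, ε ≤ |WPC.empirical (fun i => (s i).1)
            (WPC.reconstruct (f n) (WPC.msgLen_le hR1 n) P W s H q) a b -
              WPC.lawXZ P W (a, b)|)
        atTop (𝓝 0)) ∧
    ∀ d : X → ZMod 2 → ℝ,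
      Tendsto (fun n : ℕ => WPC.expect P PQ n (WPC.msgLen R n) fun s H q =>
          (∑ i, d (s i).1
            (WPC.reconstruct (f n) (WPC.msgLen_le hR1 n) P W s H q i)) / n)
        atTop (𝓝 (∑ x, ∑ z, WPC.lawXZ P W (x, z) * d x z)) := by
  refine ⟨fun ε hε => ?_, fun d => ?_⟩
  · exact WPC.negl_empirical hP hW hR1 hR hPQ hQ hnd f hf hε
  · exact WPC.tendsto_expect_distortion hP hW hPQ
      (fun n s H q => WPC.reconstruct (f n) (WPC.msgLen_le hR1 n) P W s H q)
      (fun ε hε => WPC.negl_empirical hP hW hR1 hR hPQ hQ hnd f hf hε) d
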